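/- A $C$-edge-colored graph is a finite simple undirected graph $G=(V,E)$ together with a finite set $C$ of colors and a map $f_C:E\to 2^C$. A path is *uni-color* if some color $c\in C$ belongs to $f_C(e)$ for all its edges $e$. Two $st$-paths are *disjoint* if they share no vertex other than $s$ and $t$. The problem MaxCDP asks, given $C$, a $C$-edge-colored graph $G$ and two distinct vertices $s,t\in V$, for the maximum size of a set of pairwise disjoint uni-color $st$-paths. The *distance to disjoint paths* $d(G)$ is the minimum number of vertices whose removal from $G$ leaves a disjoint union of paths (every connected component is a path, possibly a single vertex). **Theorem.** MaxCDP is in XP when parameterized by the distance to disjoint paths: there are an algorithm and a function $g:\mathbb N\to\mathbb N$ such that, on every instance $I=(C,G,s,t)$, the algorithm computes the maximum number of pairwise disjoint uni-color $st$-paths of $G$ in time at most $|I|^{g(d(G))}$, where $|I|$ is the size of the instance. The algorithm is given neither $d(G)$ nor a deletion set. In particular, for every constant $d$, MaxCDP is solvable in polynomial time on graphs at distance at most $d$ from disjoint paths. Here an algorithm is a program for a random access machine over the natural numbers with addition and truncated subtraction, whose unit-cost running time is polynomially related to Turing machine time. The instance is given as $|V|$, $|C|$, $s$, $t$, the adjacency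 matrix, and, for each pair of vertices, the 0-1 vector of the colors of the corresponding edge. -/

import Mathlib

/-! ### Edge-coloured graphs, uni-colour paths, and MaxCDP -/

section Graph

variable {V C : Type*} {G : SimpleGraph V}

/-- A walk is uni-colour if some single colour belongs to the colour sets of all its edges. -/
def SimpleGraph.Walk.IsUniColor (f : G.edgeSet → Finset C) {x y : V} (p : G.Walk x y) : Prop :=
  ∃ c : C, ∀ (e : Sym2 V) (he : e ∈ p.edges), c ∈ f ⟨e, p.edges_subset_edgeSet he⟩

/-- Two paths between `s` and `t` are (internally) disjoint if they share no internal vertex,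
i.e. no vertex other than the common end points `s` and `t`. -/
def SimpleGraph.Path.InternallyDisjoint {s t : V} (p r : G.Path s t) : Prop :=
  ∀ v : V, v ∈ p.1.support → v ∈ r.1.support → v = s ∨ v = t

/-- `P` is a set of pairwise internally disjoint uni-colour `st`-paths. -/
def IsDisjointUniColorFamily (f : G.edgeSet → Finset C) {s t : V}
    (P : Finset (G.Path s t)) : Prop :=
  (∀ p ∈ P, p.1.IsUniColor f) ∧
    ∀ p ∈ P, ∀ r ∈ P, p ≠ r → SimpleGraph.Path.InternallyDisjoint p r

/-- A graph is a disjoint union of paths if each connected component is a path graph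
(possibly a single vertex). -/
def SimpleGraph.IsDisjointUnionOfPaths (H : SimpleGraph V) : Prop :=
  ∀ K : H.ConnectedComponent, ∃ k : ℕ, Nonempty (K.toSimpleGraph ≃g SimpleGraph.pathGraph k)

/-- The distance to disjoint paths: the least number of vertices whose removal leaves a disjoint
union of paths. (For finite `V` the set below is not empty, since all of `V` may be removed.) -/
noncomputable def SimpleGraph.distToDisjointPaths (H : SimpleGraph V) : ℕ :=
  sInf {k | ∃ X : Finset V, X.card = k ∧
    (H.induce {v | v ∉ X}).IsDisjointUnionOfPaths}

theorem SimpleGraph.distToDisjointPaths_spec [Fintype V] (H : SimpleGraph V) :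
    IsLeast {k | ∃ X : Finset V, X.card = k ∧
      (H.induce {v | v ∉ X}).IsDisjointUnionOfPaths} H.distToDisjointPaths := by
  refine ⟨Nat.sInf_mem ⟨_, Finset.univ, rfl, fun K => ?_⟩, fun k hk => Nat.sInf_le hk⟩
  obtain ⟨v, -⟩ := K.exists_rep
  exact absurd (Finset.mem_univ v.1) v.2

end Graph

/-- An instance of MaxCDP: a graph on `n` vertices, `q` colours, a set of colours for each edge,
and two distinct vertices `s` and `t`. -/
structure MaxCDPInstance where
  n : ℕ
  q : ℕ
  G : SimpleGraph (Fin n)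
  f : G.edgeSet → Finset (Fin q)
  s : Fin n
  t : Fin n
  s_ne_t : s ≠ t

namespace MaxCDPInstance

/-- `z` is the maximum number of disjoint uni-colour `st`-paths. -/
def IsOptimum (I : MaxCDPInstance) (z : ℕ) : Prop :=
  IsGreatest {k | ∃ P : Finset (I.G.Path I.s I.t), IsDisjointUniColorFamily I.f P ∧ P.card = k} z

open Classical in
/-- The instance as a list of numbers: `n`, `q`, `s`, `t`, then the adjacency matrix (row by row),
then for each pair `(u, v)` of vertices, in the same order, the 0-1 vector of the colours of the
edge `uv` (the zero vector if `uv` is not an edge). Every entry is at most the length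
`4 + n² + n²q` of the list. -/
noncomputable def encode (I : MaxCDPInstance) : List ℕ :=
  [I.n, I.q, I.s, I.t] ++
  List.ofFn (fun i : Fin (I.n * I.n) => if I.G.Adj i.divNat i.modNat then 1 else 0) ++
  List.ofFn (fun j : Fin (I.n * I.n * I.q) =>
    if ∃ h : I.G.Adj j.divNat.divNat j.divNat.modNat,
        j.modNat ∈ I.f ⟨s(j.divNat.divNat, j.divNat.modNat), h⟩ then 1 else 0)

/-- The parameter: the distance of the graph to disjoint paths. -/
noncomputable def distToPaths (I : MaxCDPInstance) : ℕ := I.G.distToDisjointPaths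

end MaxCDPInstance

/-! ### Machine model

Structured programs for a random access machine. The memory consists of scalar registers and of
arrays, all holding natural numbers; a program names finitely many of them. The only arithmetic is
addition and truncated subtraction (no multiplication), so that unit cost running time is
polynomially related to Turing machine time. -/

namespace RAM

/-- Expressions: constants, registers, array entries `a[e]`, sums and truncated differences. -/
inductive Expr : Type
  | const (k : ℕ)
  | reg (x : ℕ)
  | get (a : ℕ) (e : Expr)
  | add (e₁ e₂ : Expr)
  | sub (e₁ e₂ : Expr)

/-- Programs: assignment `x := e`, array assignment `a[i] := e`, sequencing, conditional and loop.
A condition holds if the value of the expression is not zero. -/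
inductive Prog : Type
  | skip
  | assign (x : ℕ) (e : Expr)
  | put (a : ℕ) (i e : Expr)
  | seq (p₁ p₂ : Prog)
  | ite (e : Expr) (p₁ p₂ : Prog)
  | while (e : Expr) (p : Prog)

/-- Memory contents. -/
structure Memory where
  reg : ℕ → ℕ
  arr : ℕ → ℕ → ℕ

/-- The value of an expression. -/
def Expr.eval (m : Memory) : Expr → ℕ
  | .const k => k
  | .reg x => m.reg x
  | .get a e => m.arr a (e.eval m)
  | .add e₁ e₂ => e₁.eval m + e₂.eval m
  | .sub e₁ e₂ => e₁.eval m - e₂.eval m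

/-- The time to evaluate an expression: one step for each operation or memory access in it. -/
def Expr.cost : Expr → ℕ
  | .const _ => 1
  | .reg _ => 1
  | .get _ e => e.cost + 1
  | .add e₁ e₂ => e₁.cost + e₂.cost + 1
  | .sub e₁ e₂ => e₁.cost + e₂.cost + 1

/-- `m.setReg x k` is `m` with register `x` overwritten by `k`. -/
def Memory.setReg (m : Memory) (x k : ℕ) : Memory :=
  { m with reg := Function.update m.reg x k }

/-- `m.setArr a i k` is `m` with entry `i` of array `a` overwritten by `k`. -/
def Memory.setArr (m : Memory) (a i k : ℕ) : Memory :=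
  { m with arr := Function.update m.arr a (Function.update (m.arr a) i k) }

/-- `Runs p m T m'`: program `p`, started with memory `m`, halts after exactly `T` steps with
memory `m'`. -/
inductive Runs : Prog → Memory → ℕ → Memory → Prop
  | skip (m : Memory) : Runs .skip m 1 m
  | assign (x : ℕ) (e : Expr) (m : Memory) :
      Runs (.assign x e) m (e.cost + 1) (m.setReg x (e.eval m))
  | put (a : ℕ) (i e : Expr) (m : Memory) :
      Runs (.put a i e) m (i.cost + e.cost + 1) (m.setArr a (i.eval m) (e.eval m))
  | seq {p₁ p₂ : Prog} {m₁ m₂ m₃ : Memory} {T₁ T₂ : ℕ} :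
      Runs p₁ m₁ T₁ m₂ → Runs p₂ m₂ T₂ m₃ → Runs (.seq p₁ p₂) m₁ (T₁ + T₂) m₃
  | ite_true {e : Expr} {p₁ p₂ : Prog} {m m' : Memory} {T : ℕ} :
      e.eval m ≠ 0 → Runs p₁ m T m' → Runs (.ite e p₁ p₂) m (e.cost + 1 + T) m'
  | ite_false {e : Expr} {p₁ p₂ : Prog} {m m' : Memory} {T : ℕ} :
      e.eval m = 0 → Runs p₂ m T m' → Runs (.ite e p₁ p₂) m (e.cost + 1 + T) m'
  | while_true {e : Expr} {p : Prog} {m₁ m₂ m₃ : Memory} {T₁ T₂ : ℕ} :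
      e.eval m₁ ≠ 0 → Runs p m₁ T₁ m₂ → Runs (.while e p) m₂ T₂ m₃ →
      Runs (.while e p) m₁ (e.cost + 1 + T₁ + T₂) m₃
  | while_false {e : Expr} {p : Prog} {m : Memory} :
      e.eval m = 0 → Runs (.while e p) m (e.cost + 1) m

/-- Execution is deterministic: running time and final memory are unique. -/
theorem Runs.unique {p : Prog} {m m₁ m₂ : Memory} {T₁ T₂ : ℕ}
    (h₁ : Runs p m T₁ m₁) (h₂ : Runs p m T₂ m₂) : T₁ = T₂ ∧ m₁ = m₂ := by
  induction h₁ generalizing T₂ m₂ with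
  | skip m => cases h₂; exact ⟨rfl, rfl⟩
  | assign x e m => cases h₂; exact ⟨rfl, rfl⟩
  | put a i e m => cases h₂; exact ⟨rfl, rfl⟩
  | seq _ _ ih₁ ih₂ =>
    cases h₂ with
    | seq a b =>
      obtain ⟨rfl, rfl⟩ := ih₁ a
      obtain ⟨rfl, rfl⟩ := ih₂ b
      exact ⟨rfl, rfl⟩
  | ite_true h _ ih =>
    cases h₂ with
    | ite_true _ a => obtain ⟨rfl, rfl⟩ := ih a; exact ⟨rfl, rfl⟩
    | ite_false h' _ => exact absurd h' h
  | ite_false h _ ih =>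
    cases h₂ with
    | ite_true h' _ => exact absurd h h'
    | ite_false _ a => obtain ⟨rfl, rfl⟩ := ih a; exact ⟨rfl, rfl⟩
  | while_true h _ _ ih₁ ih₂ =>
    cases h₂ with
    | while_true _ a b =>
      obtain ⟨rfl, rfl⟩ := ih₁ a
      obtain ⟨rfl, rfl⟩ := ih₂ b
      exact ⟨rfl, rfl⟩
    | while_false h' => exact absurd h' h
  | while_false h =>
    cases h₂ with
    | while_true h' _ _ => exact absurd h h'
    | while_false _ => exact ⟨rfl, rfl⟩

/-- The initial memory on input `w`: array `0` holds `w`, register `0` holds the length of `w`, and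
everything else is `0`. -/
def Memory.init (w : List ℕ) : Memory where
  reg x := if x = 0 then w.length else 0
  arr a i := if a = 0 then w.getD i 0 else 0

/-- On input `w`, the program `p` halts within `B` steps with `z` in register `0`. -/
def OutputsWithin (p : Prog) (w : List ℕ) (z B : ℕ) : Prop :=
  ∃ (T : ℕ) (m : Memory), Runs p (Memory.init w) T m ∧ T ≤ B ∧ m.reg 0 = z

/-- The size of an input: the total length of the binary representations of its entries, with one
separator for each entry. -/
def inputSize (w : List ℕ) : ℕ := (w.map fun a => a.size + 1).sum

/-- The class XP. The problem with instances `ι` (encoded by `enc`), correct answers `ans` and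
parameter `κ` is in XP if one program solves every instance `I` in time `|I| ^ g (κ I)`, for some
function `g`. The parameter is not part of the input. -/
def InXP {ι : Type} (enc : ι → List ℕ) (ans : ι → ℕ → Prop) (κ : ι → ℕ) : Prop :=
  ∃ (p : Prog) (g : ℕ → ℕ), ∀ I : ι, ∃ z : ℕ,
    ans I z ∧ OutputsWithin p (enc I) z (inputSize (enc I) ^ g (κ I))

end RAM

/-! ### A language of terms with tables, and its compilation to programs -/

namespace RAM

/-! Combinatorics. Let `X` be a set of `k` vertices whose removal leaves disjoint paths, and delete
`s` and `t` as well. The vertices can then be listed so that every remaining edge joins consecutive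
positions. In a disjoint family of uni-colour `st`-paths, at most `k` paths have an internal vertex
in `X`. Any other path, unless it is the edge `st`, moves by one position at each step between
internal vertices, so its interior is a single interval of the list. The interior of a path through
`X` is a union of at most `3 * (k + 2)` intervals: where a run of its positions ends, the vertex
there or one of its two neighbours on the path is deleted.

It therefore suffices to guess at most `k` colours and at most `k * (3 * k + 6)` intervals, with at
most `n + q` choices for each colour and each end point. Given the guess, the paths avoiding `X`
form a packing of disjoint intervals, which is maximised by dynamic programming; the edge `st`
counts at most once. A guess need not describe actual paths exactly: a set of vertices is acceptable
as soon as it supports a one-coloured route, and routes in disjoint sets are disjoint. The two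
directions are `exists_certificate` and `IsCertificate.exists_family`.

The search. Neither `k` nor `X` is known, so all numbers below a bound `N` are tried. An attempt
counts only if its list is verified to be linear and `base ^ (k * (3 * k + 6)) ≤ N`. Then every
guess belonging to this `k` and `X` has a code below `N`, and the attempt already reaches the
optimum, even if `k` is not minimal (`Feasible.of_family`). So the search returns zero or the
optimum plus one, and doubling `N` until the result is not zero is correct. Success is certain once
`N` is about `|I| ^ g (d(G))` (`exists_feasible`).

Running time. No program is written by hand. Terms with tables of length `N + 1` compile to programs
polynomial in `N` (`Tm.compilable`); functions that are values of terms (`Dfn`) are closed under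
bounded sums, bounded quantifiers and recursion, hence contain the search; `inXP_of_term` adds the
doubling loop. -/

/-- Values of the free variables of a term: a global loop bound, numbers and arrays. -/
structure Env where
  N : ℕ
  reg : ℕ → ℕ
  arr : ℕ → ℕ → ℕ

/-- The first `i` entries of the array defined by course-of-values recursion: entry `k` is
`b a k`, where `a` holds the entries before `k` (and zeros from `k` on). -/
def table (b : (ℕ → ℕ) → ℕ → ℕ) : ℕ → ℕ → ℕ
  | 0 => fun _ => 0
  | i + 1 => Function.update (table b i) i (b (table b i) i)

/-- The function defined by course-of-values recursion from `b`. -/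
def covRec (b : (ℕ → ℕ) → ℕ → ℕ) (i : ℕ) : ℕ := b (table b i) i

theorem table_apply (b : (ℕ → ℕ) → ℕ → ℕ) (i k : ℕ) :
    table b i k = if k < i then covRec b k else 0 := by
  induction i with
  | zero => simp [table]
  | succ i ih =>
    rw [table, Function.update_apply]
    rcases lt_trichotomy k i with h | rfl | h
    · rw [if_neg h.ne, ih, if_pos h, if_pos (h.trans (Nat.lt_succ_self _))]
    · simp [covRec]
    · rw [if_neg h.ne', ih, if_neg (by omega), if_neg (by omega)]

/-- Pure terms with let-bindings and tables of length `N + 1` defined by course-of-values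
recursion. `tab a x b e` is entry `e` of the table whose entry `x` is `b`, where `b` may refer to the
earlier entries as the array `a`. -/
inductive Tm : Type
  | const (k : ℕ)
  | bound
  | var (x : ℕ)
  | get (a : ℕ) (e : Tm)
  | add (e₁ e₂ : Tm)
  | sub (e₁ e₂ : Tm)
  | ite (e e₁ e₂ : Tm)
  | letv (x : ℕ) (e b : Tm)
  | tab (a x : ℕ) (b e : Tm)

/-- Rebinding a number variable. -/
def Env.setReg (ε : Env) (x k : ℕ) : Env := { ε with reg := Function.update ε.reg x k }

/-- Rebinding an array variable. -/
def Env.setArr (ε : Env) (a : ℕ) (f : ℕ → ℕ) : Env := { ε with arr := Function.update ε.arr a f }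

/-- The value of a term. -/
def Tm.eval : Tm → Env → ℕ
  | .const k, _ => k
  | .bound, ε => ε.N
  | .var x, ε => ε.reg x
  | .get a e, ε => ε.arr a (e.eval ε)
  | .add e₁ e₂, ε => e₁.eval ε + e₂.eval ε
  | .sub e₁ e₂, ε => e₁.eval ε - e₂.eval ε
  | .ite e e₁ e₂, ε => if e.eval ε ≠ 0 then e₁.eval ε else e₂.eval ε
  | .letv x e b, ε => b.eval (ε.setReg x (e.eval ε))
  | .tab a x b e, ε =>
    if e.eval ε ≤ ε.N then covRec (fun f i => b.eval ((ε.setArr a f).setReg x i)) (e.eval ε) else 0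

/-- Memory `m` represents `ε`: number variable `x` is in register `σ x`, and array variable `a` is
array `τ a`, cut off at the length found in register `l a`. -/
structure Represents (σ τ l : ℕ → ℕ) (m : Memory) (ε : Env) : Prop where
  N_eq : m.reg 1 = ε.N
  reg_eq : ∀ x, ε.reg x = m.reg (σ x)
  arr_eq : ∀ a i, ε.arr a i = if i < m.reg (l a) then m.arr (τ a) i else 0

/-- `m` and `m'` agree on registers and arrays below `k`. -/
structure AgreeBelow (k : ℕ) (m m' : Memory) : Prop where
  reg_eq : ∀ x < k, m'.reg x = m.reg x
  arr_eq : ∀ a < k, m'.arr a = m.arr a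

theorem AgreeBelow.refl (k : ℕ) (m : Memory) : AgreeBelow k m m := ⟨fun _ _ => rfl, fun _ _ => rfl⟩

theorem AgreeBelow.trans {k : ℕ} {m₁ m₂ m₃ : Memory} (h : AgreeBelow k m₁ m₂)
    (h' : AgreeBelow k m₂ m₃) : AgreeBelow k m₁ m₃ :=
  ⟨fun x hx => (h'.reg_eq x hx).trans (h.reg_eq x hx),
    fun x hx => (h'.arr_eq x hx).trans (h.arr_eq x hx)⟩

theorem AgreeBelow.mono {k k' : ℕ} {m m' : Memory} (h : AgreeBelow k' m m') (hk : k ≤ k') :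
    AgreeBelow k m m' :=
  ⟨fun x hx => h.reg_eq x (hx.trans_le hk), fun x hx => h.arr_eq x (hx.trans_le hk)⟩

theorem AgreeBelow.setReg {k x : ℕ} (m : Memory) (v : ℕ) (hx : k ≤ x) :
    AgreeBelow k m (m.setReg x v) :=
  ⟨fun y hy => Function.update_of_ne (by omega) _ _, fun _ _ => rfl⟩

theorem AgreeBelow.setArr {k a : ℕ} (m : Memory) (i v : ℕ) (ha : k ≤ a) :
    AgreeBelow k m (m.setArr a i v) :=
  ⟨fun _ _ => rfl, fun y hy => Function.update_of_ne (by omega) _ _⟩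

/-- The placement of variables lies below `k`. -/
structure PlacedBelow (k : ℕ) (σ τ l : ℕ → ℕ) : Prop where
  two_le : 2 ≤ k
  reg_lt : ∀ x, σ x < k
  arr_lt : ∀ a, τ a < k
  len_lt : ∀ a, l a < k

theorem Represents.of_agree {σ τ l : ℕ → ℕ} {k : ℕ} {m m' : Memory} {ε : Env}
    (h : Represents σ τ l m ε) (hk : PlacedBelow k σ τ l) (ha : AgreeBelow k m m') :
    Represents σ τ l m' ε where
  N_eq := (ha.reg_eq 1 hk.two_le).trans h.N_eq
  reg_eq x := (h.reg_eq x).trans (ha.reg_eq _ (hk.reg_lt x)).symm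
  arr_eq a i := by
    rw [h.arr_eq, ha.reg_eq _ (hk.len_lt a), ha.arr_eq _ (hk.arr_lt a)]

theorem PlacedBelow.mono {k k' : ℕ} {σ τ l : ℕ → ℕ} (h : PlacedBelow k σ τ l) (hk : k ≤ k') :
    PlacedBelow k' σ τ l :=
  ⟨h.two_le.trans hk, fun x => (h.reg_lt x).trans_le hk, fun x => (h.arr_lt x).trans_le hk,
    fun x => (h.len_lt x).trans_le hk⟩

/-- Program `p` computes the number `v` from memory `m` into register `k`, leaving everything below
`k` unchanged, in time at most `B`. -/
def Computes (p : Prog) (m : Memory) (k v B : ℕ) : Prop :=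
  ∃ (T : ℕ) (m' : Memory), Runs p m T m' ∧ T ≤ B ∧ AgreeBelow k m m' ∧ m'.reg k = v

/-- A term is compilable if, for each placement of its variables, some program computes it, in time
polynomial in the loop bound. -/
def Tm.Compilable (t : Tm) : Prop :=
  ∃ c : ℕ, ∀ (σ τ l : ℕ → ℕ) (k : ℕ), PlacedBelow k σ τ l → ∃ p : Prog, ∀ (m : Memory) (ε : Env),
    Represents σ τ l m ε → Computes p m k (t.eval ε) ((ε.N + 2) ^ c)

/-- Since `N + 2 ≥ 2`, constants and sums are absorbed into the exponent; all time bounds can thus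
be pure powers of `N + 2`. -/
theorem const_le_pow (N : ℕ) {a c : ℕ} (h : a ≤ 2 ^ c) : a ≤ (N + 2) ^ c :=
  h.trans (Nat.pow_le_pow_left (by omega) c)

theorem add_le_pow {N a b c d : ℕ} (ha : a ≤ (N + 2) ^ c) (hb : b ≤ (N + 2) ^ d) :
    a + b ≤ (N + 2) ^ (c + d + 1) := by
  have h1 : (N + 2) ^ c ≤ (N + 2) ^ (c + d) := Nat.pow_le_pow_right (by omega) (by omega)
  have h2 : (N + 2) ^ d ≤ (N + 2) ^ (c + d) := Nat.pow_le_pow_right (by omega) (by omega)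
  calc a + b ≤ (N + 2) ^ (c + d) * 2 := by omega
    _ ≤ (N + 2) ^ (c + d) * (N + 2) := Nat.mul_le_mul_left _ (by omega)
    _ = _ := (pow_succ _ _).symm

theorem Tm.compilable_simple (t : Tm) (e : (ℕ → ℕ) → Expr) (c : ℕ)
    (hc : ∀ σ, (e σ).cost + 1 ≤ 2 ^ c)
    (h : ∀ σ τ l m ε, Represents σ τ l m ε → (e σ).eval m = t.eval ε) : t.Compilable := by
  refine ⟨c, fun σ τ l k hk => ⟨.assign k (e σ), fun m ε hr => ?_⟩⟩
  refine ⟨_, _, Runs.assign k (e σ) m, const_le_pow _ (hc σ), AgreeBelow.setReg _ _ le_rfl, ?_⟩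
  simp [Memory.setReg, h σ τ l m ε hr]

theorem Tm.compilable_const (k : ℕ) : (Tm.const k).Compilable :=
  compilable_simple _ (fun _ => .const k) 1 (fun _ => by simp [Expr.cost])
    (fun _ _ _ _ _ _ => by simp [Expr.eval, Tm.eval])

theorem Tm.compilable_bound : Tm.bound.Compilable :=
  compilable_simple _ (fun _ => .reg 1) 1 (fun _ => by simp [Expr.cost])
    (fun _ _ _ _ _ h => by simp [Expr.eval, Tm.eval, h.N_eq])

theorem Tm.compilable_var (x : ℕ) : (Tm.var x).Compilable :=
  compilable_simple _ (fun σ => .reg (σ x)) 1 (fun _ => by simp [Expr.cost])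
    (fun _ _ _ _ _ h => by simp [Expr.eval, Tm.eval, h.reg_eq])

theorem Tm.Compilable.get {e : Tm} (a : ℕ) (he : e.Compilable) : (Tm.get a e).Compilable := by
  obtain ⟨c, hc⟩ := he
  refine ⟨c + 4 + 1, fun σ τ l k hk => ?_⟩
  obtain ⟨p, hp⟩ := hc σ τ l k hk
  refine ⟨.seq p (.ite (.sub (.reg (l a)) (.reg k)) (.assign k (.get (τ a) (.reg k)))
    (.assign k (.const 0))), fun m ε hr => ?_⟩
  obtain ⟨T, m', hrun, hT, ha, hv⟩ := hp m ε hr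
  have hr' := hr.of_agree hk ha
  by_cases hlt : e.eval ε < m'.reg (l a)
  · refine ⟨_, _, hrun.seq (Runs.ite_true ?_ (Runs.assign ..)), add_le_pow hT (const_le_pow _ ?_),
      ha.trans (AgreeBelow.setReg _ _ le_rfl), ?_⟩
    · simp [Expr.eval, hv]; omega
    · simp [Expr.cost]
    · simp [Memory.setReg, Expr.eval, hv, Tm.eval, hr'.arr_eq, hlt]
  · refine ⟨_, _, hrun.seq (Runs.ite_false ?_ (Runs.assign ..)), add_le_pow hT (const_le_pow _ ?_),
      ha.trans (AgreeBelow.setReg _ _ le_rfl), ?_⟩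
    · simp [Expr.eval, hv]; omega
    · simp [Expr.cost]
    · simp [Memory.setReg, Expr.eval, Tm.eval, hr'.arr_eq, hlt]

theorem Tm.compilable_binary (t e₁ e₂ : Tm) (op : Expr → Expr → Expr)
    (hcost : ∀ x y, (op x y).cost = x.cost + y.cost + 1)
    (h : ∀ (m : Memory) ε x y, x.eval m = e₁.eval ε → y.eval m = e₂.eval ε →
      (op x y).eval m = t.eval ε)
    (h₁ : e₁.Compilable) (h₂ : e₂.Compilable) : t.Compilable := by
  obtain ⟨c₁, h₁⟩ := h₁
  obtain ⟨c₂, h₂⟩ := h₂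
  refine ⟨c₁ + (c₂ + 2 + 1) + 1, fun σ τ l k hk => ?_⟩
  obtain ⟨p₁, hp₁⟩ := h₁ σ τ l k hk
  -- The second operand is compiled to work from `k + 1` on, so that it preserves the first result
  -- in register `k`.
  obtain ⟨p₂, hp₂⟩ := h₂ σ τ l (k + 1) (hk.mono (Nat.le_succ k))
  refine ⟨.seq p₁ (.seq p₂ (.assign k (op (.reg k) (.reg (k + 1))))), fun m ε hr => ?_⟩
  obtain ⟨T₁, m₁, hrun₁, hT₁, ha₁, hv₁⟩ := hp₁ m ε hr
  have hr₁ := hr.of_agree hk ha₁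
  obtain ⟨T₂, m₂, hrun₂, hT₂, ha₂, hv₂⟩ := hp₂ m₁ ε hr₁
  refine ⟨_, _, hrun₁.seq (hrun₂.seq (Runs.assign ..)),
    add_le_pow hT₁ (add_le_pow hT₂ (const_le_pow _ ?_)),
    ha₁.trans ((ha₂.mono (Nat.le_succ k)).trans (AgreeBelow.setReg _ _ le_rfl)), ?_⟩
  · simp [hcost, Expr.cost]
  · simp only [Memory.setReg, Function.update_self]
    exact h _ _ _ _ (by rw [Expr.eval, ha₂.reg_eq k (Nat.lt_succ_self k), hv₁]) hv₂

theorem Tm.Compilable.ite {e e₁ e₂ : Tm} (he : e.Compilable) (h₁ : e₁.Compilable)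
    (h₂ : e₂.Compilable) : (Tm.ite e e₁ e₂).Compilable := by
  obtain ⟨c, he⟩ := he
  obtain ⟨c₁, h₁⟩ := h₁
  obtain ⟨c₂, h₂⟩ := h₂
  refine ⟨c + (1 + (c₁ + c₂) + 1) + 1, fun σ τ l k hk => ?_⟩
  obtain ⟨p, hp⟩ := he σ τ l k hk
  obtain ⟨p₁, hp₁⟩ := h₁ σ τ l k hk
  obtain ⟨p₂, hp₂⟩ := h₂ σ τ l k hk
  refine ⟨.seq p (.ite (.reg k) p₁ p₂), fun m ε hr => ?_⟩
  obtain ⟨T, m', hrun, hT, ha, hv⟩ := hp m ε hr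
  have hr' := hr.of_agree hk ha
  by_cases hz : e.eval ε ≠ 0
  · obtain ⟨T₁, m₁, hrun₁, hT₁, ha₁, hv₁⟩ := hp₁ m' ε hr'
    refine ⟨_, _, hrun.seq (Runs.ite_true ?_ hrun₁), add_le_pow hT (add_le_pow
      (const_le_pow _ ?_) (hT₁.trans (Nat.pow_le_pow_right (by omega) (by omega)))),
      ha.trans ha₁, ?_⟩
    · simpa [Expr.eval, hv] using hz
    · simp [Expr.cost]
    · simp only [Tm.eval, if_pos hz, hv₁]
  · obtain ⟨T₁, m₁, hrun₁, hT₁, ha₁, hv₁⟩ := hp₂ m' ε hr'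
    refine ⟨_, _, hrun.seq (Runs.ite_false ?_ hrun₁), add_le_pow hT (add_le_pow
      (const_le_pow _ ?_) (hT₁.trans (Nat.pow_le_pow_right (by omega) (by omega)))),
      ha.trans ha₁, ?_⟩
    · simpa [Expr.eval, hv] using hz
    · simp [Expr.cost]
    · simp only [Tm.eval, if_neg hz, hv₁]

theorem PlacedBelow.update_reg {k : ℕ} {σ τ l : ℕ → ℕ} (hk : PlacedBelow k σ τ l) (x : ℕ) :
    PlacedBelow (k + 1) (Function.update σ x k) τ l where
  two_le := hk.two_le.trans (Nat.le_succ k)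
  reg_lt y := by
    rw [Function.update_apply]
    split_ifs
    · omega
    · exact (hk.reg_lt y).trans (Nat.lt_succ_self k)
  arr_lt a := (hk.arr_lt a).trans (Nat.lt_succ_self k)
  len_lt a := (hk.len_lt a).trans (Nat.lt_succ_self k)

theorem PlacedBelow.update_arr {k : ℕ} {σ τ l : ℕ → ℕ} (hk : PlacedBelow (k + 1) σ τ l) (a : ℕ) :
    PlacedBelow (k + 1) σ (Function.update τ a k) (Function.update l a k) where
  two_le := hk.two_le
  reg_lt := hk.reg_lt
  arr_lt y := by
    rw [Function.update_apply]
    split_ifs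
    · omega
    · exact hk.arr_lt y
  len_lt y := by
    rw [Function.update_apply]
    split_ifs
    · omega
    · exact hk.len_lt y

theorem Represents.update_reg {σ τ l : ℕ → ℕ} {m : Memory} {ε : Env} {k : ℕ}
    (h : Represents σ τ l m ε) (x : ℕ) :
    Represents (Function.update σ x k) τ l m (ε.setReg x (m.reg k)) where
  N_eq := h.N_eq
  reg_eq y := by
    simp only [Env.setReg, Function.update_apply]
    split_ifs
    · rfl
    · exact h.reg_eq y
  arr_eq := h.arr_eq

theorem Tm.Compilable.letv {e b : Tm} (x : ℕ) (he : e.Compilable) (hb : b.Compilable) :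
    (Tm.letv x e b).Compilable := by
  obtain ⟨c, he⟩ := he
  obtain ⟨d, hb⟩ := hb
  refine ⟨c + (d + 2 + 1) + 1, fun σ τ l k hk => ?_⟩
  obtain ⟨p, hp⟩ := he σ τ l k hk
  obtain ⟨p₁, hp₁⟩ := hb _ τ l (k + 1) (hk.update_reg x)
  refine ⟨.seq p (.seq p₁ (.assign k (.reg (k + 1)))), fun m ε hr => ?_⟩
  obtain ⟨T, m', hrun, hT, ha, hv⟩ := hp m ε hr
  have hr' := (hr.of_agree hk ha).update_reg (k := k) x
  obtain ⟨T₁, m₁, hrun₁, hT₁, ha₁, hv₁⟩ := hp₁ m' _ hr'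
  refine ⟨_, _, hrun.seq (hrun₁.seq (Runs.assign ..)),
    add_le_pow hT (add_le_pow hT₁ (const_le_pow _ ?_)),
    ha.trans ((ha₁.mono (Nat.le_succ k)).trans (AgreeBelow.setReg _ _ le_rfl)), ?_⟩
  · simp [Expr.cost]
  · simp [Memory.setReg, Expr.eval, hv₁, Tm.eval, hv]

/-- The loop filling a table. -/
theorem runs_table_loop {σ τ l : ℕ → ℕ} {k c : ℕ} {b : Tm} {a x : ℕ} {p : Prog}
    (hk : PlacedBelow (k + 1) σ τ l)
    (hp : ∀ (m : Memory) (ε : Env),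
      Represents (Function.update σ x (k + 1)) (Function.update τ a (k + 1))
        (Function.update l a (k + 1)) m ε → Computes p m (k + 2) (b.eval ε) ((ε.N + 2) ^ c))
    (ε : Env) (j : ℕ) : ∀ (i : ℕ), i + j = ε.N + 1 → ∀ m : Memory, Represents σ τ l m ε →
    m.reg (k + 1) = i →
    (∀ y < i, m.arr (k + 1) y = covRec (fun f i => b.eval ((ε.setArr a f).setReg x i)) y) →
    ∃ T m', Runs (.while (.sub (.add (.reg 1) (.const 1)) (.reg (k + 1)))
        (.seq p (.seq (.put (k + 1) (.reg (k + 1)) (.reg (k + 2)))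
          (.assign (k + 1) (.add (.reg (k + 1)) (.const 1)))))) m T m' ∧
      T ≤ j * ((ε.N + 2) ^ c + 14) + 6 ∧ AgreeBelow (k + 1) m m' ∧
      ∀ y ≤ ε.N, m'.arr (k + 1) y =
        covRec (fun f i => b.eval ((ε.setArr a f).setReg x i)) y := by
  induction j with
  | zero =>
    intro i hi m hr hm harr
    refine ⟨_, m, Runs.while_false ?_, ?_, AgreeBelow.refl _ _, fun y hy => harr y (by omega)⟩
    · simp [Expr.eval, hr.N_eq, hm]; omega
    · simp [Expr.cost]
  | succ j ih =>
    intro i hi m hr hm harr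
    set g := (fun f i => b.eval ((ε.setArr a f).setReg x i)) with hg
    have hrep : Represents (Function.update σ x (k + 1)) (Function.update τ a (k + 1))
        -- Nothing is assumed about array `k + 1` from index `i` on. The counter is also the length
        -- of the array, so leftovers of an earlier evaluation are read as zeros, in agreement with
        -- `table g i`; the array need not be cleared.
        (Function.update l a (k + 1)) m ((ε.setArr a (table g i)).setReg x i) := by
      refine ⟨hr.N_eq, fun y => ?_, fun y z => ?_⟩
      · simp only [Env.setReg, Env.setArr, Function.update_apply]
        split_ifs
        · exact hm.symm
        · exact hr.reg_eq y
      · simp only [Env.setReg, Env.setArr, Function.update_apply]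
        split_ifs with h1 h2 h2
        · rw [hm] at h2
          rw [table_apply, if_pos h2, harr z h2]
        · rw [hm] at h2
          rw [table_apply, if_neg h2]
        · rw [hr.arr_eq, if_pos h2]
        · rw [hr.arr_eq, if_neg h2]
    obtain ⟨T, m₁, hrun, hT, ha, hv⟩ := hp m _ hrep
    have hi₁ : m₁.reg (k + 1) = i := by rw [ha.reg_eq _ (by omega), hm]
    set m₂ := (m₁.setArr (k + 1) i (m₁.reg (k + 2))).setReg (k + 1) (i + 1) with hm₂
    have ha₂ : AgreeBelow (k + 1) m m₂ := (ha.mono (by omega)).trans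
      ((AgreeBelow.setArr _ _ _ le_rfl).trans (AgreeBelow.setReg _ _ le_rfl))
    obtain ⟨T', m', hrun', hT', ha', hv'⟩ := ih (i + 1) (by omega) m₂ (hr.of_agree hk ha₂)
      (by simp [hm₂, Memory.setReg]) (by
        intro y hy
        simp only [hm₂, Memory.setReg, Memory.setArr, Function.update_self]
        rw [Function.update_apply]
        split_ifs with h
        · rw [hv, h]; rfl
        · rw [ha.arr_eq _ (by omega), harr y (by omega)])
    have hput : Runs (.put (k + 1) (.reg (k + 1)) (.reg (k + 2))) m₁ 3
        (m₁.setArr (k + 1) i (m₁.reg (k + 2))) := by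
      have := Runs.put (k + 1) (.reg (k + 1)) (.reg (k + 2)) m₁
      simpa [Expr.eval, Expr.cost, hi₁] using this
    have hinc : Runs (.assign (k + 1) (.add (.reg (k + 1)) (.const 1)))
        (m₁.setArr (k + 1) i (m₁.reg (k + 2))) 4 m₂ := by
      have := Runs.assign (k + 1) (.add (.reg (k + 1)) (.const 1))
        (m₁.setArr (k + 1) i (m₁.reg (k + 2)))
      simpa [Expr.eval, Expr.cost, Memory.setArr, hi₁, hm₂] using this
    refine ⟨_, m', Runs.while_true ?_ (hrun.seq (hput.seq hinc)) hrun', ?_, ha₂.trans ha', hv'⟩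
    · simp [Expr.eval, hr.N_eq, hm]; omega
    · simp only [Expr.cost]
      have : T ≤ (ε.N + 2) ^ c := hT
      rw [Nat.succ_mul]
      omega

theorem Tm.Compilable.tab {b e : Tm} (a x : ℕ) (hb : b.Compilable) (he : e.Compilable) :
    (Tm.tab a x b e).Compilable := by
  obtain ⟨c, hb⟩ := hb
  obtain ⟨d, he⟩ := he
  obtain ⟨w, hw⟩ : ∃ w, w = 1 + (c + 4 + 1) + 3 + 1 := ⟨_, rfl⟩
  refine ⟨d + (2 + (w + 5 + 1) + 1) + 1, fun σ τ l k hk => ?_⟩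
  obtain ⟨p₁, hp₁⟩ := he σ τ l k hk
  obtain ⟨p, hp⟩ := hb _ _ _ (k + 2) (((hk.mono (Nat.le_succ k)).update_reg x).update_arr a)
  -- Register `k` keeps the value of `e`, register `k + 1` is both counter and length of array `k +
  -- 1`, and register `k + 2` receives the new entry.
  refine ⟨.seq p₁ (.seq (.assign (k + 1) (.const 0)) (.seq
    (.while (.sub (.add (.reg 1) (.const 1)) (.reg (k + 1)))
        (.seq p (.seq (.put (k + 1) (.reg (k + 1)) (.reg (k + 2)))
          (.assign (k + 1) (.add (.reg (k + 1)) (.const 1))))))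
    (.ite (.sub (.add (.reg 1) (.const 1)) (.reg k)) (.assign k (.get (k + 1) (.reg k)))
      (.assign k (.const 0))))), fun m ε hr => ?_⟩
  obtain ⟨T₁, m₁, hrun₁, hT₁, ha₁, hv₁⟩ := hp₁ m ε hr
  have ha₂ : AgreeBelow (k + 1) m₁ (m₁.setReg (k + 1) 0) := AgreeBelow.setReg _ _ le_rfl
  have hr₂ := (hr.of_agree hk ha₁).of_agree hk (ha₂.mono (Nat.le_succ k))
  obtain ⟨T₃, m₃, hrun₃, hT₃, ha₃, hv₃⟩ := runs_table_loop (hk.mono (Nat.le_succ k)) hp ε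
    (ε.N + 1) 0 (by omega) (m₁.setReg (k + 1) 0) hr₂ (by simp [Memory.setReg])
    (fun y hy => absurd hy (by omega))
  have ha13 := ha₂.trans ha₃
  have hr₃ := (hr.of_agree hk ha₁).of_agree hk (ha13.mono (Nat.le_succ k))
  have hv : m₃.reg k = e.eval ε := by rw [ha13.reg_eq k (Nat.lt_succ_self k), hv₁]
  have hT : T₃ ≤ (ε.N + 2) ^ w := by
    rw [hw]
    refine hT₃.trans (add_le_pow ?_ (const_le_pow _ (by norm_num)))
    rw [pow_add _ 1, pow_one]
    exact Nat.mul_le_mul (by omega) (add_le_pow le_rfl (const_le_pow _ (by norm_num)))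
  have h12 := Runs.assign (k + 1) (.const 0) m₁
  by_cases hle : e.eval ε ≤ ε.N
  · have hend := Runs.ite_true (e := .sub (.add (.reg 1) (.const 1)) (.reg k))
      (p₂ := .assign k (.const 0)) (m := m₃) (by simp [Expr.eval, hv, hr₃.N_eq]; omega)
      (Runs.assign k (.get (k + 1) (.reg k)) m₃)
    refine ⟨_, _, hrun₁.seq (h12.seq (hrun₃.seq hend)), ?_,
      ha₁.trans ((ha13.mono (Nat.le_succ k)).trans (AgreeBelow.setReg _ _ le_rfl)), ?_⟩
    · refine add_le_pow hT₁ (add_le_pow (const_le_pow _ ?_)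
        (add_le_pow (c := w) (d := 5) hT (const_le_pow _ ?_)))
      · simp [Expr.cost]
      · simp [Expr.cost]
    · simp [Memory.setReg, Expr.eval, hv, Tm.eval, hle, hv₃]
  · have hend := Runs.ite_false (e := .sub (.add (.reg 1) (.const 1)) (.reg k))
      (p₁ := .assign k (.get (k + 1) (.reg k))) (m := m₃)
      (by simp [Expr.eval, hv, hr₃.N_eq]; omega) (Runs.assign k (.const 0) m₃)
    refine ⟨_, _, hrun₁.seq (h12.seq (hrun₃.seq hend)), ?_,
      ha₁.trans ((ha13.mono (Nat.le_succ k)).trans (AgreeBelow.setReg _ _ le_rfl)), ?_⟩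
    · refine add_le_pow hT₁ (add_le_pow (const_le_pow _ ?_)
        (add_le_pow (c := w) (d := 5) hT (const_le_pow _ ?_)))
      · simp [Expr.cost]
      · simp [Expr.cost]
    · simp [Memory.setReg, Expr.eval, Tm.eval, hle]

theorem Tm.compilable (t : Tm) : t.Compilable := by
  induction t with
  | const k => exact compilable_const k
  | bound => exact compilable_bound
  | var x => exact compilable_var x
  | get a e he => exact he.get a
  | add e₁ e₂ h₁ h₂ =>
    exact compilable_binary _ e₁ e₂ .add (fun _ _ => rfl)
      (fun _ _ _ _ h h' => by rw [Expr.eval, Tm.eval, h, h']) h₁ h₂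
  | sub e₁ e₂ h₁ h₂ =>
    exact compilable_binary _ e₁ e₂ .sub (fun _ _ => rfl)
      (fun _ _ _ _ h h' => by rw [Expr.eval, Tm.eval, h, h']) h₁ h₂
  | ite e e₁ e₂ h h₁ h₂ => exact h.ite h₁ h₂
  | letv x e b he hb => exact he.letv x hb
  | tab a x b e hb he => exact hb.tab a x he

end RAM

namespace RAM

/-! ### From terms to the class XP -/

/-- The environment given by an input word and a loop bound. -/
def Env.ofInput (w : List ℕ) (N : ℕ) : Env where
  N := N
  reg _ := w.length
  arr _ i := w.getD i 0

theorem length_le_inputSize (w : List ℕ) : w.length ≤ inputSize w := by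
  induction w with
  | nil => simp
  | cons a w ih => simp only [inputSize, List.map_cons, List.sum_cons, List.length_cons] at *; omega

/-- Before anything is bound, all number variables may share register `0` and all array variables
array `0`, whose length is in register `0` too. -/
theorem represents_ofInput {w : List ℕ} {N : ℕ} {m : Memory} (h0 : m.reg 0 = w.length)
    (h1 : m.reg 1 = N) (ha : m.arr 0 = fun i => w.getD i 0) :
    Represents (fun _ => 0) (fun _ => 0) (fun _ => 0) m (Env.ofInput w N) where
  N_eq := h1
  reg_eq _ := h0.symm
  arr_eq a i := by
    simp only [Env.ofInput, h0, ha]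
    split_ifs with h
    · rfl
    · exact List.getD_eq_default _ _ (by omega)

/-- The loop that doubles the bound until the program `p` returns a non-zero value. -/
theorem runs_doubling_loop {w : List ℕ} {t : Tm} {p : Prog} {c H : ℕ} (hw : 0 < w.length)
    (hp : ∀ (m : Memory) (ε : Env), Represents (fun _ => 0) (fun _ => 0) (fun _ => 0) m ε →
      Computes p m 2 (t.eval ε) ((ε.N + 2) ^ c))
    (hH : ∀ N, H ≤ N → t.eval (Env.ofInput w N) ≠ 0) (j : ℕ) :
    ∀ (N : ℕ) (m : Memory), w.length ≤ N → N ≤ H → H ≤ N + j → m.reg 0 = w.length →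
      m.reg 1 = N → m.reg 2 = 0 → m.arr 0 = (fun i => w.getD i 0) →
      ∃ T m' N', Runs (.while (.sub (.const 1) (.reg 2))
          (.seq (.assign 1 (.add (.reg 1) (.reg 1))) p)) m T m' ∧
        T ≤ (j + 1) * ((2 * H + 2) ^ c + 8) + 4 ∧ 2 * w.length ≤ N' ∧
        m'.reg 2 = t.eval (Env.ofInput w N') ∧ m'.reg 2 ≠ 0 := by
  induction j with
  | zero =>
    intro N m hlen hNH hHN h0 h1 h2 ha
    set m₁ := m.setReg 1 (N + N) with hm₁
    have hrun₁ : Runs (.assign 1 (.add (.reg 1) (.reg 1))) m 4 m₁ := by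
      have := Runs.assign 1 (.add (.reg 1) (.reg 1)) m
      simpa [Expr.eval, Expr.cost, h1] using this
    obtain ⟨T, m', hrun, hT, hag, hv⟩ := hp m₁ _ (represents_ofInput (N := N + N)
      (by simpa [hm₁, Memory.setReg] using h0) (by simp [hm₁, Memory.setReg]) ha)
    have hne : m'.reg 2 ≠ 0 := hv ▸ hH _ (by omega)
    refine ⟨_, m', N + N, Runs.while_true ?_ (hrun₁.seq hrun) (Runs.while_false ?_), ?_, by omega,
      hv, hne⟩
    · simp [Expr.eval, h2]
    · simp [Expr.eval]; omega
    · have : (N + N + 2) ^ c ≤ (2 * H + 2) ^ c := Nat.pow_le_pow_left (by omega) c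
      have hT' : T ≤ (N + N + 2) ^ c := hT
      simp only [Expr.cost]
      omega
  | succ j ih =>
    intro N m hlen hNH hHN h0 h1 h2 ha
    set m₁ := m.setReg 1 (N + N) with hm₁
    have hrun₁ : Runs (.assign 1 (.add (.reg 1) (.reg 1))) m 4 m₁ := by
      have := Runs.assign 1 (.add (.reg 1) (.reg 1)) m
      simpa [Expr.eval, Expr.cost, h1] using this
    obtain ⟨T, m', hrun, hT, hag, hv⟩ := hp m₁ _ (represents_ofInput (N := N + N)
      (by simpa [hm₁, Memory.setReg] using h0) (by simp [hm₁, Memory.setReg]) ha)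
    have hpow : (N + N + 2) ^ c ≤ (2 * H + 2) ^ c := Nat.pow_le_pow_left (by omega) c
    have hT' : T ≤ (N + N + 2) ^ c := hT
    by_cases hne : m'.reg 2 = 0
    · have hlt : N + N < H := by
        by_contra h
        exact hH _ (not_lt.1 h) (hv ▸ hne)
      obtain ⟨T', m'', N', hrun', hT'', hN', hv', hne'⟩ := ih (N + N) m' (by omega) hlt.le
        (by omega) ((hag.reg_eq 0 (by omega)).trans (by simpa [hm₁, Memory.setReg] using h0))
        ((hag.reg_eq 1 (by omega)).trans (by simp [hm₁, Memory.setReg])) hne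
        ((hag.arr_eq 0 (by omega)).trans ha)
      refine ⟨_, m'', N', Runs.while_true ?_ (hrun₁.seq hrun) hrun', ?_, hN', hv', hne'⟩
      · simp [Expr.eval, h2]
      · simp only [Expr.cost]
        rw [Nat.succ_mul]
        omega
    · refine ⟨_, m', N + N, Runs.while_true ?_ (hrun₁.seq hrun) (Runs.while_false ?_), ?_,
        by omega, hv, hne⟩
      · simp [Expr.eval, h2]
      · simp [Expr.eval]; omega
      · simp only [Expr.cost]
        have : 0 ≤ j * ((2 * H + 2) ^ c + 8) := Nat.zero_le _
        rw [Nat.succ_mul, Nat.succ_mul]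
        omega

/-- A problem is in XP if a term, evaluated with a sufficiently large loop bound, yields the answer
plus one, where for smaller bounds it may also yield zero. -/
theorem inXP_of_term {ι : Type} {enc : ι → List ℕ} {ans : ι → ℕ → Prop} {κ : ι → ℕ} (t : Tm)
    (g : ℕ → ℕ) (hlen : ∀ I, 2 ≤ (enc I).length)
    (hsound : ∀ I N z, 2 * (enc I).length ≤ N → t.eval (Env.ofInput (enc I) N) = z + 1 → ans I z)
    (hlarge : ∀ I N, 2 * (enc I).length ≤ N → inputSize (enc I) ^ g (κ I) ≤ N →
      t.eval (Env.ofInput (enc I) N) ≠ 0) : InXP enc ans κ := by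
  obtain ⟨c, hc⟩ := t.compilable
  obtain ⟨p, hp⟩ := hc (fun _ => 0) (fun _ => 0) (fun _ => 0) 2
    ⟨le_rfl, fun _ => by simp, fun _ => by simp, fun _ => by simp⟩
  -- Register `1` holds the bound and register `2` the result. The bound starts at the input length
  -- and is doubled before each evaluation, so it is at least twice that length whenever the term is
  -- evaluated.
  refine ⟨.seq (.assign 1 (.reg 0)) (.seq (.while (.sub (.const 1) (.reg 2))
    (.seq (.assign 1 (.add (.reg 1) (.reg 1))) p)) (.assign 0 (.sub (.reg 2) (.const 1)))),
    fun d => (g d + 5) * (1 + (c + 3 + 1) + 4 + 1), fun I => ?_⟩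
  set w := enc I with hw
  set S := inputSize w with hS
  -- From `H` on the term is not zero, so the last bound is at most `2 * H`. Counting the rounds by
  -- `H` instead of its logarithm is harmless for a polynomial bound.
  set H := 2 * w.length + S ^ g (κ I) with hH
  have hwS : w.length ≤ S := length_le_inputSize w
  have h2 : 2 ≤ w.length := hlen I
  obtain ⟨T, m, N', hrun, hT, hN', hv, hne⟩ := runs_doubling_loop (t := t) (c := c) (H := H)
    (by omega : 0 < w.length) hp (fun N hN => hlarge I N (show 2 * w.length ≤ N by omega)
      (show S ^ g (κ I) ≤ N by omega)) H w.length
    ((Memory.init w).setReg 1 w.length) le_rfl (by omega) (by omega)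
    (by simp [Memory.init, Memory.setReg]) (by simp [Memory.setReg])
    (by simp [Memory.init, Memory.setReg]) (by simp [Memory.init, Memory.setReg])
  refine ⟨m.reg 2 - 1, hsound I N' _ hN' (by rw [← hw, ← hv]; omega), _, _,
    (Runs.assign 1 (.reg 0) (Memory.init w)).seq ((show Runs _ _ T m from ?_).seq
      (Runs.assign 0 (.sub (.reg 2) (.const 1)) m)), ?_, ?_⟩
  · simpa [Expr.eval, Memory.init, Memory.setReg] using hrun
  · have hS2 : 2 ≤ S := h2.trans hwS
    have hbound : 2 * H + 2 ≤ S ^ (g (κ I) + 5) := by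
      have h1 : 1 ≤ S ^ g (κ I) := Nat.one_le_pow _ _ (by omega)
      have h3 : S ≤ S * S ^ g (κ I) := Nat.le_mul_of_pos_right _ h1
      have h4 : S ^ g (κ I) ≤ S * S ^ g (κ I) := Nat.le_mul_of_pos_left _ (by omega)
      have h5 : (2 : ℕ) ^ 4 ≤ S ^ 4 := Nat.pow_le_pow_left hS2 4
      calc 2 * H + 2 ≤ 2 ^ 4 * (S * S ^ g (κ I)) := by omega
        _ ≤ S ^ 4 * (S * S ^ g (κ I)) := Nat.mul_le_mul_right _ h5
        _ = S ^ (g (κ I) + 5) := by ring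
    rw [pow_mul]
    refine le_trans ?_ (Nat.pow_le_pow_left hbound _)
    have hT' : T + 8 ≤ (2 * H + 2) ^ (1 + (c + 3 + 1) + 4 + 1) := by
      refine (Nat.add_le_add_right hT 8).trans ?_
      rw [add_assoc]
      refine add_le_pow ?_ (const_le_pow _ (by norm_num))
      rw [pow_add _ 1, pow_one]
      exact Nat.mul_le_mul (by omega) (add_le_pow le_rfl (const_le_pow _ (by norm_num)))
    simp only [Expr.cost]
    omega
  · simp [Memory.setReg, Expr.eval]

theorem table_congr {b b' : (ℕ → ℕ) → ℕ → ℕ} {i : ℕ} (h : ∀ f, ∀ j < i, b f j = b' f j) :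
    table b i = table b' i := by
  induction i with
  | zero => rfl
  | succ i ih => rw [table, table, ih fun f j hj => h f j (by omega), h _ i (by omega)]

/-- Only indices up to `i` enter. This is what `Dfn.cov` needs, where the body is known to have the
right value only for indices within the loop bound. -/
theorem covRec_congr {b b' : (ℕ → ℕ) → ℕ → ℕ} {i : ℕ} (h : ∀ f, ∀ j ≤ i, b f j = b' f j) :
    covRec b i = covRec b' i := by
  rw [covRec, covRec, table_congr fun f j hj => h f j hj.le, h _ i le_rfl]

end RAM

/-! ### Definable functions -/

open Finset

/-- An instance together with a bound for loops. -/
structure BoundedInstance where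
  I : MaxCDPInstance
  N : ℕ
  le_N : 2 * I.encode.length ≤ N

namespace RAM

/-- Types of contexts: instances with a bound, extended by variables for numbers (at most the bound)
and for arrays. -/
class Ctx (Γ : Type) where
  inp : Γ → BoundedInstance
  Ok : Γ → Prop
  regs : ℕ
  arrs : ℕ
  Rep : Env → Γ → Prop
  rep_N : ∀ {ε γ}, Rep ε γ → ε.N = (inp γ).N
  rep_input : ∀ {ε γ}, Rep ε γ → ε.arr 0 = fun i => (inp γ).I.encode.getD i 0
  rep_congr : ∀ {ε ε' : Env} {γ}, Rep ε γ → ε'.N = ε.N → (∀ x < regs, ε'.reg x = ε.reg x) →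
    (∀ a < arrs, ε'.arr a = ε.arr a) → Rep ε' γ

open Ctx

/-- No number variable is in scope, and array variable `0` is reserved for the input. -/
instance : Ctx BoundedInstance where
  inp b := b
  Ok _ := True
  regs := 0
  arrs := 1
  Rep ε b := ε.N = b.N ∧ ε.arr 0 = fun i => b.I.encode.getD i 0
  rep_N h := h.1
  rep_input h := h.2
  rep_congr h hN _ ha := ⟨hN.trans h.1, (ha 0 Nat.one_pos).trans h.2⟩

section

variable {Γ Δ : Type} [Ctx Γ] [Ctx Δ]

/-- Variables are numbered by depth of binding: the new one is `regs Γ`. Terms over `Γ` then keep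
their meaning in larger contexts, and weakening does not change the term. -/
instance : Ctx (Γ × ℕ) where
  inp p := inp p.1
  Ok p := Ok p.1 ∧ p.2 ≤ (inp p.1).N
  regs := regs Γ + 1
  arrs := arrs Γ
  Rep ε p := Rep ε p.1 ∧ ε.reg (regs Γ) = p.2
  rep_N h := rep_N h.1
  rep_input h := rep_input h.1
  rep_congr h hN hr ha := ⟨rep_congr h.1 hN (fun x hx => hr x (by omega)) ha,
    (hr _ (Nat.lt_succ_self _)).trans h.2⟩

instance : Ctx (Γ × (ℕ → ℕ)) where
  inp p := inp p.1
  Ok p := Ok p.1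
  regs := regs Γ
  arrs := arrs Γ + 1
  Rep ε p := Rep ε p.1 ∧ ε.arr (arrs Γ) = p.2
  rep_N h := rep_N h.1
  rep_input h := rep_input h.1
  rep_congr h hN hr ha := ⟨rep_congr h.1 hN hr (fun x hx => ha x (by omega)),
    (ha _ (Nat.lt_succ_self _)).trans h.2⟩

/-- A function of the context is definable if it is the value of a term. -/
def Dfn (F : Γ → ℕ) : Prop := ∃ t : Tm, ∀ ε γ, Ok γ → Rep ε γ → t.eval ε = F γ

open Classical in
/-- A property of the context is definable if its indicator function is. -/
def DfnP (P : Γ → Prop) : Prop := Dfn fun γ => if P γ then 1 else 0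

/-- A projection of contexts forgets variables. -/
structure Proj (π : Δ → Γ) : Prop where
  inp_eq : ∀ δ, inp (π δ) = inp δ
  ok : ∀ {δ}, Ok δ → Ok (π δ)
  rep : ∀ {ε δ}, Rep ε δ → Rep ε (π δ)

theorem Proj.id : Proj fun γ : Γ => γ := ⟨fun _ => rfl, fun h => h, fun h => h⟩

theorem Proj.fst {π : Δ → Γ} (h : Proj π) : Proj fun p : Δ × ℕ => π p.1 :=
  ⟨fun p => h.inp_eq p.1, fun hp => h.ok hp.1, fun hp => h.rep hp.1⟩

theorem Proj.fst_arr {π : Δ → Γ} (h : Proj π) : Proj fun p : Δ × (ℕ → ℕ) => π p.1 :=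
  ⟨fun p => h.inp_eq p.1, fun hp => h.ok hp, fun hp => h.rep hp.1⟩

/-- The body of a table lives in the context extended by the array of earlier entries and then the
current index. -/
theorem Proj.table : Proj fun p : (Γ × (ℕ → ℕ)) × ℕ => p.1.1 := Proj.id.fst_arr.fst

namespace Dfn

theorem congr {F F' : Γ → ℕ} (hF : Dfn F) (h : ∀ γ, Ok γ → F γ = F' γ) : Dfn F' := by
  obtain ⟨t, ht⟩ := hF
  exact ⟨t, fun ε γ hok hr => (ht ε γ hok hr).trans (h γ hok)⟩

theorem proj {F : Γ → ℕ} (hF : Dfn F) {π : Δ → Γ} (hπ : Proj π) : Dfn fun δ => F (π δ) := by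
  obtain ⟨t, ht⟩ := hF
  exact ⟨t, fun ε δ hok hr => ht ε _ (hπ.ok hok) (hπ.rep hr)⟩

theorem fst {F : Γ → ℕ} (hF : Dfn F) : Dfn fun p : Γ × ℕ => F p.1 := hF.proj Proj.id.fst

theorem const (k : ℕ) : Dfn fun _ : Γ => k := ⟨.const k, fun _ _ _ _ => rfl⟩

theorem N : Dfn fun γ : Γ => (inp γ).N := ⟨.bound, fun _ _ _ h => rep_N h⟩

theorem snd : Dfn fun p : Γ × ℕ => p.2 := ⟨.var (regs Γ), fun _ _ _ h => h.2⟩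

theorem input {e : Γ → ℕ} (he : Dfn e) : Dfn fun γ => (inp γ).I.encode.getD (e γ) 0 := by
  obtain ⟨t, ht⟩ := he
  exact ⟨.get 0 t, fun ε γ hok h => by rw [Tm.eval, rep_input h, ht ε γ hok h]⟩

theorem add {F G : Γ → ℕ} (hF : Dfn F) (hG : Dfn G) : Dfn fun γ => F γ + G γ := by
  obtain ⟨t, ht⟩ := hF
  obtain ⟨u, hu⟩ := hG
  exact ⟨.add t u, fun ε γ hok h => by rw [Tm.eval, ht ε γ hok h, hu ε γ hok h]⟩

theorem sub {F G : Γ → ℕ} (hF : Dfn F) (hG : Dfn G) : Dfn fun γ => F γ - G γ := by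
  obtain ⟨t, ht⟩ := hF
  obtain ⟨u, hu⟩ := hG
  exact ⟨.sub t u, fun ε γ hok h => by rw [Tm.eval, ht ε γ hok h, hu ε γ hok h]⟩

theorem ite {P : Γ → Prop} [∀ γ, Decidable (P γ)] {F G : Γ → ℕ} (hP : DfnP P) (hF : Dfn F)
    (hG : Dfn G) : Dfn fun γ => if P γ then F γ else G γ := by
  obtain ⟨t, ht⟩ := hP
  obtain ⟨u, hu⟩ := hF
  obtain ⟨v, hv⟩ := hG
  refine ⟨.ite t u v, fun ε γ hok h => ?_⟩
  rw [Tm.eval, ht ε γ hok h, hu ε γ hok h, hv ε γ hok h]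
  by_cases hp : P γ <;> simp [hp]

/-- Substitution for the last variable, in a larger context. -/
theorem call {F : Γ → ℕ → ℕ} (hF : Dfn fun p : Γ × ℕ => F p.1 p.2) {π : Δ → Γ} (hπ : Proj π)
    {e : Δ → ℕ} (he : Dfn e) (hle : ∀ δ, Ok δ → e δ ≤ (inp δ).N) :
    Dfn fun δ => F (π δ) (e δ) := by
  obtain ⟨t, ht⟩ := hF
  obtain ⟨u, hu⟩ := he
  refine ⟨.letv (regs Γ) u t, fun ε δ hok h => ?_⟩
  rw [Tm.eval, hu ε δ hok h]
  refine ht _ (π δ, e δ) ⟨hπ.ok hok, ?_⟩ ⟨?_, ?_⟩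
  · rw [hπ.inp_eq]
    exact hle δ hok
  · exact rep_congr (hπ.rep h) rfl (fun x hx => Function.update_of_ne hx.ne _ _) fun _ _ => rfl
  · exact Function.update_self _ _ _

/-- Access to an array variable. -/
theorem entry {π : Δ → Γ × (ℕ → ℕ)} (hπ : Proj π) {e : Δ → ℕ} (he : Dfn e) :
    Dfn fun δ => (π δ).2 (e δ) := by
  obtain ⟨t, ht⟩ := he
  refine ⟨.get (arrs Γ) t, fun ε δ hok h => ?_⟩
  have h1 := (hπ.rep h).2
  rw [Tm.eval, ht ε δ hok h, h1]

/-- The bound on `e` reflects that a table has only `N + 1` entries; the sums, quantifiers and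
recursions below inherit it. -/
theorem cov {b : Γ → (ℕ → ℕ) → ℕ → ℕ}
    (hb : Dfn fun p : (Γ × (ℕ → ℕ)) × ℕ => b p.1.1 p.1.2 p.2) {e : Γ → ℕ} (he : Dfn e)
    (hle : ∀ γ, Ok γ → e γ ≤ (inp γ).N) : Dfn fun γ => covRec (b γ) (e γ) := by
  obtain ⟨t, ht⟩ := hb
  obtain ⟨u, hu⟩ := he
  refine ⟨.tab (arrs Γ) (regs Γ) t u, fun ε γ hok h => ?_⟩
  have hN := rep_N h
  rw [Tm.eval, hu ε γ hok h, if_pos (hN ▸ hle γ hok)]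
  refine covRec_congr fun f j hj => ht _ ((γ, f), j) ⟨hok, hj.trans (hle γ hok)⟩ ⟨⟨?_, ?_⟩, ?_⟩
  · exact rep_congr h rfl (fun x hx => Function.update_of_ne hx.ne _ _)
      fun x hx => Function.update_of_ne hx.ne _ _
  · exact Function.update_self _ _ _
  · exact Function.update_self _ _ _

end Dfn

namespace DfnP

theorem of_ne_zero {P : Γ → Prop} {F : Γ → ℕ} (hF : Dfn F) (h : ∀ γ, Ok γ → (F γ ≠ 0 ↔ P γ)) :
    DfnP P := by
  -- With truncated subtraction, `1 - (1 - x)` is the indicator of `x ≠ 0`.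
  refine ((Dfn.const 1).sub ((Dfn.const 1).sub hF)).congr fun γ hok => ?_
  have := h γ hok
  split_ifs with hP
  · have := this.2 hP
    omega
  · have : F γ = 0 := by simpa using mt this.1 hP
    omega

theorem congr {P Q : Γ → Prop} (hP : DfnP P) (h : ∀ γ, Ok γ → (P γ ↔ Q γ)) : DfnP Q :=
  Dfn.congr hP fun γ hok => by rw [propext (h γ hok)]

theorem proj {P : Γ → Prop} (hP : DfnP P) {π : Δ → Γ} (hπ : Proj π) : DfnP fun δ => P (π δ) :=
  Dfn.proj hP hπ

theorem fst {P : Γ → Prop} (hP : DfnP P) : DfnP fun p : Γ × ℕ => P p.1 := hP.proj Proj.id.fst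

theorem call {P : Γ → ℕ → Prop} (hP : DfnP fun p : Γ × ℕ => P p.1 p.2) {π : Δ → Γ} (hπ : Proj π)
    {e : Δ → ℕ} (he : Dfn e) (hle : ∀ δ, Ok δ → e δ ≤ (inp δ).N) : DfnP fun δ => P (π δ) (e δ) := by
  classical
  exact Dfn.call (F := fun γ i => if P γ i then 1 else 0) hP hπ he hle

theorem lt {F G : Γ → ℕ} (hF : Dfn F) (hG : Dfn G) : DfnP fun γ => F γ < G γ :=
  of_ne_zero (hG.sub hF) fun γ _ => by omega

theorem not {P : Γ → Prop} (hP : DfnP P) : DfnP fun γ => ¬ P γ :=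
  of_ne_zero ((Dfn.const 1).sub hP) fun γ _ => by by_cases h : P γ <;> simp [h]

theorem le {F G : Γ → ℕ} (hF : Dfn F) (hG : Dfn G) : DfnP fun γ => F γ ≤ G γ :=
  (lt hG hF).not.congr fun _ _ => not_lt

theorem eq {F G : Γ → ℕ} (hF : Dfn F) (hG : Dfn G) : DfnP fun γ => F γ = G γ :=
  (of_ne_zero ((hF.sub hG).add (hG.sub hF)) (P := fun γ => ¬ F γ = G γ)
    fun γ _ => by omega).not.congr fun _ _ => not_not

theorem ne {F G : Γ → ℕ} (hF : Dfn F) (hG : Dfn G) : DfnP fun γ => F γ ≠ G γ := (eq hF hG).not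

theorem or {P Q : Γ → Prop} (hP : DfnP P) (hQ : DfnP Q) : DfnP fun γ => P γ ∨ Q γ :=
  of_ne_zero (Dfn.add hP hQ) fun γ _ => by by_cases h : P γ <;> by_cases h' : Q γ <;> simp [h, h']

theorem and {P Q : Γ → Prop} (hP : DfnP P) (hQ : DfnP Q) : DfnP fun γ => P γ ∧ Q γ :=
  (hP.not.or hQ.not).not.congr fun _ _ => by tauto

theorem imp {P Q : Γ → Prop} (hP : DfnP P) (hQ : DfnP Q) : DfnP fun γ => P γ → Q γ :=
  (hP.not.or hQ).congr fun _ _ => by tauto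

end DfnP

namespace Dfn

/-- Primitive recursion. -/
theorem natRec {init : Γ → ℕ} {step : Γ → ℕ → ℕ → ℕ} (h0 : Dfn init)
    (hs : Dfn fun p : (Γ × (ℕ → ℕ)) × ℕ => step p.1.1 (p.2 - 1) (p.1.2 (p.2 - 1)))
    {e : Γ → ℕ} (he : Dfn e) (hle : ∀ γ, Ok γ → e γ ≤ (inp γ).N) :
    Dfn fun γ => Nat.rec (motive := fun _ => ℕ) (init γ) (step γ) (e γ) := by
  refine (cov (b := fun γ a i => if i = 0 then init γ else step γ (i - 1) (a (i - 1)))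
    (ite (DfnP.eq snd (const 0)) (h0.proj Proj.table) hs) he hle).congr fun γ _ => ?_
  induction e γ with
  | zero => simp [covRec]
  | succ i ih => rw [covRec, if_neg (Nat.succ_ne_zero i), Nat.add_sub_cancel, table_apply,
      if_pos (Nat.lt_succ_self i), ih]

theorem pred_table : Dfn fun p : (Γ × (ℕ → ℕ)) × ℕ => p.2 - 1 := snd.sub (const 1)

theorem pred_entry : Dfn fun p : (Γ × (ℕ → ℕ)) × ℕ => p.1.2 (p.2 - 1) :=
  entry Proj.id.fst pred_table

theorem sum {f : Γ → ℕ → ℕ} (hf : Dfn fun p : Γ × ℕ => f p.1 p.2) {e : Γ → ℕ} (he : Dfn e)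
    (hle : ∀ γ, Ok γ → e γ ≤ (inp γ).N) : Dfn fun γ => ∑ i ∈ range (e γ), f γ i := by
  refine (natRec (init := fun _ => 0) (step := fun γ i r => r + f γ i) (const 0)
    (pred_entry.add (hf.call Proj.table pred_table fun p hp => (Nat.sub_le _ _).trans hp.2))
    he hle).congr fun γ _ => ?_
  induction e γ with
  | zero => simp
  | succ i ih => rw [sum_range_succ, ← ih]

theorem max {F G : Γ → ℕ} (hF : Dfn F) (hG : Dfn G) : Dfn fun γ => max (F γ) (G γ) :=
  (hF.add (hG.sub hF)).congr fun γ _ => by omega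

theorem min {F G : Γ → ℕ} (hF : Dfn F) (hG : Dfn G) : Dfn fun γ => min (F γ) (G γ) :=
  (hF.sub (hF.sub hG)).congr fun γ _ => by omega

theorem sup {f : Γ → ℕ → ℕ} (hf : Dfn fun p : Γ × ℕ => f p.1 p.2) {e : Γ → ℕ} (he : Dfn e)
    (hle : ∀ γ, Ok γ → e γ ≤ (inp γ).N) : Dfn fun γ => (range (e γ)).sup (f γ) := by
  refine (natRec (init := fun _ => 0) (step := fun γ i r => Max.max (f γ i) r) (const 0)
    (max (hf.call Proj.table pred_table fun p hp => (Nat.sub_le _ _).trans hp.2) pred_entry)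
    he hle).congr fun γ _ => ?_
  induction e γ with
  | zero => simp
  | succ i ih => rw [range_add_one, sup_insert, ← ih]

theorem card_filter {P : Γ → ℕ → Prop} [∀ γ, DecidablePred (P γ)]
    (hP : DfnP fun p : Γ × ℕ => P p.1 p.2) {e : Γ → ℕ} (he : Dfn e)
    (hle : ∀ γ, Ok γ → e γ ≤ (inp γ).N) : Dfn fun γ => #{i ∈ range (e γ) | P γ i} := by
  refine (sum (f := fun γ i => if P γ i then 1 else 0) (ite hP (const 1) (const 0)) he
    hle).congr fun γ _ => ?_
  rw [Finset.card_filter]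

/-- Multiplication is repeated addition, so only the number of summands has to be within the loop
bound. -/
theorem mul {F G : Γ → ℕ} (hF : Dfn F) (hG : Dfn G) (hle : ∀ γ, Ok γ → G γ ≤ (inp γ).N) :
    Dfn fun γ => F γ * G γ :=
  (sum (f := fun γ _ => F γ) hF.fst hG hle).congr fun γ _ => by simp [mul_comm]

theorem pow {F G : Γ → ℕ} (hF : Dfn F) (hFN : ∀ γ, Ok γ → F γ ≤ (inp γ).N) (hG : Dfn G)
    (hle : ∀ γ, Ok γ → G γ ≤ (inp γ).N) : Dfn fun γ => F γ ^ G γ := by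
  refine (natRec (init := fun _ => 1) (step := fun γ _ r => r * F γ) (const 1)
    (pred_entry.mul (hF.proj Proj.table) fun p hp => hFN _ hp.1) hG hle).congr fun γ _ => ?_
  induction G γ with
  | zero => simp
  | succ i ih => rw [pow_succ, ← ih]

theorem div {F G : Γ → ℕ} (hF : Dfn F) (hG : Dfn G) (hle : ∀ γ, Ok γ → F γ ≤ (inp γ).N) :
    Dfn fun γ => F γ / G γ := by
  -- The quotient is the number of positive multiples of `G γ` up to `F γ`; the clause `0 < G γ`
  -- produces the value `0` for division by zero.
  refine (card_filter (P := fun γ j => 0 < G γ ∧ G γ * (j + 1) ≤ F γ)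
    ((DfnP.lt (const 0) hG.fst).and (DfnP.le ((hG.fst.mul snd fun p hp => hp.2).add hG.fst)
      hF.fst)) hF hle).congr fun γ _ => ?_
  rcases Nat.eq_zero_or_pos (G γ) with h | h
  · simp [h]
  · have : {j ∈ range (F γ) | 0 < G γ ∧ G γ * (j + 1) ≤ F γ} = range (F γ / G γ) := by
      ext j
      simp only [mem_filter, mem_range, h, true_and]
      rw [Nat.lt_iff_add_one_le (m := j) (n := F γ / G γ), Nat.le_div_iff_mul_le h,
        mul_comm (j + 1)]
      refine ⟨fun h => h.2, fun hj => ⟨?_, hj⟩⟩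
      nlinarith
    rw [this, card_range]

theorem mod {F G : Γ → ℕ} (hF : Dfn F) (hG : Dfn G) (hle : ∀ γ, Ok γ → F γ ≤ (inp γ).N) :
    Dfn fun γ => F γ % G γ :=
  (hF.sub (hG.mul (hF.div hG hle) fun γ h => (Nat.div_le_self _ _).trans (hle γ h))).congr
    fun γ _ => by
      have := Nat.mod_add_div (F γ) (G γ)
      omega

end Dfn

namespace DfnP

theorem exists_lt {P : Γ → ℕ → Prop} (hP : DfnP fun p : Γ × ℕ => P p.1 p.2) {e : Γ → ℕ} (he : Dfn e)
    (hle : ∀ γ, Ok γ → e γ ≤ (inp γ).N) : DfnP fun γ => ∃ i < e γ, P γ i := by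
  classical
  exact of_ne_zero (Dfn.card_filter hP he hle) fun γ _ => by
    simp [Finset.card_eq_zero, Finset.filter_eq_empty_iff]

theorem forall_lt {P : Γ → ℕ → Prop} (hP : DfnP fun p : Γ × ℕ => P p.1 p.2) {e : Γ → ℕ} (he : Dfn e)
    (hle : ∀ γ, Ok γ → e γ ≤ (inp γ).N) : DfnP fun γ => ∀ i < e γ, P γ i :=
  (exists_lt (P := fun γ i => ¬ P γ i) hP.not he hle).not.congr fun γ _ => by simp

end DfnP

end

end RAM

/-! ### The algorithm -/

section

open Classical

/-- The least `v < n` with `P v`, or `n` if there is none. -/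
noncomputable def leastBelow (n : ℕ) (P : ℕ → Prop) : ℕ :=
  #{j ∈ range n | ¬ P j ∧ ∀ i < j, ¬ P i}

/-- The choice of entry `i` of a greedy layout, given the earlier entries: a neighbour of the last
vertex, if one is left, or else a vertex with at most one neighbour left. -/
noncomputable def layoutStep (n : ℕ) (E : ℕ → ℕ → Prop) (a : ℕ → ℕ) (i : ℕ) : ℕ :=
  leastBelow n fun v => (∀ j < i, a j ≠ v) ∧
    ((0 < i ∧ E (a (i - 1)) v) ∨
      (¬ (0 < i ∧ ∃ u < n, (∀ j < i, a j ≠ u) ∧ E (a (i - 1)) u) ∧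
        #{u ∈ range n | (∀ j < i, a j ≠ u) ∧ E v u} ≤ 1))

/-- The greedy layout of a graph on the numbers below `n`. -/
noncomputable def layout (n : ℕ) (E : ℕ → ℕ → Prop) : ℕ → ℕ := RAM.covRec (layoutStep n E)

/-- The sequence `o` lists `n` vertices so that edges join only consecutive ones. -/
def IsLinearLayout (n : ℕ) (E : ℕ → ℕ → Prop) (o : ℕ → ℕ) : Prop :=
  ∀ i < n, o i < n ∧ ∀ j < i, o j ≠ o i ∧ (E (o j) (o i) → i = j + 1)

/-- Vertex `v` is reached from `s` by a walk with at most `l` steps. -/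
def ReachedIn (n s : ℕ) (E : ℕ → ℕ → Prop) : ℕ → ℕ → Prop
  | 0, v => v = s
  | l + 1, v => ReachedIn n s E l v ∨ ∃ u < n, ReachedIn n s E l u ∧ E u v

/-- Digit `i` of `c` in base `B`. -/
def digit (B c i : ℕ) : ℕ := c / B ^ i % B

/-- The recursion for the maximum number of disjoint good intervals. -/
noncomputable def packingStep (good : ℕ → ℕ → Prop) (a : ℕ → ℕ) (j : ℕ) : ℕ :=
  if j = 0 then 0
  else max (a (j - 1)) ((range j).sup fun i => if good i (j - 1) then a i + 1 else 0)

/-- The maximum number of disjoint good intervals `[i, j]` with `j` less than the argument. -/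
noncomputable def packing (good : ℕ → ℕ → Prop) : ℕ → ℕ := RAM.covRec (packingStep good)

namespace MaxCDPInstance

variable (I : MaxCDPInstance)

/-- Adjacency as a relation on numbers. -/
def Adj (u v : ℕ) : Prop := ∃ (hu : u < I.n) (hv : v < I.n), I.G.Adj ⟨u, hu⟩ ⟨v, hv⟩

/-- The edge `uv` exists and has colour `c`. -/
def HasColor (c u v : ℕ) : Prop :=
  ∃ (hu : u < I.n) (hv : v < I.n) (hc : c < I.q) (h : I.G.Adj ⟨u, hu⟩ ⟨v, hv⟩),
    ⟨c, hc⟩ ∈ I.f ⟨s(⟨u, hu⟩, ⟨v, hv⟩), h⟩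

/-- The base of the codes used for certificates. -/
def base : ℕ := I.n + I.q

/-- Vertex `v` is `s`, `t`, or one of the first `k` digits of `x`. -/
def Deleted (k x v : ℕ) : Prop := v = I.s ∨ v = I.t ∨ ∃ i < k, digit I.base x i = v

/-- Adjacency after deletion of vertices. -/
def RestAdj (k x u v : ℕ) : Prop := I.Adj u v ∧ ¬ I.Deleted k x u ∧ ¬ I.Deleted k x v

/-- The greedy layout after deletion of vertices. -/
noncomputable def order (k x : ℕ) : ℕ → ℕ := layout I.n (I.RestAdj k x)

/-- There is a path from `s` to `t`, other than the edge `st`, with all edges of colour `c` and all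
internal vertices in `S`. -/
def Linked (c : ℕ) (S : ℕ → Prop) : Prop :=
  ReachedIn I.n I.s (fun u v => I.HasColor c u v ∧ ¬ (u = I.s ∧ v = I.t) ∧ ¬ (u = I.t ∧ v = I.s) ∧
    (v = I.t ∨ S v)) I.n I.t

/-- The vertices with position from `i` to `j`. -/
def Segment (o : ℕ → ℕ) (i j v : ℕ) : Prop := ∃ p < I.n, o p = v ∧ i ≤ p ∧ p ≤ j

/-- The union of the `m` segments with end points coded in row `a` of `lo` and `hi`. -/
def Territory (o : ℕ → ℕ) (m lo hi a v : ℕ) : Prop :=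
  ∃ i < m, I.Segment o (digit I.base lo (a * m + i)) (digit I.base hi (a * m + i)) v

/-- The segment from `i` to `j` avoids the territories and contains a route. -/
def Good (o : ℕ → ℕ) (m r lo hi i j : ℕ) : Prop :=
  (∀ v < I.n, I.Segment o i j v → ∀ a < r, ¬ I.Territory o m lo hi a v) ∧
    ∃ c < I.q, I.Linked c (I.Segment o i j)

/-- The number of paths consisting of the edge `st` only. -/
noncomputable def direct : ℕ := if ∃ c < I.q, I.HasColor c I.s I.t then 1 else 0

/-- The codes describe `r` disjoint routes which can be completed to `z` routes. -/
def IsCertificate (o : ℕ → ℕ) (m r col lo hi z : ℕ) : Prop :=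
  (∀ a < r, I.Linked (digit I.base col a) (I.Territory o m lo hi a)) ∧
  (∀ a < r, ∀ b < a, ∀ v < I.n, ¬ (I.Territory o m lo hi a v ∧ I.Territory o m lo hi b v)) ∧
  z ≤ r + packing (I.Good o m r lo hi) I.n + I.direct

/-- The search with loop bound `N` finds a certificate for `z` paths. -/
def Feasible (N z : ℕ) : Prop :=
  ∃ k < N, ∃ x < N, ∃ m < N, ∃ e < N, m = 3 * k + 6 ∧ e = k * m ∧ I.base ^ e ≤ N ∧
    IsLinearLayout I.n (I.RestAdj k x) (I.order k x) ∧
    ∃ r < N, r ≤ k ∧ ∃ col < N, ∃ lo < N, ∃ hi < N, I.IsCertificate (I.order k x) m r col lo hi z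

/-- The result of the search: one more than the optimum, or zero if the bound is too small. -/
noncomputable def searchResult (N : ℕ) : ℕ := #{z ∈ range N | I.Feasible N z}

end MaxCDPInstance

end

/-! ### The input word -/

namespace MaxCDPInstance

variable (I : MaxCDPInstance)

theorem two_le_n : 2 ≤ I.n := by
  have h := I.s_ne_t
  have h1 := I.s.2
  have h2 := I.t.2
  have h3 : (I.s : ℕ) ≠ I.t := fun h' => h (Fin.ext h')
  omega

theorem two_le_base : 2 ≤ I.base := I.two_le_n.trans (Nat.le_add_right _ _)

theorem encode_length : I.encode.length = 4 + I.n * I.n + I.n * I.n * I.q := by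
  simp [encode]; omega

theorem encode_header : I.encode.getD 0 0 = I.n ∧ I.encode.getD 1 0 = I.q ∧
    I.encode.getD 2 0 = I.s ∧ I.encode.getD 3 0 = I.t := by
  simp [encode]

theorem encode_adj {u v : ℕ} (hu : u < I.n) (hv : v < I.n) :
    I.encode.getD (4 + (u * I.n + v)) 0 ≠ 0 ↔ I.Adj u v := by
  classical
  have hlt : u * I.n + v < I.n * I.n := by nlinarith
  have h0 : 0 < I.n := by omega
  have h1 : I.encode.getD (4 + (u * I.n + v)) 0 =
      if I.G.Adj (Fin.divNat (⟨u * I.n + v, hlt⟩ : Fin (I.n * I.n)))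
        (Fin.modNat (⟨u * I.n + v, hlt⟩ : Fin (I.n * I.n))) then 1 else 0 := by
    rw [encode, List.append_assoc, List.getD_append_right _ _ _ _ (by simp),
      List.getD_append _ _ _ _ (by simpa using hlt)]
    simp only [List.length_cons, List.length_nil, Nat.zero_add, Nat.reduceAdd,
      Nat.add_sub_cancel_left]
    rw [List.getD_eq_getElem _ _ (by simpa using hlt), List.getElem_ofFn]
  have h2 : Fin.divNat (⟨u * I.n + v, hlt⟩ : Fin (I.n * I.n)) = ⟨u, hu⟩ := by
    apply Fin.ext
    simp [Fin.divNat, mul_comm u, Nat.mul_add_div h0, Nat.div_eq_of_lt hv]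
  have h3 : Fin.modNat (⟨u * I.n + v, hlt⟩ : Fin (I.n * I.n)) = ⟨v, hv⟩ := by
    apply Fin.ext
    simp [Fin.modNat, mul_comm u, Nat.mod_eq_of_lt hv]
  rw [h1, h2, h3]
  simp only [Adj, hu, hv, exists_true_left]
  split_ifs with h <;> simp [h]

theorem encode_color {u v c : ℕ} (hu : u < I.n) (hv : v < I.n) (hc : c < I.q) :
    I.encode.getD (4 + I.n * I.n + ((u * I.n + v) * I.q + c)) 0 ≠ 0 ↔ I.HasColor c u v := by
  classical
  have hlt : u * I.n + v < I.n * I.n := by nlinarith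
  have hlt' : (u * I.n + v) * I.q + c < I.n * I.n * I.q := by nlinarith
  have h0 : 0 < I.n := by omega
  have h0' : 0 < I.q := by omega
  set j : Fin (I.n * I.n * I.q) := ⟨(u * I.n + v) * I.q + c, hlt'⟩ with hj
  have h1 : I.encode.getD (4 + I.n * I.n + ((u * I.n + v) * I.q + c)) 0 =
      if ∃ h : I.G.Adj j.divNat.divNat j.divNat.modNat,
        j.modNat ∈ I.f ⟨s(j.divNat.divNat, j.divNat.modNat), h⟩ then 1 else 0 := by
    rw [encode, List.getD_append_right _ _ _ _ (by simp; omega)]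
    simp only [List.length_append, List.length_ofFn, List.length_cons, List.length_nil,
      Nat.zero_add, Nat.reduceAdd, Nat.add_sub_cancel_left]
    rw [List.getD_eq_getElem _ _ (by simpa using hlt'), List.getElem_ofFn]
  have h4 : j.divNat = ⟨u * I.n + v, hlt⟩ := by
    apply Fin.ext
    simp [hj, Fin.divNat, mul_comm _ I.q, Nat.mul_add_div h0', Nat.div_eq_of_lt hc]
  have h5 : j.modNat = ⟨c, hc⟩ := by
    apply Fin.ext
    simp [hj, Fin.modNat, mul_comm _ I.q, Nat.mod_eq_of_lt hc]
  have h2 : Fin.divNat (⟨u * I.n + v, hlt⟩ : Fin (I.n * I.n)) = ⟨u, hu⟩ := by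
    apply Fin.ext
    simp [Fin.divNat, mul_comm u, Nat.mul_add_div h0, Nat.div_eq_of_lt hv]
  have h3 : Fin.modNat (⟨u * I.n + v, hlt⟩ : Fin (I.n * I.n)) = ⟨v, hv⟩ := by
    apply Fin.ext
    simp [Fin.modNat, mul_comm u, Nat.mod_eq_of_lt hv]
  have h6 : (∃ h : I.G.Adj j.divNat.divNat j.divNat.modNat,
      j.modNat ∈ I.f ⟨s(j.divNat.divNat, j.divNat.modNat), h⟩) ↔ I.HasColor c u v := by
    simp only [HasColor, hu, hv, hc, exists_true_left]
    rw [h4, h5]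
    simp only [h2, h3]
  rw [h1, ← h6]
  split_ifs with h <;> simp [h]

end MaxCDPInstance

/-! ### Definability of the algorithm -/

namespace BoundedInstance

variable (b : BoundedInstance)

/-- The table for reachability is read at index `n * n + t`. The input length alone may fall short
of this when there are no colours, whence the factor `2` in `le_N`. -/
theorem n_sq_le : b.I.n * b.I.n + b.I.n ≤ b.N := by
  have h := b.le_N
  rw [b.I.encode_length] at h
  have := b.I.two_le_n
  nlinarith [Nat.zero_le (b.I.n * b.I.n * b.I.q)]

theorem n_le : b.I.n ≤ b.N := (Nat.le_add_left _ _).trans b.n_sq_le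

theorem base_le : b.I.base ≤ b.N := by
  have h := b.le_N
  rw [b.I.encode_length] at h
  have := b.I.two_le_n
  have h4 : 1 * b.I.q ≤ b.I.n * b.I.n * b.I.q := Nat.mul_le_mul_right _ (by nlinarith)
  have h5 : b.I.n * 1 ≤ b.I.n * b.I.n := Nat.mul_le_mul_left _ (by omega)
  rw [MaxCDPInstance.base]
  omega

theorem q_le : b.I.q ≤ b.N := (Nat.le_add_left _ _).trans b.base_le

end BoundedInstance

namespace RAM

open Ctx

variable {Γ Δ : Type} [Ctx Γ] [Ctx Δ]

namespace Dfn

theorem inp_n : Dfn fun γ : Γ => (inp γ).I.n :=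
  (input (const 0)).congr fun _ _ => (MaxCDPInstance.encode_header _).1

theorem inp_q : Dfn fun γ : Γ => (inp γ).I.q :=
  (input (const 1)).congr fun _ _ => (MaxCDPInstance.encode_header _).2.1

theorem inp_s : Dfn fun γ : Γ => ((inp γ).I.s : ℕ) :=
  (input (const 2)).congr fun _ _ => (MaxCDPInstance.encode_header _).2.2.1

theorem inp_t : Dfn fun γ : Γ => ((inp γ).I.t : ℕ) :=
  (input (const 3)).congr fun _ _ => (MaxCDPInstance.encode_header _).2.2.2

theorem inp_base : Dfn fun γ : Γ => (inp γ).I.base := inp_n.add inp_q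

end Dfn

theorem DfnP.adj {u v : Γ → ℕ} (hu : Dfn u) (hv : Dfn v) :
    DfnP fun γ => (inp γ).I.Adj (u γ) (v γ) := by
  have h : Dfn fun γ => (inp γ).I.encode.getD (4 + (u γ * (inp γ).I.n + v γ)) 0 :=
    .input ((Dfn.const 4).add ((hu.mul .inp_n fun γ _ => (inp γ).n_le).add hv))
  refine (((lt hu .inp_n).and (lt hv .inp_n)).and (ne h (.const 0))).congr fun γ _ => ?_
  constructor
  · rintro ⟨⟨h1, h2⟩, h3⟩
    exact ((inp γ).I.encode_adj h1 h2).1 h3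
  · rintro h3
    obtain ⟨h1, h2, -⟩ := id h3
    exact ⟨⟨h1, h2⟩, ((inp γ).I.encode_adj h1 h2).2 h3⟩

theorem DfnP.hasColor {c u v : Γ → ℕ} (hc : Dfn c) (hu : Dfn u) (hv : Dfn v) :
    DfnP fun γ => (inp γ).I.HasColor (c γ) (u γ) (v γ) := by
  have h : Dfn fun γ => (inp γ).I.encode.getD (4 + (inp γ).I.n * (inp γ).I.n +
      ((u γ * (inp γ).I.n + v γ) * (inp γ).I.q + c γ)) 0 :=
    .input (((Dfn.const 4).add (.mul .inp_n .inp_n fun γ _ => (inp γ).n_le)).add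
      ((((hu.mul .inp_n fun γ _ => (inp γ).n_le).add hv).mul .inp_q
        fun γ _ => (inp γ).q_le).add hc))
  refine ((((lt hu .inp_n).and (lt hv .inp_n)).and (lt hc .inp_q)).and
    (ne h (.const 0))).congr fun γ _ => ?_
  constructor
  · rintro ⟨⟨⟨h1, h2⟩, h3⟩, h4⟩
    exact ((inp γ).I.encode_color h1 h2 h3).1 h4
  · rintro h4
    obtain ⟨h1, h2, h3, -⟩ := id h4
    exact ⟨⟨⟨h1, h2⟩, h3⟩, ((inp γ).I.encode_color h1 h2 h3).2 h4⟩

/-- No bound on the index `i` is needed: as `c ≤ N < base ^ N`, all digits from `N` on vanish, so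
the exponent may be cut off at `N`. -/
theorem Dfn.digit {c i : Γ → ℕ} (hc : Dfn c) (hcN : ∀ γ, Ok γ → c γ ≤ (inp γ).N) (hi : Dfn i) :
    Dfn fun γ => digit (inp γ).I.base (c γ) (i γ) := by
  refine ((hc.div (inp_base.pow (fun γ _ => (inp γ).base_le) (hi.min .N)
    fun γ _ => min_le_right _ _) hcN).mod inp_base fun γ h =>
      (Nat.div_le_self _ _).trans (hcN γ h)).congr fun γ h => ?_
  rw [_root_.digit]
  rcases le_total (i γ) (inp γ).N with h' | h'
  · rw [min_eq_left h']
  · have h2 : c γ < (inp γ).I.base ^ (inp γ).N :=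
      (hcN γ h).trans_lt (Nat.lt_pow_self (inp γ).I.two_le_base)
    have h3 : (inp γ).I.base ^ (inp γ).N ≤ (inp γ).I.base ^ (i γ) :=
      Nat.pow_le_pow_right (by have := (inp γ).I.two_le_base; omega) h'
    rw [min_eq_right h', Nat.div_eq_of_lt h2, Nat.div_eq_of_lt (h2.trans_le h3)]

theorem DfnP.deleted {k x v : Γ → ℕ} (hk : Dfn k) (hkN : ∀ γ, Ok γ → k γ ≤ (inp γ).N) (hx : Dfn x)
    (hxN : ∀ γ, Ok γ → x γ ≤ (inp γ).N) (hv : Dfn v) :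
    DfnP fun γ => (inp γ).I.Deleted (k γ) (x γ) (v γ) :=
  (eq hv .inp_s).or ((eq hv .inp_t).or (exists_lt
    (P := fun γ i => digit (inp γ).I.base (x γ) i = v γ) (eq (hx.fst.digit (fun p h => hxN p.1 h.1) .snd) hv.fst) hk hkN))

theorem DfnP.restAdj {k x u v : Γ → ℕ} (hk : Dfn k) (hkN : ∀ γ, Ok γ → k γ ≤ (inp γ).N) (hx : Dfn x)
    (hxN : ∀ γ, Ok γ → x γ ≤ (inp γ).N) (hu : Dfn u) (hv : Dfn v) :
    DfnP fun γ => (inp γ).I.RestAdj (k γ) (x γ) (u γ) (v γ) :=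
  (adj hu hv).and ((deleted hk hkN hx hxN hu).not.and (deleted hk hkN hx hxN hv).not)

theorem Dfn.leastBelow {P : Γ → ℕ → Prop} (hP : DfnP fun p : Γ × ℕ => P p.1 p.2) {e : Γ → ℕ}
    (he : Dfn e) (hle : ∀ γ, Ok γ → e γ ≤ (inp γ).N) : Dfn fun γ => leastBelow (e γ) (P γ) := by
  classical
  refine (card_filter (P := fun γ j => ¬ P γ j ∧ ∀ i < j, ¬ P γ i) (hP.not.and (DfnP.forall_lt
    (P := fun (p : Γ × ℕ) i => ¬ P p.1 i) (hP.call (π := fun p : (Γ × ℕ) × ℕ => p.1.1)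
      Proj.id.fst.fst .snd fun p h => h.2).not .snd fun p h => h.2)) he hle).congr fun γ _ => ?_
  rw [_root_.leastBelow]

theorem Dfn.order {k x i : Γ → ℕ} (hk : Dfn k) (hkN : ∀ γ, Ok γ → k γ ≤ (inp γ).N) (hx : Dfn x)
    (hxN : ∀ γ, Ok γ → x γ ≤ (inp γ).N) (hi : Dfn i) (hiN : ∀ γ, Ok γ → i γ ≤ (inp γ).N) :
    Dfn fun γ => (inp γ).I.order (k γ) (x γ) (i γ) := by
  -- This fact and the next are stated for every context over the given one, because they are
  -- applied under different numbers of binders.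
  have hE : ∀ {Δ : Type} [Ctx Δ] {π : Δ → Γ}, Proj π → ∀ {u v : Δ → ℕ}, Dfn u → Dfn v →
      DfnP fun δ => (inp (π δ)).I.RestAdj (k (π δ)) (x (π δ)) (u δ) (v δ) := by
    intro Δ _ π hπ u v hu hv
    refine (DfnP.restAdj (hk.proj hπ) (fun δ h => ?_) (hx.proj hπ) (fun δ h => ?_) hu hv).congr
      fun δ _ => by rw [hπ.inp_eq]
    · exact hπ.inp_eq δ ▸ hkN _ (hπ.ok h)
    · exact hπ.inp_eq δ ▸ hxN _ (hπ.ok h)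
  have hfree : ∀ {Δ : Type} [Ctx Δ] {π : Δ → (Γ × (ℕ → ℕ)) × ℕ}, Proj π → ∀ {v : Δ → ℕ}, Dfn v →
      DfnP fun δ => ∀ j < (π δ).2, (π δ).1.2 j ≠ v δ := by
    intro Δ _ π hπ v hv
    refine DfnP.forall_lt (P := fun δ j => (π δ).1.2 j ≠ v δ) (DfnP.ne ?_ hv.fst)
      (Dfn.snd.proj hπ) fun δ h => ?_
    · exact Dfn.entry (π := fun p : Δ × ℕ => (π p.1).1)
        ⟨fun p => hπ.inp_eq p.1, fun h => (hπ.ok h.1).1, fun h => (hπ.rep h.1).1⟩ .snd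
    · exact hπ.inp_eq δ ▸ (hπ.ok h).2
  refine cov (b := fun γ => layoutStep (inp γ).I.n ((inp γ).I.RestAdj (k γ) (x γ))) ?_ hi hiN
  classical
  refine Dfn.leastBelow (P := fun (p : (Γ × (ℕ → ℕ)) × ℕ) v => (∀ j < p.2, p.1.2 j ≠ v) ∧
    ((0 < p.2 ∧ (inp p.1.1).I.RestAdj (k p.1.1) (x p.1.1) (p.1.2 (p.2 - 1)) v) ∨
      (¬ (0 < p.2 ∧ ∃ u < (inp p.1.1).I.n, (∀ j < p.2, p.1.2 j ≠ u) ∧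
        (inp p.1.1).I.RestAdj (k p.1.1) (x p.1.1) (p.1.2 (p.2 - 1)) u) ∧
        #{u ∈ range (inp p.1.1).I.n | (∀ j < p.2, p.1.2 j ≠ u) ∧
          (inp p.1.1).I.RestAdj (k p.1.1) (x p.1.1) v u} ≤ 1))) ?_
    .inp_n fun p _ => (inp p.1.1).n_le
  have hpos {Δ : Type} [Ctx Δ] {π : Δ → (Γ × (ℕ → ℕ)) × ℕ} (hπ : Proj π) :
      DfnP fun δ => 0 < (π δ).2 := DfnP.lt (.const 0) (Dfn.snd.proj hπ)
  have hnext : DfnP fun p : (((Γ × (ℕ → ℕ)) × ℕ) × ℕ) =>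
      (inp p.1.1.1).I.RestAdj (k p.1.1.1) (x p.1.1.1) (p.1.1.2 (p.1.2 - 1)) p.2 :=
    hE (π := fun p : ((Γ × (ℕ → ℕ)) × ℕ) × ℕ => p.1.1.1) Proj.table.fst Dfn.pred_entry.fst .snd
  refine (hfree (π := fun p : ((Γ × (ℕ → ℕ)) × ℕ) × ℕ => p.1) Proj.id.fst .snd).and
    (((hpos Proj.id.fst).and hnext).or (.and (.not (.and (hpos Proj.id.fst)
      (DfnP.fst (P := fun p : (Γ × (ℕ → ℕ)) × ℕ => ∃ u < (inp p.1.1).I.n,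
        (∀ j < p.2, p.1.2 j ≠ u) ∧
        (inp p.1.1).I.RestAdj (k p.1.1) (x p.1.1) (p.1.2 (p.2 - 1)) u) ?_))) ?_))
  · exact DfnP.exists_lt (P := fun (p : (Γ × (ℕ → ℕ)) × ℕ) u => (∀ j < p.2, p.1.2 j ≠ u) ∧
        (inp p.1.1).I.RestAdj (k p.1.1) (x p.1.1) (p.1.2 (p.2 - 1)) u)
      ((hfree (π := fun p : ((Γ × (ℕ → ℕ)) × ℕ) × ℕ => p.1) Proj.id.fst .snd).and hnext)
      .inp_n fun p _ => (inp p.1.1).n_le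
  · refine DfnP.le (Dfn.card_filter (P := fun (p : ((Γ × (ℕ → ℕ)) × ℕ) × ℕ) u =>
      (∀ j < p.1.2, p.1.1.2 j ≠ u) ∧
          (inp p.1.1.1).I.RestAdj (k p.1.1.1) (x p.1.1.1) p.2 u) ?_
      .inp_n fun p _ => (inp p.1.1.1).n_le) (.const 1)
    exact (hfree (π := fun p : (((Γ × (ℕ → ℕ)) × ℕ) × ℕ) × ℕ => p.1.1) Proj.id.fst.fst .snd).and
      (hE (π := fun p : (((Γ × (ℕ → ℕ)) × ℕ) × ℕ) × ℕ => p.1.1.1.1) Proj.table.fst.fst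
        Dfn.snd.fst .snd)

end RAM

/-- The recursion that tabulates `ReachedIn`: entry `l * n + v` tells whether `v` is reached within
`l` steps. -/
theorem covRec_reachedIn {n s : ℕ} {E : ℕ → ℕ → Prop} {b : (ℕ → ℕ) → ℕ → ℕ}
    (hb : ∀ a i, b a i ≠ 0 ↔ (i < n ∧ i = s) ∨ (n ≤ i ∧
      (a (i - n) ≠ 0 ∨ ∃ u < n, a (i - n - i % n + u) ≠ 0 ∧ E u (i % n)))) (l : ℕ) :
    ∀ v < n, RAM.covRec b (l * n + v) ≠ 0 ↔ ReachedIn n s E l v := by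
  induction l with
  | zero =>
    intro v hv
    rw [RAM.covRec, hb]
    simp only [ReachedIn, Nat.zero_mul, Nat.zero_add]
    refine ⟨fun h => ?_, fun h => .inl ⟨hv, h⟩⟩
    rcases h with h | h
    · exact h.2
    · omega
  | succ l ih =>
    intro v hv
    -- For index `i` in row `l + 1`, index `i - n` is the same vertex one row earlier, and `i - n -
    -- i % n` is the start of that earlier row.
    have h1 : (l + 1) * n + v - n = l * n + v := by rw [Nat.succ_mul]; omega
    have h2 : ((l + 1) * n + v) % n = v := by
      rw [mul_comm, Nat.mul_add_mod, Nat.mod_eq_of_lt hv]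
    have h3 : n ≤ (l + 1) * n + v := by rw [Nat.succ_mul]; omega
    have h4 : l * n + v - v = l * n := by omega
    rw [RAM.covRec, hb, h1, h2, h4, RAM.table_apply,
      if_pos (by rw [Nat.succ_mul]; omega), ih v hv, ReachedIn]
    have h5 : ∀ u < n, (RAM.table b ((l + 1) * n + v) (l * n + u) ≠ 0 ↔ ReachedIn n s E l u) := by
      intro u hu
      rw [RAM.table_apply, if_pos (by rw [Nat.succ_mul]; omega), ih u hu]
    constructor
    · rintro (h | ⟨-, h | ⟨u, hu, h, h'⟩⟩)
      · omega
      · exact .inl h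
      · exact .inr ⟨u, hu, (h5 u hu).1 h, h'⟩
    · rintro (h | ⟨u, hu, h, h'⟩)
      · exact .inr ⟨h3, .inl h⟩
      · exact .inr ⟨h3, .inr ⟨u, hu, (h5 u hu).2 h, h'⟩⟩

namespace RAM

open Ctx

variable {Γ Δ : Type} [Ctx Γ] [Ctx Δ]

theorem Dfn.lift {o : Γ → ℕ → ℕ} (ho : Dfn fun p : Γ × ℕ => o p.1 p.2) {π : Δ → Γ} (hπ : Proj π) :
    Dfn fun p : Δ × ℕ => o (π p.1) p.2 :=
  ho.call hπ.fst .snd fun _ h => h.2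

theorem Dfn.indicator {P : Γ → Prop} [∀ γ, Decidable (P γ)] (hP : DfnP P) :
    Dfn fun γ => if P γ then 1 else 0 := ite hP (const 1) (const 0)

theorem DfnP.linked {c : Γ → ℕ} (hc : Dfn c) {S : Γ → ℕ → Prop}
    (hS : DfnP fun p : Γ × ℕ => S p.1 p.2) : DfnP fun γ => (inp γ).I.Linked (c γ) (S γ) := by
  classical
  let E : Γ → ℕ → ℕ → Prop := fun γ u v => (inp γ).I.HasColor (c γ) u v ∧
    ¬ (u = (inp γ).I.s ∧ v = (inp γ).I.t) ∧ ¬ (u = (inp γ).I.t ∧ v = (inp γ).I.s) ∧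
    (v = (inp γ).I.t ∨ S γ v)
  let b : Γ → (ℕ → ℕ) → ℕ → ℕ := fun γ a i => if (i < (inp γ).I.n ∧ i = (inp γ).I.s) ∨
    ((inp γ).I.n ≤ i ∧ (a (i - (inp γ).I.n) ≠ 0 ∨ ∃ u < (inp γ).I.n,
      a (i - (inp γ).I.n - i % (inp γ).I.n + u) ≠ 0 ∧ E γ u (i % (inp γ).I.n))) then 1 else 0
  -- The entry wanted is that of `t` in row `n`.
  have hle (γ : Γ) : (inp γ).I.n * (inp γ).I.n + (inp γ).I.t ≤ (inp γ).N :=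
    (Nat.add_le_add_left (inp γ).I.t.2.le _).trans (inp γ).n_sq_le
  have hmod : Dfn fun p : (Γ × (ℕ → ℕ)) × ℕ => p.2 % (inp p.1.1).I.n :=
    Dfn.snd.mod .inp_n fun p h => h.2
  have hb : Dfn fun p : (Γ × (ℕ → ℕ)) × ℕ => b p.1.1 p.1.2 p.2 := by
    refine Dfn.indicator (DfnP.or (.and (.lt .snd .inp_n) (.eq .snd .inp_s)) (.and (.le .inp_n .snd)
      (.or (.ne (.entry Proj.id.fst (.sub .snd .inp_n)) (.const 0)) (.exists_lt
        (P := fun (p : (Γ × (ℕ → ℕ)) × ℕ) u =>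
          p.1.2 (p.2 - (inp p.1.1).I.n - p.2 % (inp p.1.1).I.n + u) ≠ 0 ∧
            E p.1.1 u (p.2 % (inp p.1.1).I.n))
        (.and (.ne (.entry (Proj.id.fst.fst)
          (.add (.sub (.sub Dfn.snd.fst .inp_n) hmod.fst) .snd)) (.const 0))
          (.and (.hasColor (hc.proj (Proj.table.fst)) .snd hmod.fst)
            (.and (.not (.and (.eq .snd .inp_s) (.eq hmod.fst .inp_t)))
            (.and (.not (.and (.eq .snd .inp_t) (.eq hmod.fst .inp_s)))
            (.or (.eq hmod.fst .inp_t) (hS.call (π := fun p : ((Γ × (ℕ → ℕ)) × ℕ) × ℕ => p.1.1.1)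
              Proj.table.fst hmod.fst fun p h => (Nat.mod_le _ _).trans h.1.2))))))
        .inp_n fun p _ => (inp p.1.1).n_le))))
  refine DfnP.congr (.ne (Dfn.cov (b := b) hb (e := fun γ => (inp γ).I.n * (inp γ).I.n + (inp γ).I.t)
    (.add (.mul .inp_n .inp_n fun γ _ => (inp γ).n_le) .inp_t) fun γ _ => hle γ) (.const 0))
    fun γ _ => ?_
  refine covRec_reachedIn (E := E γ) (fun a i => ?_) _ _ (inp γ).I.t.2
  simp only [b]
  split_ifs with h
  · simpa using h
  · simpa using h

theorem DfnP.segment {o : Γ → ℕ → ℕ} (ho : Dfn fun p : Γ × ℕ => o p.1 p.2) {i j v : Γ → ℕ}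
    (hi : Dfn i) (hj : Dfn j) (hv : Dfn v) :
    DfnP fun γ => (inp γ).I.Segment (o γ) (i γ) (j γ) (v γ) :=
  .exists_lt (P := fun γ p => o γ p = v γ ∧ i γ ≤ p ∧ p ≤ j γ)
    (.and (.eq ho hv.fst) (.and (.le hi.fst .snd) (.le .snd hj.fst))) .inp_n
    fun γ _ => (inp γ).n_le

theorem DfnP.territory {o : Γ → ℕ → ℕ} (ho : Dfn fun p : Γ × ℕ => o p.1 p.2)
    {m lo hi a v : Γ → ℕ} (hm : Dfn m) (hmN : ∀ γ, Ok γ → m γ ≤ (inp γ).N) (hlo : Dfn lo)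
    (hloN : ∀ γ, Ok γ → lo γ ≤ (inp γ).N) (hhi : Dfn hi) (hhiN : ∀ γ, Ok γ → hi γ ≤ (inp γ).N)
    (ha : Dfn a) (hv : Dfn v) :
    DfnP fun γ => (inp γ).I.Territory (o γ) (m γ) (lo γ) (hi γ) (a γ) (v γ) := by
  have hidx : Dfn fun p : Γ × ℕ => a p.1 * m p.1 + p.2 :=
    .add (.mul ha.fst hm.fst fun p h => hmN _ h.1) .snd
  exact .exists_lt (P := fun γ i => (inp γ).I.Segment (o γ)
    (_root_.digit (inp γ).I.base (lo γ) (a γ * m γ + i))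
    (_root_.digit (inp γ).I.base (hi γ) (a γ * m γ + i)) (v γ))
    (.segment (ho.lift Proj.id.fst) (hlo.fst.digit (fun p h => hloN _ h.1) hidx)
      (hhi.fst.digit (fun p h => hhiN _ h.1) hidx) hv.fst) hm hmN

/-- Definability of `good` is demanded over every extension of the context, since its arguments are
substituted under the binders of the table and of the supremum. -/
theorem Dfn.packing {good : Γ → ℕ → ℕ → Prop} (hgood : ∀ {Δ : Type} [Ctx Δ] {π : Δ → Γ}, Proj π →
      ∀ {i j : Δ → ℕ}, Dfn i → Dfn j → DfnP fun δ => good (π δ) (i δ) (j δ))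
    {e : Γ → ℕ} (he : Dfn e) (hle : ∀ γ, Ok γ → e γ ≤ (inp γ).N) :
    Dfn fun γ => packing (good γ) (e γ) := by
  classical
  refine cov (b := fun γ => packingStep (good γ)) ?_ he hle
  refine ite (.eq .snd (.const 0)) (.const 0) (.max pred_entry (.sup
    (f := fun (p : (Γ × (ℕ → ℕ)) × ℕ) i => if good p.1.1 i (p.2 - 1) then p.1.2 i + 1 else 0)
    (.ite (hgood Proj.table.fst .snd pred_table.fst)
      (.add (.entry (π := fun p : ((Γ × (ℕ → ℕ)) × ℕ) × ℕ => p.1.1) Proj.id.fst.fst .snd)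
        (.const 1)) (.const 0)) .snd fun p h => h.2))

theorem DfnP.good {o : Γ → ℕ → ℕ} (ho : Dfn fun p : Γ × ℕ => o p.1 p.2)
    {m r lo hi i j : Γ → ℕ} (hm : Dfn m) (hmN : ∀ γ, Ok γ → m γ ≤ (inp γ).N) (hr : Dfn r)
    (hrN : ∀ γ, Ok γ → r γ ≤ (inp γ).N) (hlo : Dfn lo)
    (hloN : ∀ γ, Ok γ → lo γ ≤ (inp γ).N) (hhi : Dfn hi) (hhiN : ∀ γ, Ok γ → hi γ ≤ (inp γ).N)
    (hi' : Dfn i) (hj : Dfn j) :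
    DfnP fun γ => (inp γ).I.Good (o γ) (m γ) (r γ) (lo γ) (hi γ) (i γ) (j γ) := by
  refine .and (.forall_lt (P := fun γ v => (inp γ).I.Segment (o γ) (i γ) (j γ) v → ∀ a < r γ,
      ¬ (inp γ).I.Territory (o γ) (m γ) (lo γ) (hi γ) a v)
    (.imp (.segment (ho.lift Proj.id.fst) hi'.fst hj.fst .snd) (.forall_lt
      (P := fun (p : Γ × ℕ) a => ¬ (inp p.1).I.Territory (o p.1) (m p.1) (lo p.1) (hi p.1) a p.2)
      (.not (.territory (ho.lift Proj.id.fst.fst) hm.fst.fst (fun p h => hmN _ h.1.1) hlo.fst.fst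
        (fun p h => hloN _ h.1.1) hhi.fst.fst (fun p h => hhiN _ h.1.1) .snd Dfn.snd.fst)) hr.fst
      fun p h => hrN _ h.1)) .inp_n fun γ _ => (inp γ).n_le)
    (.exists_lt (P := fun γ c => (inp γ).I.Linked c ((inp γ).I.Segment (o γ) (i γ) (j γ)))
      (.linked .snd (.segment (ho.lift Proj.id.fst.fst) hi'.fst.fst hj.fst.fst .snd)) .inp_q
      fun γ _ => (inp γ).q_le)

theorem Dfn.direct : Dfn fun γ : Γ => (inp γ).I.direct := by
  classical
  exact .ite (.exists_lt (P := fun (γ : Γ) c => (inp γ).I.HasColor c (inp γ).I.s (inp γ).I.t)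
    (.hasColor .snd .inp_s .inp_t) .inp_q fun γ _ => (inp γ).q_le) (.const 1) (.const 0)

theorem DfnP.isCertificate {o : Γ → ℕ → ℕ} (ho : Dfn fun p : Γ × ℕ => o p.1 p.2)
    {m r col lo hi z : Γ → ℕ} (hm : Dfn m) (hmN : ∀ γ, Ok γ → m γ ≤ (inp γ).N) (hr : Dfn r)
    (hrN : ∀ γ, Ok γ → r γ ≤ (inp γ).N) (hcol : Dfn col)
    (hcolN : ∀ γ, Ok γ → col γ ≤ (inp γ).N) (hlo : Dfn lo)
    (hloN : ∀ γ, Ok γ → lo γ ≤ (inp γ).N) (hhi : Dfn hi) (hhiN : ∀ γ, Ok γ → hi γ ≤ (inp γ).N)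
    (hz : Dfn z) :
    DfnP fun γ => (inp γ).I.IsCertificate (o γ) (m γ) (r γ) (col γ) (lo γ) (hi γ) (z γ) := by
  have hterr {Δ : Type} [Ctx Δ] {π : Δ → Γ} (hπ : Proj π) {a v : Δ → ℕ} (ha : Dfn a) (hv : Dfn v) :
      DfnP fun δ => (inp δ).I.Territory (o (π δ)) (m (π δ)) (lo (π δ)) (hi (π δ)) (a δ) (v δ) :=
    .territory (ho.lift hπ) (hm.proj hπ) (fun δ h => hπ.inp_eq δ ▸ hmN _ (hπ.ok h))
      (hlo.proj hπ) (fun δ h => hπ.inp_eq δ ▸ hloN _ (hπ.ok h)) (hhi.proj hπ)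
      (fun δ h => hπ.inp_eq δ ▸ hhiN _ (hπ.ok h)) ha hv
  refine .and (.forall_lt (P := fun γ a => (inp γ).I.Linked (_root_.digit (inp γ).I.base (col γ) a)
      ((inp γ).I.Territory (o γ) (m γ) (lo γ) (hi γ) a))
    (.linked (hcol.fst.digit (fun p h => hcolN _ h.1) .snd)
      (hterr Proj.id.fst.fst Dfn.snd.fst .snd)) hr hrN) (.and ?_ ?_)
  · refine .forall_lt (P := fun γ a => ∀ b < a, ∀ v < (inp γ).I.n,
      ¬ ((inp γ).I.Territory (o γ) (m γ) (lo γ) (hi γ) a v ∧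
        (inp γ).I.Territory (o γ) (m γ) (lo γ) (hi γ) b v)) ?_ hr hrN
    refine .forall_lt (P := fun (p : Γ × ℕ) b => ∀ v < (inp p.1).I.n,
      ¬ ((inp p.1).I.Territory (o p.1) (m p.1) (lo p.1) (hi p.1) p.2 v ∧
        (inp p.1).I.Territory (o p.1) (m p.1) (lo p.1) (hi p.1) b v)) ?_ .snd fun p h => h.2
    refine .forall_lt (P := fun (p : (Γ × ℕ) × ℕ) v =>
      ¬ ((inp p.1.1).I.Territory (o p.1.1) (m p.1.1) (lo p.1.1) (hi p.1.1) p.1.2 v ∧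
        (inp p.1.1).I.Territory (o p.1.1) (m p.1.1) (lo p.1.1) (hi p.1.1) p.2 v)) ?_ .inp_n
      fun p _ => (inp p.1.1).n_le
    exact .not (.and (hterr Proj.id.fst.fst.fst Dfn.snd.fst.fst .snd)
      (hterr Proj.id.fst.fst.fst Dfn.snd.fst .snd))
  · refine .le hz (.add (.add hr (.packing
      (good := fun γ => (inp γ).I.Good (o γ) (m γ) (r γ) (lo γ) (hi γ)) ?_ .inp_n
        fun γ _ => (inp γ).n_le)) .direct)
    intro Δ _ π hπ i j hi' hj
    refine (DfnP.good (ho.lift hπ) (hm.proj hπ) (fun δ h => hπ.inp_eq δ ▸ hmN _ (hπ.ok h))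
      (hr.proj hπ) (fun δ h => hπ.inp_eq δ ▸ hrN _ (hπ.ok h))
      (hlo.proj hπ) (fun δ h => hπ.inp_eq δ ▸ hloN _ (hπ.ok h)) (hhi.proj hπ)
      (fun δ h => hπ.inp_eq δ ▸ hhiN _ (hπ.ok h)) hi' hj).congr fun δ _ => by rw [hπ.inp_eq]

theorem DfnP.isLinearLayout {k x : Γ → ℕ} (hk : Dfn k) (hkN : ∀ γ, Ok γ → k γ ≤ (inp γ).N)
    (hx : Dfn x) (hxN : ∀ γ, Ok γ → x γ ≤ (inp γ).N) :
    DfnP fun γ => IsLinearLayout (inp γ).I.n ((inp γ).I.RestAdj (k γ) (x γ))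
      ((inp γ).I.order (k γ) (x γ)) := by
  have h2 : Dfn fun p : Γ × ℕ => (inp p).I.order (k p.1) (x p.1) p.2 :=
    .order hk.fst (fun p h => hkN _ h.1) hx.fst (fun p h => hxN _ h.1) .snd fun p h => h.2
  have h3 : Dfn fun p : (Γ × ℕ) × ℕ => (inp p).I.order (k p.1.1) (x p.1.1) p.2 :=
    .order hk.fst.fst (fun p h => hkN _ h.1.1) hx.fst.fst (fun p h => hxN _ h.1.1) .snd
      fun p h => h.2
  refine .forall_lt (P := fun γ i => (inp γ).I.order (k γ) (x γ) i < (inp γ).I.n ∧ ∀ j < i,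
    (inp γ).I.order (k γ) (x γ) j ≠ (inp γ).I.order (k γ) (x γ) i ∧
    ((inp γ).I.RestAdj (k γ) (x γ) ((inp γ).I.order (k γ) (x γ) j)
      ((inp γ).I.order (k γ) (x γ) i) → i = j + 1)) (.and (.lt h2 .inp_n) ?_) .inp_n
    fun γ _ => (inp γ).n_le
  exact .forall_lt (P := fun (p : Γ × ℕ) j =>
    (inp p).I.order (k p.1) (x p.1) j ≠ (inp p).I.order (k p.1) (x p.1) p.2 ∧
    ((inp p).I.RestAdj (k p.1) (x p.1) ((inp p).I.order (k p.1) (x p.1) j)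
      ((inp p).I.order (k p.1) (x p.1) p.2) → p.2 = j + 1)) (.and (.ne h3 h2.fst)
      (.imp (.restAdj hk.fst.fst (fun p h => hkN _ h.1.1) hx.fst.fst (fun p h => hxN _ h.1.1)
        h3 h2.fst) (.eq Dfn.snd.fst (.add .snd (.const 1))))) .snd fun p h => h.2

theorem DfnP.exists_lt_N {P : Γ → ℕ → Prop} (hP : DfnP fun p : Γ × ℕ => P p.1 p.2) :
    DfnP fun γ => ∃ i < (inp γ).N, P γ i := .exists_lt hP .N fun _ _ => le_rfl

theorem DfnP.pow_base_le_N {e : Γ → ℕ} (he : Dfn e) (heN : ∀ γ, Ok γ → e γ ≤ (inp γ).N) :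
    DfnP fun γ => (inp γ).I.base ^ e γ ≤ (inp γ).N :=
  .le (.pow .inp_base (fun γ _ => (inp γ).base_le) he heN) .N

theorem Dfn.searchResult : Dfn fun b : BoundedInstance => b.I.searchResult b.N := by
  classical
  refine .card_filter (P := fun (b : BoundedInstance) z => b.I.Feasible b.N z) ?_ .N fun _ _ => le_rfl
  have hz : Dfn fun p : BoundedInstance × ℕ => p.2 := .snd
  refine .exists_lt_N (P := fun (p : BoundedInstance × ℕ) k => _) ?_
  have hk : Dfn fun p : (BoundedInstance × ℕ) × ℕ => p.2 := .snd
  refine .exists_lt_N (P := fun (p : (BoundedInstance × ℕ) × ℕ) x => _) ?_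
  have hx : Dfn fun p : ((BoundedInstance × ℕ) × ℕ) × ℕ => p.2 := .snd
  refine .exists_lt_N (P := fun (p : ((BoundedInstance × ℕ) × ℕ) × ℕ) m => _) ?_
  have hm : Dfn fun p : (((BoundedInstance × ℕ) × ℕ) × ℕ) × ℕ => p.2 := .snd
  refine .exists_lt_N (P := fun (p : (((BoundedInstance × ℕ) × ℕ) × ℕ) × ℕ) e => _) ?_
  have he : Dfn fun p : ((((BoundedInstance × ℕ) × ℕ) × ℕ) × ℕ) × ℕ => p.2 := .snd
  -- Because `m` and `e` are quantified in `Feasible` instead of substituted, the context supplies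
  -- the bounds by `N` that multiplication and powers require.
  refine .and (.eq hm.fst (.add (.mul (.const 3) hk.fst.fst.fst fun p h => h.1.1.1.2) (.const 6)))
    (.and (.eq he (.mul hk.fst.fst.fst hm.fst fun p h => h.1.2)) (.and
    (.pow_base_le_N he fun p h => h.2) (.and (.isLinearLayout hk.fst.fst.fst
      (fun p h => h.1.1.1.2) hx.fst.fst fun p h => h.1.1.2) ?_)))
  refine .exists_lt_N (P := fun (p : ((((BoundedInstance × ℕ) × ℕ) × ℕ) × ℕ) × ℕ) r => _) ?_
  refine .and (.le .snd hk.fst.fst.fst.fst) ?_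
  refine .exists_lt_N (P := fun (p : (((((BoundedInstance × ℕ) × ℕ) × ℕ) × ℕ) × ℕ) × ℕ) r => _) ?_
  refine .exists_lt_N
    (P := fun (p : ((((((BoundedInstance × ℕ) × ℕ) × ℕ) × ℕ) × ℕ) × ℕ) × ℕ) r => _) ?_
  refine .exists_lt_N
    (P := fun (p : (((((((BoundedInstance × ℕ) × ℕ) × ℕ) × ℕ) × ℕ) × ℕ) × ℕ) × ℕ) r => _) ?_
  refine .isCertificate (.order hk.fst.fst.fst.fst.fst.fst.fst.fst (fun p h => h.1.1.1.1.1.1.1.1.2)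
    hx.fst.fst.fst.fst.fst.fst.fst (fun p h => h.1.1.1.1.1.1.1.2) .snd (fun p h => h.2))
    hm.fst.fst.fst.fst.fst (fun p h => h.1.1.1.1.1.2) Dfn.snd.fst.fst.fst
    (fun p h => h.1.1.1.2) Dfn.snd.fst.fst (fun p h => h.1.1.2) Dfn.snd.fst (fun p h => h.1.2)
    .snd (fun p h => h.2) hz.fst.fst.fst.fst.fst.fst.fst.fst

/-- A term for the result of the search. -/
theorem exists_searchTerm : ∃ t : Tm, ∀ (I : MaxCDPInstance) (N : ℕ), 2 * I.encode.length ≤ N →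
    t.eval (Env.ofInput I.encode N) = I.searchResult N := by
  obtain ⟨t, ht⟩ := Dfn.searchResult
  exact ⟨t, fun I N h => ht _ ⟨I, N, h⟩ trivial ⟨rfl, rfl⟩⟩

end RAM

/-! ### Correctness of the greedy layout -/

theorem leastBelow_spec {n : ℕ} {P : ℕ → Prop} (h : ∃ v < n, P v) :
    leastBelow n P < n ∧ P (leastBelow n P) := by
  classical
  have hex : ∃ v, P v := h.imp fun _ h => h.2
  have hlt : Nat.find hex < n := by
    obtain ⟨v, hv, hP⟩ := h
    exact (Nat.find_min' hex hP).trans_lt hv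
  have : leastBelow n P = Nat.find hex := by
    rw [leastBelow]
    -- The numbers counted are those at which, and before which, `P` fails: an initial segment
    -- ending where `P` first holds.
    have : {j ∈ range n | ¬ P j ∧ ∀ i < j, ¬ P i} = range (Nat.find hex) := by
      ext j
      simp only [mem_filter, mem_range, Nat.lt_find_iff]
      constructor
      · rintro ⟨-, h1, h2⟩ i hi
        rcases hi.lt_or_eq with h | rfl
        · exact h2 i h
        · exact h1
      · intro h
        refine ⟨?_, h j le_rfl, fun i hi => h i hi.le⟩
        by_contra hj
        exact h _ (hlt.le.trans (not_lt.1 hj)) (Nat.find_spec hex)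
    rw [this, card_range]
  rw [this]
  exact ⟨hlt, Nat.find_spec hex⟩

theorem layoutStep_congr {n : ℕ} {E : ℕ → ℕ → Prop} {a a' : ℕ → ℕ} {i : ℕ}
    (h : ∀ j < i, a j = a' j) : layoutStep n E a i = layoutStep n E a' i := by
  classical
  have h1 : ∀ v, (∀ j < i, a j ≠ v) ↔ (∀ j < i, a' j ≠ v) := fun v =>
    forall₂_congr fun j hj => by rw [h j hj]
  rcases Nat.eq_zero_or_pos i with rfl | hi
  · simp only [layoutStep, h1, lt_irrefl, false_and]
  · simp only [layoutStep, h1, h (i - 1) (by omega)]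

theorem layout_eq (n : ℕ) (E : ℕ → ℕ → Prop) (i : ℕ) :
    layout n E i = layoutStep n E (layout n E) i :=
  layoutStep_congr fun j hj => by rw [RAM.table_apply, if_pos hj, layout]

/-- A sequence is a layout of its first `i` entries if edges join only consecutive ones. -/
def IsPartialLayout (n : ℕ) (E : ℕ → ℕ → Prop) (o : ℕ → ℕ) (i : ℕ) : Prop :=
  ∀ k < i, o k < n ∧ ∀ j < k, o j ≠ o k ∧ (E (o j) (o k) → k = j + 1)

/-- If every vertex has at most one neighbour of rank one less and at most one of rank one more, and
no other neighbours, then the greedy layout is linear. -/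
theorem isLinearLayout_layout {n : ℕ} {E : ℕ → ℕ → Prop} (hsymm : ∀ u v, E u v → E v u)
    (rank : ℕ → ℕ) (h1 : ∀ u v, E u v → rank u = rank v + 1 ∨ rank v = rank u + 1)
    (h2 : ∀ u v w, E u v → E u w → rank v = rank w → v = w) :
    IsLinearLayout n E (layout n E) := by
  classical
  set o := layout n E with ho
  -- Two invariants accompany the partial layout: only the vertex placed last can still have
  -- unplaced neighbours, and it has at most one. So a component, once begun, is followed to its end
  -- before another one is started.
  suffices H : ∀ i ≤ n, IsPartialLayout n E o i ∧
      (∀ j < i, ∀ v < n, (∀ k < i, o k ≠ v) → E (o j) v → j + 1 = i) ∧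
      (0 < i → ∀ v < n, ∀ w < n, (∀ k < i, o k ≠ v) → (∀ k < i, o k ≠ w) →
        E (o (i - 1)) v → E (o (i - 1)) w → v = w) from (H n le_rfl).1
  intro i
  induction i with
  | zero =>
    exact fun _ => ⟨fun k hk => absurd hk (by omega), fun j hj => absurd hj (by omega),
      fun h => absurd h (by omega)⟩
  | succ i ih =>
    intro hi
    obtain ⟨ha, hb, hc⟩ := ih (by omega)
    obtain ⟨hlt, hfree, hnew⟩ : o i < n ∧ (∀ j < i, o j ≠ o i) ∧
        ((0 < i ∧ E (o (i - 1)) (o i)) ∨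
          (¬ (0 < i ∧ ∃ u < n, (∀ j < i, o j ≠ u) ∧ E (o (i - 1)) u) ∧
            #{u ∈ range n | (∀ j < i, o j ≠ u) ∧ E (o i) u} ≤ 1)) := by
      have := layout_eq n E i
      rw [← ho, layoutStep] at this
      rw [this]
      apply leastBelow_spec (P := fun v => (∀ j < i, o j ≠ v) ∧
        ((0 < i ∧ E (o (i - 1)) v) ∨
          (¬ (0 < i ∧ ∃ u < n, (∀ j < i, o j ≠ u) ∧ E (o (i - 1)) u) ∧
            #{u ∈ range n | (∀ j < i, o j ≠ u) ∧ E v u} ≤ 1)))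
      by_cases hex : 0 < i ∧ ∃ u < n, (∀ j < i, o j ≠ u) ∧ E (o (i - 1)) u
      · obtain ⟨hpos, u, hu, hf, hE⟩ := hex
        exact ⟨u, hu, hf, .inl ⟨hpos, hE⟩⟩
      · have hne : ((range n).filter fun v => ∀ j < i, o j ≠ v).Nonempty := by
          obtain ⟨v, hv, hv'⟩ := exists_mem_notMem_of_card_lt_card
            (s := (range i).image o) (t := range n)
            (card_image_le.trans_lt (by simpa using (by omega : i < n)))
          exact ⟨v, mem_filter.2 ⟨hv, fun j hj h =>
            hv' (mem_image.2 ⟨j, mem_range.2 hj, h⟩)⟩⟩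
        -- An unplaced vertex of maximal rank can start a new component: its unplaced neighbours all
        -- have rank one less, so there is at most one.
        obtain ⟨v, hv, hmax⟩ := exists_max_image _ rank hne
        rw [mem_filter, mem_range] at hv
        refine ⟨v, hv.1, hv.2, .inr ⟨hex, card_le_one.2 fun u hu w hw => ?_⟩⟩
        rw [mem_filter] at hu hw
        have hru := hmax u (mem_filter.2 ⟨hu.1, hu.2.1⟩)
        have hrw := hmax w (mem_filter.2 ⟨hw.1, hw.2.1⟩)
        have hu' := h1 v u hu.2.2
        have hw' := h1 v w hw.2.2
        exact h2 v u w hu.2.2 hw.2.2 (by omega)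
    refine ⟨fun k hk => ?_, fun j hj v hv hf hE => ?_, fun _ v hv w hw hfv hfw hEv hEw => ?_⟩
    · rcases (Nat.lt_succ_iff.1 hk).lt_or_eq with hk | rfl
      · exact ha k hk
      · exact ⟨hlt, fun j hj => ⟨hfree j hj, fun hE => (hb j hj _ hlt hfree hE).symm⟩⟩
    · rcases (Nat.lt_succ_iff.1 hj).lt_or_eq with hj | rfl
      · exfalso
        have hf' : ∀ k < i, o k ≠ v := fun k hk => hf k (by omega)
        have hji := hb j hj v hv hf' hE
        have hj' : i - 1 = j := by omega
        rcases hnew with ⟨hpos, hE'⟩ | ⟨hno, -⟩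
        · rw [hj'] at hE' hc
          exact hf i (by omega) (hc hpos _ hlt v hv hfree hf' hE' hE)
        · exact hno ⟨by omega, v, hv, hf', by rwa [hj']⟩
      · rfl
    · rw [Nat.add_sub_cancel] at hEv hEw
      rcases hnew with ⟨hpos, hE'⟩ | ⟨-, hcard⟩
      -- The new vertex would have three neighbours `o (i - 1)`, `v`, `w` of pairwise different
      -- ranks, while only two ranks are possible.
      · by_contra hne
        have hE'' := hsymm _ _ hE'
        have h3 := h1 _ _ hEv
        have h4 := h1 _ _ hEw
        have h5 := h1 _ _ hE''
        have h6 : rank v ≠ rank w := fun h => hne (h2 _ _ _ hEv hEw h)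
        have h7 : rank (o (i - 1)) ≠ rank v := fun h =>
          hfv (i - 1) (by omega) (h2 _ _ _ hE'' hEv h)
        have h8 : rank (o (i - 1)) ≠ rank w := fun h =>
          hfw (i - 1) (by omega) (h2 _ _ _ hE'' hEw h)
        omega
      · exact card_le_one.1 hcard v (mem_filter.2 ⟨mem_range.2 hv, fun j hj => hfv j (by omega), hEv⟩)
          w (mem_filter.2 ⟨mem_range.2 hw, fun j hj => hfw j (by omega), hEw⟩)

/-! ### Correctness of the interval packing -/

/-- A set of disjoint good intervals below `J`. -/
structure IsIntervalPacking (good : ℕ → ℕ → Prop) (F : Finset (ℕ × ℕ)) (J : ℕ) : Prop where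
  good : ∀ p ∈ F, p.1 ≤ p.2 ∧ p.2 < J ∧ good p.1 p.2
  disj : ∀ p ∈ F, ∀ p' ∈ F, p ≠ p' → p.2 < p'.1 ∨ p'.2 < p.1

-- An optimal packing below `J + 1` either has no interval ending at `J`, or consists of some `[i,
-- J]` and a packing below `i`.
open Classical in
theorem packing_succ (good : ℕ → ℕ → Prop) (J : ℕ) :
    packing good (J + 1) = max (packing good J)
      ((range (J + 1)).sup fun i => if good i J then packing good i + 1 else 0) := by
  have h : ∀ i < J + 1, RAM.table (packingStep good) (J + 1) i = packing good i := fun i hi => by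
    rw [RAM.table_apply, if_pos hi, packing]
  rw [packing, RAM.covRec, packingStep, if_neg (Nat.succ_ne_zero J), Nat.add_sub_cancel,
    h J (Nat.lt_succ_self J)]
  congr 1
  exact sup_congr rfl fun i hi => by rw [h i (mem_range.1 hi)]; rfl

theorem packing_zero (good : ℕ → ℕ → Prop) : packing good 0 = 0 := by
  rw [packing, RAM.covRec, packingStep, if_pos rfl]

theorem exists_intervalPacking (good : ℕ → ℕ → Prop) (J : ℕ) :
    ∃ F, IsIntervalPacking good F J ∧ #F = packing good J := by
  classical
  induction J using Nat.strong_induction_on with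
  | _ J ih =>
    cases J with
    | zero => exact ⟨∅, ⟨by simp, by simp⟩, by simp [packing_zero]⟩
    | succ J =>
      have hold : ∃ F, IsIntervalPacking good F (J + 1) ∧ #F = packing good J := by
        obtain ⟨F, hF, hc⟩ := ih J (Nat.lt_succ_self J)
        exact ⟨F, ⟨fun p hp => ⟨(hF.good p hp).1, (hF.good p hp).2.1.trans (Nat.lt_succ_self J),
          (hF.good p hp).2.2⟩, hF.disj⟩, hc⟩
      rw [packing_succ]
      obtain ⟨i, hi, hsup⟩ := exists_mem_eq_sup (range (J + 1)) ⟨0, by simp⟩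
        (fun i => if good i J then packing good i + 1 else 0)
      rw [hsup]
      split_ifs with hg
      · rcases le_total (packing good i + 1) (packing good J) with h | h
        · rwa [max_eq_left h]
        · rw [max_eq_right h]
          rw [mem_range] at hi
          obtain ⟨F, hF, hc⟩ := ih i hi
          have hnot : (i, J) ∉ F := fun hmem => by
            have := hF.good _ hmem
            simp only at this
            omega
          refine ⟨insert (i, J) F, ⟨fun p hp => ?_, fun p hp p' hp' hne => ?_⟩, ?_⟩
          · rcases mem_insert.1 hp with rfl | hp
            · exact ⟨Nat.lt_succ_iff.1 hi, Nat.lt_succ_self J, hg⟩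
            · have := hF.good p hp
              exact ⟨this.1, by omega, this.2.2⟩
          · rcases mem_insert.1 hp with rfl | hp <;> rcases mem_insert.1 hp' with rfl | hp'
            · exact absurd rfl hne
            · exact .inr (hF.good p' hp').2.1
            · exact .inl (hF.good p hp).2.1
            · exact hF.disj p hp p' hp' hne
          · rw [card_insert_of_notMem hnot, hc]
      · rwa [max_eq_left (Nat.zero_le _)]

theorem IsIntervalPacking.card_le {good : ℕ → ℕ → Prop} {J : ℕ} :
    ∀ {F : Finset (ℕ × ℕ)}, IsIntervalPacking good F J → #F ≤ packing good J := by
  classical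
  induction J using Nat.strong_induction_on with
  | _ J ih =>
    intro F hF
    cases J with
    | zero =>
      have : F = ∅ := eq_empty_of_forall_notMem fun p hp => by
        have := (hF.good p hp).2.1
        omega
      simp [this]
    | succ J =>
      rw [packing_succ]
      by_cases hex : ∃ i, (i, J) ∈ F
      · obtain ⟨i, hi⟩ := hex
        have hg := hF.good _ hi
        simp only at hg
        have hF' : IsIntervalPacking good (F.erase (i, J)) i := by
          refine ⟨fun p hp => ?_, fun p hp p' hp' => hF.disj p (mem_of_mem_erase hp) p'
            (mem_of_mem_erase hp')⟩
          have hp' := mem_of_mem_erase hp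
          have h1 := hF.good p hp'
          have h2 := hF.disj p hp' _ hi (ne_of_mem_erase hp)
          simp only at h2
          exact ⟨h1.1, by omega, h1.2.2⟩
        have hc := ih i (by omega) hF'
        rw [card_erase_of_mem hi] at hc
        refine le_trans ?_ (le_max_right _ _)
        have := le_sup (f := fun i => if good i J then packing good i + 1 else 0)
          (mem_range.2 (by omega : i < J + 1))
        simp only [if_pos hg.2.2] at this
        omega
      · refine le_trans (ih J (Nat.lt_succ_self J) ⟨fun p hp => ?_, hF.disj⟩) (le_max_left _ _)
        have h1 := hF.good p hp
        have h2 : p.2 ≠ J := fun h => hex ⟨p.1, by rw [← h]; exact hp⟩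
        exact ⟨h1.1, by omega, h1.2.2⟩

/-! ### Walks, layouts and interiors of paths -/

theorem SimpleGraph.Walk.mk_getVert_mem_edges {V : Type*} {G : SimpleGraph V} {u v : V}
    (p : G.Walk u v) {i : ℕ} (hi : i < p.length) :
    s(p.getVert i, p.getVert (i + 1)) ∈ p.edges := by
  induction p generalizing i with
  | nil => simp at hi
  | cons h p ih =>
    cases i with
    | zero => simp
    | succ i =>
      rw [getVert_cons_succ, getVert_cons_succ, edges_cons]
      exact List.mem_cons_of_mem _ (ih (by simpa using hi))

/-- A path with a single edge is determined by its end points. -/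
theorem SimpleGraph.Walk.eq_of_length_eq_one {V : Type*} {G : SimpleGraph V} {u v : V}
    {p r : G.Walk u v} (hp : p.length = 1) (hr : r.length = 1) : p = r := by
  refine ext_getVert fun k => ?_
  cases k with
  | zero => simp
  | succ k => rw [getVert_of_length_le _ (by omega), getVert_of_length_le _ (by omega)]

theorem IsLinearLayout.inj {n : ℕ} {E : ℕ → ℕ → Prop} {o : ℕ → ℕ} (ho : IsLinearLayout n E o)
    {i j : ℕ} (hi : i < n) (hj : j < n) (h : o i = o j) : i = j := by
  rcases lt_trichotomy i j with hlt | heq | hlt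
  · exact absurd h ((ho j hj).2 i hlt).1
  · exact heq
  · exact absurd h.symm ((ho i hi).2 j hlt).1

namespace MaxCDPInstance

variable {I : MaxCDPInstance}

/-- The internal vertices of a path, as numbers. -/
def Interior (p : I.G.Path I.s I.t) (v : ℕ) : Prop :=
  ∃ hv : v < I.n, ⟨v, hv⟩ ∈ p.1.support ∧ v ≠ I.s ∧ v ≠ I.t

theorem Interior.lt {p : I.G.Path I.s I.t} {v : ℕ} (h : Interior p v) : v < I.n := h.1

theorem HasColor.symm {c u v : ℕ} (h : I.HasColor c u v) : I.HasColor c v u := by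
  obtain ⟨hu, hv, hc, ha, hf⟩ := h
  refine ⟨hv, hu, hc, ha.symm, ?_⟩
  have : (⟨s(⟨v, hv⟩, ⟨u, hu⟩), ha.symm⟩ : I.G.edgeSet) = ⟨s(⟨u, hu⟩, ⟨v, hv⟩), ha⟩ :=
    Subtype.ext Sym2.eq_swap
  rw [this]
  exact hf

/-! ### Soundness -/

/-- A route can be shortened to a path inside the same set. Excluding the edge `st` forces an
internal vertex, which will show that paths found in disjoint sets are distinct from each other and
from the edge `st`. -/
theorem Linked.exists_path {c : ℕ} {S : ℕ → Prop} (h : I.Linked c S) :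
    ∃ p : I.G.Path I.s I.t, p.1.IsUniColor I.f ∧ (∀ v, Interior p v → S v) ∧
      ∃ v, Interior p v := by
  classical
  -- A step of `ReachedIn` restricts only its head; starting at `s`, both ends of every step lie in
  -- `In`, so the steps are edges of an undirected graph.
  let In : ℕ → Prop := fun v => v = I.s ∨ v = I.t ∨ S v
  let H : SimpleGraph (Fin I.n) :=
    { Adj := fun u v => I.HasColor c u v ∧ ¬ ((u : ℕ) = I.s ∧ (v : ℕ) = I.t) ∧
        ¬ ((u : ℕ) = I.t ∧ (v : ℕ) = I.s) ∧ In u ∧ In v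
      symm := ⟨fun u v h => ⟨h.1.symm, fun h' => h.2.2.1 ⟨h'.2, h'.1⟩, fun h' => h.2.1 ⟨h'.2, h'.1⟩,
        h.2.2.2.2, h.2.2.2.1⟩⟩
      loopless := ⟨fun u h => by
        obtain ⟨⟨_, _, _, ha, _⟩, -⟩ := h
        exact I.G.loopless.irrefl _ ha⟩ }
  have hle : H ≤ I.G := fun u v h => by
    obtain ⟨⟨_, _, _, ha, _⟩, -⟩ := h
    exact ha
  have hreach : ∀ l v, ∀ hv : v < I.n, ReachedIn I.n I.s (fun u v => I.HasColor c u v ∧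
      ¬ (u = I.s ∧ v = I.t) ∧ ¬ (u = I.t ∧ v = I.s) ∧ (v = I.t ∨ S v)) l v →
      H.Reachable I.s ⟨v, hv⟩ ∧ In v := by
    intro l
    induction l with
    | zero =>
      intro v hv h
      have : I.s = ⟨v, hv⟩ := Fin.ext (Eq.symm h)
      exact ⟨this ▸ SimpleGraph.Reachable.refl _, .inl h⟩
    | succ l ih =>
      rintro v hv (h | ⟨u, hu, h, h1, h2, h3, h4⟩)
      · exact ih v hv h
      · obtain ⟨hr, hin⟩ := ih u hu h
        have hin' : In v := .inr h4
        have hadj : H.Adj ⟨u, hu⟩ ⟨v, hv⟩ := ⟨h1, h2, h3, hin, hin'⟩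
        exact ⟨hr.trans hadj.reachable, hin'⟩
  obtain ⟨p, hp⟩ := (hreach _ _ I.t.2 h).1.exists_isPath
  have hpos : 0 < p.length := Nat.pos_of_ne_zero fun h0 =>
    I.s_ne_t (SimpleGraph.Walk.eq_of_length_eq_zero h0)
  have hadj : ∀ i < p.length, H.Adj (p.getVert i) (p.getVert (i + 1)) := fun i hi =>
    p.adj_getVert_succ hi
  have hin : ∀ v ∈ p.support, In v := by
    intro v hv
    obtain ⟨i, rfl, hi⟩ := SimpleGraph.Walk.mem_support_iff_exists_getVert.1 hv
    rcases hi.lt_or_eq with hi | rfl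
    · exact (hadj i hi).2.2.2.1
    · rw [SimpleGraph.Walk.getVert_length]
      exact .inr (.inl rfl)
  have h01 := hadj 0 hpos
  rw [SimpleGraph.Walk.getVert_zero] at h01
  refine ⟨⟨p.mapLe hle, (SimpleGraph.Walk.isPath_mapLe hle).2 hp⟩, ⟨⟨c, ?_⟩, fun e he => ?_⟩,
    fun v hv => ?_, p.getVert 1, (p.getVert 1).2, ?_, fun h1 => ?_, fun h1 => ?_⟩
  · exact h01.1.2.2.1
  · have he' : e ∈ p.edges := by rwa [← SimpleGraph.Walk.edges_mapLe_eq_edges hle]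
    have heH := p.edges_subset_edgeSet he'
    induction e with
    | _ u v =>
      obtain ⟨⟨_, _, _, _, hf⟩, -⟩ := (SimpleGraph.mem_edgeSet H).1 heH
      exact hf
  · obtain ⟨hv', hmem, h1, h2⟩ := hv
    rw [SimpleGraph.Walk.support_mapLe_eq_support] at hmem
    rcases hin _ hmem with h | h | h
    · exact absurd h h1
    · exact absurd h h2
    · exact h
  · rw [SimpleGraph.Walk.support_mapLe_eq_support]
    exact p.getVert_mem_support 1
  · exact h01.ne (Fin.ext h1.symm)
  · exact h01.2.1 ⟨rfl, h1⟩

/-- The path consisting of a single edge has no internal vertex. -/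
theorem exists_direct_path (h : ∃ c < I.q, I.HasColor c I.s I.t) :
    ∃ p : I.G.Path I.s I.t, p.1.IsUniColor I.f ∧ ∀ v, ¬ Interior p v := by
  obtain ⟨c, -, hs, ht, hc, ha, hf⟩ := h
  refine ⟨SimpleGraph.Path.singleton ha, ⟨⟨c, hc⟩, fun e he => ?_⟩, fun v hv => ?_⟩
  · have : e = s(I.s, I.t) := by
      simpa [SimpleGraph.Path.singleton] using he
    subst this
    exact hf
  · obtain ⟨hv', hmem, h1, h2⟩ := hv
    simp only [SimpleGraph.Path.singleton, SimpleGraph.Walk.support_cons,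
      SimpleGraph.Walk.support_nil, List.mem_cons, List.not_mem_nil, or_false] at hmem
    rcases hmem with h | h
    · exact h1 (congrArg Fin.val h)
    · exact h2 (congrArg Fin.val h)

theorem internallyDisjoint_of_interior {p r : I.G.Path I.s I.t}
    (h : ∀ v, Interior p v → ¬ Interior r v) : SimpleGraph.Path.InternallyDisjoint p r := by
  intro v hp hr
  by_contra hne
  rw [not_or] at hne
  have h1 : (v : ℕ) ≠ I.s := fun h => hne.1 (Fin.ext h)
  have h2 : (v : ℕ) ≠ I.t := fun h => hne.2 (Fin.ext h)
  exact h v ⟨v.2, hp, h1, h2⟩ ⟨v.2, hr, h1, h2⟩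

theorem exists_family {ι : Type} [Fintype ι] (S : ι → ℕ → Prop)
    (hdisj : ∀ i j, i ≠ j → ∀ v < I.n, S i v → ¬ S j v) (hlink : ∀ i, ∃ c, I.Linked c (S i)) :
    ∃ P : Finset (I.G.Path I.s I.t), IsDisjointUniColorFamily I.f P ∧
      Fintype.card ι + I.direct ≤ #P := by
  classical
  have h (i : ι) := (hlink i).choose_spec.exists_path
  choose p hcol hS hne using h
  have hint : ∀ i j, i ≠ j → ∀ v, Interior (p i) v → ¬ Interior (p j) v :=
    fun i j hij v hi hj => hdisj i j hij v hi.lt (hS i v hi) (hS j v hj)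
  have hinj : Function.Injective p := fun i j hij => by
    by_contra hne'
    obtain ⟨v, hv⟩ := hne i
    exact hint i j hne' v hv (hij ▸ hv)
  have hfam : IsDisjointUniColorFamily I.f (univ.image p) := by
    constructor
    · intro r hr
      obtain ⟨i, -, rfl⟩ := mem_image.1 hr
      exact hcol i
    · intro r hr r' hr' hrr
      obtain ⟨i, -, rfl⟩ := mem_image.1 hr
      obtain ⟨j, -, rfl⟩ := mem_image.1 hr'
      exact internallyDisjoint_of_interior (hint i j fun h => hrr (h ▸ rfl))
  have hcard : #(univ.image p) = Fintype.card ι := card_image_of_injective _ hinj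
  by_cases hd : ∃ c < I.q, I.HasColor c I.s I.t
  · obtain ⟨p₀, hcol₀, hint₀⟩ := exists_direct_path hd
    have hnot : p₀ ∉ univ.image p := fun hmem => by
      obtain ⟨i, -, hi⟩ := mem_image.1 hmem
      obtain ⟨v, hv⟩ := hne i
      exact hint₀ v (hi ▸ hv)
    refine ⟨insert p₀ (univ.image p), ⟨fun r hr => ?_, fun r hr r' hr' hrr => ?_⟩, ?_⟩
    · rcases mem_insert.1 hr with rfl | hr
      · exact hcol₀
      · exact hfam.1 r hr
    · rcases mem_insert.1 hr with rfl | hr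
      · exact internallyDisjoint_of_interior fun v hv => absurd hv (hint₀ v)
      · rcases mem_insert.1 hr' with rfl | hr'
        · exact internallyDisjoint_of_interior fun v _ => hint₀ v
        · exact hfam.2 r hr r' hr' hrr
    · rw [card_insert_of_notMem hnot, hcard, direct, if_pos hd]
  · exact ⟨_, hfam, by rw [hcard, direct, if_neg hd, add_zero]⟩

/-- Of the layout only injectivity matters here: disjoint intervals of positions contain disjoint
sets of vertices. The index type consists of the `r` coded territories and the intervals of an
optimal packing. -/
theorem IsCertificate.exists_family {E : ℕ → ℕ → Prop} {o : ℕ → ℕ} (ho : IsLinearLayout I.n E o)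
    {m r col lo hi z : ℕ} (h : I.IsCertificate o m r col lo hi z) :
    ∃ P : Finset (I.G.Path I.s I.t), IsDisjointUniColorFamily I.f P ∧ z ≤ #P := by
  classical
  obtain ⟨h1, h2, h3⟩ := h
  obtain ⟨F, hF, hcard⟩ := exists_intervalPacking (I.Good o m r lo hi) I.n
  obtain ⟨P, hP, hPc⟩ := MaxCDPInstance.exists_family (I := I) (ι := Fin r ⊕ F)
    (Sum.elim (fun a => I.Territory o m lo hi a) fun p => I.Segment o p.1.1 p.1.2) (by
      rintro (a | p) (b | p') hne v hv hS hS'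
      · rcases lt_trichotomy (a : ℕ) b with hab | hab | hab
        · exact h2 b b.2 a hab v hv ⟨hS', hS⟩
        · exact hne (congrArg _ (Fin.ext hab))
        · exact h2 a a.2 b hab v hv ⟨hS, hS'⟩
      · exact (hF.good _ p'.2).2.2.1 v hv hS' a a.2 hS
      · exact (hF.good _ p.2).2.2.1 v hv hS b b.2 hS'
      · obtain ⟨x, hx, hxv, hx1, hx2⟩ := hS
        obtain ⟨y, hy, hyv, hy1, hy2⟩ := hS'
        have hxy := ho.inj hx hy (hxv.trans hyv.symm)
        have := hF.disj _ p.2 _ p'.2 fun h => hne (congrArg _ (Subtype.ext h))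
        omega) (by
      rintro (a | p)
      · exact ⟨_, h1 a a.2⟩
      · obtain ⟨c, -, hc⟩ := (hF.good _ p.2).2.2.2
        exact ⟨c, hc⟩)
  refine ⟨P, hP, h3.trans ?_⟩
  simpa [hcard] using hPc

theorem Feasible.exists_family {N z : ℕ} (h : I.Feasible N z) :
    ∃ P : Finset (I.G.Path I.s I.t), IsDisjointUniColorFamily I.f P ∧ z ≤ #P := by
  obtain ⟨k, -, x, -, m, -, e, -, -, -, -, ho, r, -, -, col, -, lo, -, hi, -, hc⟩ := h
  exact hc.exists_family ho

end MaxCDPInstance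

/-! ### Completeness -/

theorem exists_digits {B : ℕ} (L : ℕ) : ∀ (ψ : ℕ → ℕ), (∀ i < L, ψ i < B) →
    ∃ c < B ^ L, ∀ i < L, digit B c i = ψ i := by
  induction L with
  | zero => exact fun ψ _ => ⟨0, by simp, fun i hi => absurd hi (by omega)⟩
  | succ L ih =>
    intro ψ hψ
    obtain ⟨c, hc, hd⟩ := ih (fun i => ψ (i + 1)) fun i hi => hψ (i + 1) (by omega)
    have h0 := hψ 0 (by omega)
    have hB : 0 < B := by omega
    -- Horner's scheme: the remaining digits are shifted by one place.
    refine ⟨ψ 0 + B * c, ?_, fun i hi => ?_⟩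
    · have : B * (c + 1) ≤ B * B ^ L := Nat.mul_le_mul_left _ hc
      rw [pow_succ, mul_comm (B ^ L)]
      nlinarith
    · cases i with
      | zero => simp [digit, Nat.mod_eq_of_lt h0]
      | succ i =>
        rw [← hd i (by omega), digit, digit, pow_succ, mul_comm (B ^ i), ← Nat.div_div_eq_div_mul,
          Nat.add_mul_div_left _ _ hB, Nat.div_eq_of_lt h0, zero_add]

/-- A sequence of integers with steps of size one takes all values between two of its values. -/
theorem exists_interval_of_steps (π : ℕ → ℕ) (L : ℕ) (hL : 1 ≤ L)
    (h : ∀ j, 1 ≤ j → j + 1 ≤ L → π (j + 1) = π j + 1 ∨ π j = π (j + 1) + 1) :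
    ∃ a b, a ≤ b ∧ ∀ x, (a ≤ x ∧ x ≤ b) ↔ ∃ j, 1 ≤ j ∧ j ≤ L ∧ π j = x := by
  induction L, hL using Nat.le_induction with
  | base =>
    refine ⟨π 1, π 1, le_rfl, fun x => ⟨fun hx => ⟨1, le_rfl, le_rfl, by omega⟩, ?_⟩⟩
    rintro ⟨j, h1, h2, rfl⟩
    have : j = 1 := by omega
    subst this
    exact ⟨le_rfl, le_rfl⟩
  | succ L hL ih =>
    obtain ⟨a, b, hab, hx⟩ := ih fun j h1 h2 => h j h1 (by omega)
    have hstep := h L hL le_rfl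
    have hL' := (hx (π L)).2 ⟨L, hL, le_rfl, rfl⟩
    refine ⟨min a (π (L + 1)), max b (π (L + 1)), by omega, fun x => ?_⟩
    have key : (min a (π (L + 1)) ≤ x ∧ x ≤ max b (π (L + 1))) ↔
        (a ≤ x ∧ x ≤ b) ∨ π (L + 1) = x := by omega
    rw [key, hx]
    constructor
    · rintro (⟨j, h1, h2, h3⟩ | h3)
      · exact ⟨j, h1, by omega, h3⟩
      · exact ⟨L + 1, by omega, le_rfl, h3⟩
    · rintro ⟨j, h1, h2, h3⟩
      rcases h2.lt_or_eq with h2 | rfl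
      · exact .inl ⟨j, h1, by omega, h3⟩
      · exact .inr h3

/-- A finite set of numbers is a union of intervals, one for each element whose successor is not in
the set. -/
theorem exists_intervals (S : Finset ℕ) {n m : ℕ} (hS : ∀ i ∈ S, i < n) (hn : 2 ≤ n)
    (hm : #{i ∈ S | i + 1 ∉ S} ≤ m) : ∃ lo hi : ℕ → ℕ, (∀ i, lo i < n ∧ hi i < n) ∧
      ∀ x, x ∈ S ↔ ∃ i < m, lo i ≤ x ∧ x ≤ hi i := by
  classical
  set E := {i ∈ S | i + 1 ∉ S} with hE
  -- Here `l` is the left end of the maximal run in `S` that ends at `e`.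
  have hlo : ∀ e ∈ S, ∃ l ≤ e, (∀ x, l ≤ x → x ≤ e → x ∈ S) ∧
      ∀ y ≤ e, (∀ x, y ≤ x → x ≤ e → x ∈ S) → l ≤ y := by
    intro e he
    have hex : ∃ l, l ≤ e ∧ ∀ x, l ≤ x → x ≤ e → x ∈ S :=
      ⟨e, le_rfl, fun x h1 h2 => le_antisymm h2 h1 ▸ he⟩
    exact ⟨Nat.find hex, (Nat.find_spec hex).1, (Nat.find_spec hex).2,
      fun y hy h => Nat.find_min' hex ⟨hy, h⟩⟩
  choose! l hl1 hl2 hl3 using hlo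
  let e : ℕ → ℕ := fun i => if h : i < #E then (E.equivFin.symm ⟨i, h⟩ : ℕ) else 0
  have he : ∀ i < #E, e i ∈ E := fun i hi => by
    simp only [e, dif_pos hi]
    exact (E.equivFin.symm ⟨i, hi⟩).2
  -- Superfluous indices get the empty interval from `1` to `0`; its end points are below `n`
  -- because `2 ≤ n`.
  refine ⟨fun i => if i < #E then l (e i) else 1, fun i => if i < #E then e i else 0, fun i => ?_,
    fun x => ⟨fun hx => ?_, ?_⟩⟩
  · dsimp only
    split_ifs with h
    · have h1 := (mem_filter.1 (he i h)).1
      exact ⟨(hl1 _ h1).trans_lt (hS _ h1), hS _ h1⟩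
    · omega
  -- The least such `y` is the right end of the run through `x`.
  · have hex : ∃ y, x ≤ y ∧ y + 1 ∉ S := ⟨x + n, by omega, fun h => by
      have := hS _ h
      omega⟩
    have hy := Nat.find_spec hex
    have hall : ∀ z, x ≤ z → z ≤ Nat.find hex → z ∈ S := by
      intro z h1 h2
      rcases h1.lt_or_eq with h1 | rfl
      · by_contra hz
        have := Nat.find_min' hex (m := z - 1) ⟨by omega, by
          rwa [Nat.sub_add_cancel (by omega)]⟩
        omega
      · exact hx
    have hyE : Nat.find hex ∈ E := mem_filter.2 ⟨hall _ hy.1 le_rfl, hy.2⟩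
    have hi := (E.equivFin ⟨_, hyE⟩).2
    have hei : e (E.equivFin ⟨_, hyE⟩) = Nat.find hex := by
      simp only [e, dif_pos hi, Fin.eta, Equiv.symm_apply_apply]
    refine ⟨E.equivFin ⟨_, hyE⟩, hi.trans_le hm, ?_⟩
    dsimp only
    rw [if_pos hi, if_pos hi, hei]
    exact ⟨hl3 _ (mem_filter.1 hyE).1 x hy.1 hall, hy.1⟩
  · rintro ⟨i, -, h1, h2⟩
    by_cases hi : i < #E
    · simp only [if_pos hi] at h1 h2
      exact hl2 _ (mem_filter.1 (he i hi)).1 x h1 h2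
    · simp only [if_neg hi] at h1 h2
      omega

namespace MaxCDPInstance

variable {I : MaxCDPInstance}

theorem getVert_interior {p : I.G.Path I.s I.t} {j : ℕ} (h1 : 1 ≤ j) (h2 : j < p.1.length) :
    Interior p (p.1.getVert j) := by
  refine ⟨(p.1.getVert j).2, p.1.getVert_mem_support j, fun h => ?_, fun h => ?_⟩
  · have := (p.2.getVert_eq_start_iff h2.le).1 (Fin.ext h)
    omega
  · have := (p.2.getVert_eq_end_iff h2.le).1 (Fin.ext h)
    omega

theorem Interior.exists_getVert {p : I.G.Path I.s I.t} {v : ℕ} (h : Interior p v) :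
    ∃ j, 1 ≤ j ∧ j < p.1.length ∧ (p.1.getVert j : ℕ) = v := by
  obtain ⟨hv, hmem, h1, h2⟩ := h
  obtain ⟨j, hj, hle⟩ := SimpleGraph.Walk.mem_support_iff_exists_getVert.1 hmem
  have hj' : (p.1.getVert j : ℕ) = v := congrArg Fin.val hj
  refine ⟨j, Nat.pos_of_ne_zero ?_, lt_of_le_of_ne hle ?_, hj'⟩
  · rintro rfl
    rw [SimpleGraph.Walk.getVert_zero] at hj'
    exact h1 hj'.symm
  · rintro rfl
    rw [SimpleGraph.Walk.getVert_length] at hj'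
    exact h2 hj'.symm

theorem getVert_val_inj {p : I.G.Path I.s I.t} {i j : ℕ} (hi : i ≤ p.1.length)
    (hj : j ≤ p.1.length) (h : (p.1.getVert i : ℕ) = p.1.getVert j) : i = j :=
  p.2.getVert_injOn hi hj (Fin.ext h)

theorem length_pos (p : I.G.Path I.s I.t) : 0 < p.1.length :=
  Nat.pos_of_ne_zero fun h => I.s_ne_t (SimpleGraph.Walk.eq_of_length_eq_zero h)

theorem hasColor_getVert {p : I.G.Path I.s I.t} {c : Fin I.q}
    (hc : ∀ (e : Sym2 (Fin I.n)) (he : e ∈ p.1.edges), c ∈ I.f ⟨e, p.1.edges_subset_edgeSet he⟩)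
    {j : ℕ} (hj : j < p.1.length) : I.HasColor c (p.1.getVert j) (p.1.getVert (j + 1)) :=
  ⟨(p.1.getVert j).2, (p.1.getVert (j + 1)).2, c.2, p.1.adj_getVert_succ hj,
    hc _ (p.1.mk_getVert_mem_edges hj)⟩

theorem adj_getVert (p : I.G.Path I.s I.t) {j : ℕ} (hj : j < p.1.length) :
    I.Adj (p.1.getVert j) (p.1.getVert (j + 1)) :=
  ⟨(p.1.getVert j).2, (p.1.getVert (j + 1)).2, p.1.adj_getVert_succ hj⟩

theorem _root_.ReachedIn.mono {n s : ℕ} {E : ℕ → ℕ → Prop} {l l' v : ℕ} (h : ReachedIn n s E l v)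
    (hl : l ≤ l') : ReachedIn n s E l' v := by
  induction l', hl using Nat.le_induction with
  | base => exact h
  | succ l' _ ih => exact .inl ih

/-- A path with more than one edge never traverses `st`, as its ends occur only at the first and
last index. The colour precedes `S`, so one colour serves every set containing the interior. -/
theorem exists_linked {p : I.G.Path I.s I.t} (hp : p.1.IsUniColor I.f) (hlen : p.1.length ≠ 1) :
    ∃ c < I.q, ∀ S : ℕ → Prop, (∀ v, Interior p v → S v) → I.Linked c S := by
  obtain ⟨c, hc⟩ := hp
  have hpos := length_pos p
  refine ⟨c, c.2, fun S hS => ?_⟩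
  suffices h : ∀ j ≤ p.1.length, ReachedIn I.n I.s (fun u v => I.HasColor c u v ∧
      ¬ (u = I.s ∧ v = I.t) ∧ ¬ (u = I.t ∧ v = I.s) ∧ (v = I.t ∨ S v)) j (p.1.getVert j) by
    have h' := h _ le_rfl
    rw [SimpleGraph.Walk.getVert_length] at h'
    -- A path has fewer than `n` edges, so `n` rounds of reachability suffice.
    exact h'.mono (by simpa using p.2.length_lt.le)
  intro j
  induction j with
  | zero =>
    intro _
    rw [SimpleGraph.Walk.getVert_zero]
    rfl
  | succ j ih =>
    intro hj
    refine .inr ⟨_, (p.1.getVert j).2, ih (by omega), hasColor_getVert hc (by omega), ?_, ?_, ?_⟩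
    · rintro ⟨h1, h2⟩
      have h1' := (p.2.getVert_eq_start_iff (by omega)).1 (Fin.ext h1)
      have h2' := (p.2.getVert_eq_end_iff hj).1 (Fin.ext h2)
      omega
    · rintro ⟨h1, -⟩
      have h1' := (p.2.getVert_eq_end_iff (by omega)).1 (Fin.ext h1)
      omega
    · rcases hj.lt_or_eq with hj | hj
      · exact .inr (hS _ (getVert_interior (by omega) hj))
      · left
        rw [hj, SimpleGraph.Walk.getVert_length]

/-- The inverse of a linear layout. -/
theorem _root_.IsLinearLayout.exists_position {n : ℕ} {E : ℕ → ℕ → Prop} {o : ℕ → ℕ}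
    (ho : IsLinearLayout n E o) :
    ∃ pos : ℕ → ℕ, (∀ v < n, pos v < n ∧ o (pos v) = v) ∧ ∀ i < n, pos (o i) = i := by
  classical
  have hsurj : ∀ v < n, ∃ i < n, o i = v := by
    have himg : (range n).image o = range n := by
      refine eq_of_subset_of_card_le (fun v hv => ?_) ?_
      · obtain ⟨i, hi, rfl⟩ := mem_image.1 hv
        exact mem_range.2 (ho i (mem_range.1 hi)).1
      · rw [card_image_of_injOn fun i hi j hj h =>
          ho.inj (mem_range.1 (mem_coe.1 hi)) (mem_range.1 (mem_coe.1 hj)) h]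
    intro v hv
    obtain ⟨i, hi, h⟩ := mem_image.1 (himg.symm ▸ mem_range.2 hv : v ∈ (range n).image o)
    exact ⟨i, mem_range.1 hi, h⟩
  choose! pos hpos using hsurj
  refine ⟨pos, hpos, fun i hi => ?_⟩
  have := hpos _ (ho i hi).1
  exact ho.inj this.1 hi this.2

theorem _root_.IsLinearLayout.adjacent {n : ℕ} {E : ℕ → ℕ → Prop} {o : ℕ → ℕ}
    (ho : IsLinearLayout n E o) (hsymm : ∀ u v, E u v → E v u) {i j : ℕ} (hi : i < n) (hj : j < n)
    (h : E (o i) (o j)) (hne : o i ≠ o j) : j = i + 1 ∨ i = j + 1 := by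
  rcases lt_trichotomy i j with hlt | rfl | hlt
  · exact .inl (((ho j hj).2 i hlt).2 h)
  · exact absurd rfl hne
  · exact .inr (((ho i hi).2 j hlt).2 (hsymm _ _ h))

theorem Adj.symm {u v : ℕ} (h : I.Adj u v) : I.Adj v u := by
  obtain ⟨hu, hv, ha⟩ := h
  exact ⟨hv, hu, ha.symm⟩

theorem RestAdj.symm {k x : ℕ} (u v : ℕ) (h : I.RestAdj k x u v) : I.RestAdj k x v u :=
  ⟨h.1.symm, h.2.2, h.2.1⟩

/-- An edge of a path between undeleted vertices survives the deletion, and surviving edges join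
consecutive positions. -/
theorem position_step {k x : ℕ} {o pos : ℕ → ℕ} (ho : IsLinearLayout I.n (I.RestAdj k x) o)
    (hpos : ∀ v < I.n, pos v < I.n ∧ o (pos v) = v) (p : I.G.Path I.s I.t) {j : ℕ} (hj : j < p.1.length)
    (h1 : ¬ I.Deleted k x (p.1.getVert j)) (h2 : ¬ I.Deleted k x (p.1.getVert (j + 1))) :
    pos (p.1.getVert (j + 1)) = pos (p.1.getVert j) + 1 ∨
      pos (p.1.getVert j) = pos (p.1.getVert (j + 1)) + 1 := by
  have hu := hpos _ (p.1.getVert j).2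
  have hv := hpos _ (p.1.getVert (j + 1)).2
  refine ho.adjacent RestAdj.symm hu.1 hv.1 ?_ ?_
  · rw [hu.2, hv.2]
    exact ⟨adj_getVert p hj, h1, h2⟩
  · rw [hu.2, hv.2]
    intro h
    have := getVert_val_inj (by omega) (by omega) h
    omega

end MaxCDPInstance

namespace MaxCDPInstance

variable {I : MaxCDPInstance}

/-- The internal vertices of a path that avoids the deleted vertices form a segment. -/
theorem exists_segment {k x : ℕ} {o : ℕ → ℕ} (ho : IsLinearLayout I.n (I.RestAdj k x) o)
    {p : I.G.Path I.s I.t} (hlen : p.1.length ≠ 1) (hp : ∀ v, Interior p v → ¬ I.Deleted k x v) :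
    ∃ a b, a ≤ b ∧ b < I.n ∧ ∀ v, I.Segment o a b v ↔ Interior p v := by
  obtain ⟨pos, hpos, hpos'⟩ := ho.exists_position
  have hlen0 := length_pos p
  -- The internal vertices have indices `1` to `length - 1`; this range is not empty as the length
  -- is not `1`.
  obtain ⟨a, b, hab, hx⟩ := exists_interval_of_steps (fun j => pos (p.1.getVert j))
    (p.1.length - 1) (by omega) fun j h1 h2 => position_step ho hpos p (by omega)
      (hp _ (getVert_interior h1 (by omega))) (hp _ (getVert_interior (by omega) (by omega)))
  refine ⟨a, b, hab, ?_, fun v => ⟨?_, fun hv => ?_⟩⟩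
  · obtain ⟨j, -, -, hj⟩ := (hx b).1 ⟨hab, le_rfl⟩
    rw [← hj]
    exact (hpos _ (p.1.getVert j).2).1
  · rintro ⟨q, hq, rfl, h1, h2⟩
    obtain ⟨j, hj1, hj2, hj⟩ := (hx q).1 ⟨h1, h2⟩
    have := (hpos _ (p.1.getVert j).2).2
    rw [← hj, this]
    exact getVert_interior hj1 (by omega)
  · obtain ⟨j, hj1, hj2, rfl⟩ := hv.exists_getVert
    have h := hpos _ (p.1.getVert j).2
    exact ⟨_, h.1, h.2, (hx _).2 ⟨j, hj1, by omega, rfl⟩⟩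

open Classical in
theorem card_deleted_le (k x : ℕ) : #{v ∈ range I.n | I.Deleted k x v} ≤ k + 2 := by
  have hsub : {v ∈ range I.n | I.Deleted k x v} ⊆
      insert (I.s : ℕ) (insert (I.t : ℕ) ((range k).image (digit I.base x))) := by
    intro v hv
    obtain ⟨-, h | h | ⟨i, hi, h⟩⟩ := mem_filter.1 hv
    · simp [h]
    · simp [h]
    · exact mem_insert_of_mem (mem_insert_of_mem (mem_image.2 ⟨i, mem_range.2 hi, h⟩))
  refine (card_le_card hsub).trans ((card_insert_le _ _).trans ?_)
  have h1 := card_insert_le (I.t : ℕ) ((range k).image (digit I.base x))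
  have h2 : #((range k).image (digit I.base x)) ≤ k := by simpa using card_image_le (s := range k)
  omega

/-- If the next position after that of an internal vertex is not that of an internal vertex, then
the vertex or one of its neighbours on the path is deleted. -/
theorem exists_deleted_near {k x : ℕ} {o : ℕ → ℕ} (ho : IsLinearLayout I.n (I.RestAdj k x) o)
    {p : I.G.Path I.s I.t} {i : ℕ} (hi : i < I.n) (h : Interior p (o i))
    (h' : ¬ (i + 1 < I.n ∧ Interior p (o (i + 1)))) :
    -- The values `0`, `1`, `2` of `δ` stand for the predecessor of the vertex on the path, the
    -- vertex itself and its successor.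
    ∃ j δ, δ < 3 ∧ 1 ≤ j ∧ j < p.1.length ∧ (p.1.getVert j : ℕ) = o i ∧
      I.Deleted k x (p.1.getVert (j + δ - 1)) := by
  obtain ⟨pos, hpos, hpos'⟩ := ho.exists_position
  obtain ⟨j, hj1, hj2, hj⟩ := h.exists_getVert
  by_contra hno
  push Not at hno
  have hd0 := hno j 0 (by omega) hj1 hj2 hj
  have hd1 := hno j 1 (by omega) hj1 hj2 hj
  have hd2 := hno j 2 (by omega) hj1 hj2 hj
  rw [Nat.add_zero] at hd0
  rw [Nat.add_sub_cancel] at hd1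
  rw [show j + 2 - 1 = j + 1 by omega] at hd2
  have hpi : pos (p.1.getVert j) = i := by rw [hj, hpos' i hi]
  -- As `s` and `t` count as deleted, undeleted neighbours on the path are internal vertices.
  have hprev : 1 ≤ j - 1 := by
    by_contra hlt
    have h0 : j - 1 = 0 := by omega
    rw [h0, SimpleGraph.Walk.getVert_zero] at hd0
    exact hd0 (.inl rfl)
  have hnext : j + 1 < p.1.length := by
    by_contra hlt
    rw [SimpleGraph.Walk.getVert_of_length_le _ (not_lt.1 hlt)] at hd2
    exact hd2 (.inr (.inl rfl))
  have hs1 := position_step ho hpos p (j := j - 1) (by omega) hd0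
    (by rwa [Nat.sub_add_cancel hj1])
  have hs2 := position_step ho hpos p (j := j) hj2 hd1 hd2
  rw [Nat.sub_add_cancel hj1] at hs1
  have ha := hpos _ (p.1.getVert (j - 1)).2
  have hb := hpos _ (p.1.getVert (j + 1)).2
  -- Both neighbours on the path are at distance one from position `i` and they differ, so one of
  -- them is at `i + 1`, contrary to assumption.
  have hne : pos (p.1.getVert (j - 1)) ≠ pos (p.1.getVert (j + 1)) := fun he => by
    have := getVert_val_inj (p := p) (i := j - 1) (j := j + 1) (by omega) (by omega)
      (by rw [← ha.2, he, hb.2])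
    omega
  have hcases : pos (p.1.getVert (j - 1)) = i + 1 ∨ pos (p.1.getVert (j + 1)) = i + 1 := by omega
  rcases hcases with hc | hc
  · rw [hc] at ha
    exact h' ⟨ha.1, ha.2 ▸ getVert_interior hprev (by omega)⟩
  · rw [hc] at hb
    exact h' ⟨hb.1, hb.2 ▸ getVert_interior (by omega) hnext⟩

/-- The internal vertices of a path are covered by few segments. -/
theorem exists_segments {k x : ℕ} {o : ℕ → ℕ} (ho : IsLinearLayout I.n (I.RestAdj k x) o)
    (p : I.G.Path I.s I.t) : ∃ lo hi : ℕ → ℕ, (∀ i, lo i < I.n ∧ hi i < I.n) ∧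
      ∀ v, (∃ i < 3 * k + 6, I.Segment o (lo i) (hi i) v) ↔ Interior p v := by
  classical
  obtain ⟨pos, hpos, hpos'⟩ := ho.exists_position
  set S := {i ∈ range I.n | Interior p (o i)} with hS
  have hcard : #{i ∈ S | i + 1 ∉ S} ≤ 3 * k + 6 := by
    have hnear : ∀ i ∈ {i ∈ S | i + 1 ∉ S}, ∃ j δ, δ < 3 ∧ 1 ≤ j ∧ j < p.1.length ∧
        (p.1.getVert j : ℕ) = o i ∧ I.Deleted k x (p.1.getVert (j + δ - 1)) := by
      intro i hi
      obtain ⟨h1, h2⟩ := mem_filter.1 hi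
      obtain ⟨h3, h4⟩ := mem_filter.1 h1
      exact exists_deleted_near ho (mem_range.1 h3) h4
        fun h => h2 (mem_filter.2 ⟨mem_range.2 h.1, h.2⟩)
    choose! j δ hδ hj1 hj2 hj hd using hnear
    -- Each right end of a run is charged to a nearby deleted vertex together with the offset `δ`.
    -- This pair determines the index on the path and hence the position, so there are at most `(k +
    -- 2) * 3` right ends.
    calc #{i ∈ S | i + 1 ∉ S} ≤ #({v ∈ range I.n | I.Deleted k x v} ×ˢ range 3) := by
          refine card_le_card_of_injOn (fun i => (p.1.getVert (j i + δ i - 1), δ i))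
            (fun i hi => ?_) fun i hi i' hi' heq => ?_
          · exact mem_coe.2 (mem_product.2 ⟨mem_filter.2 ⟨mem_range.2 (p.1.getVert _).2, hd i hi⟩,
              mem_range.2 (hδ i hi)⟩)
          · obtain ⟨h1, h2⟩ := Prod.mk.inj heq
            have := hj2 i hi
            have := hj2 i' hi'
            have := hj1 i hi
            have := hj1 i' hi'
            have := hδ i hi
            have := hδ i' hi'
            have h3 := getVert_val_inj (p := p) (by omega) (by omega) h1
            have h4 : j i = j i' := by omega
            refine ho.inj (mem_range.1 (mem_filter.1 (mem_filter.1 hi).1).1)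
              (mem_range.1 (mem_filter.1 (mem_filter.1 hi').1).1) ?_
            rw [← hj i hi, ← hj i' hi', h4]
      _ ≤ 3 * k + 6 := by
          rw [card_product, card_range]
          have := card_deleted_le (I := I) k x
          omega
  obtain ⟨lo, hi, hlt, hmem⟩ := exists_intervals S (n := I.n)
    (fun i hi => mem_range.1 (mem_filter.1 hi).1) I.two_le_n hcard
  refine ⟨lo, hi, hlt, fun v => ⟨?_, fun hv => ?_⟩⟩
  · rintro ⟨i, him, q, hq, rfl, h1, h2⟩
    exact (mem_filter.1 ((hmem q).2 ⟨i, him, h1, h2⟩)).2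
  · obtain ⟨hq, hov⟩ := hpos v hv.lt
    obtain ⟨i, him, h1, h2⟩ := (hmem (pos v)).1
      (mem_filter.2 ⟨mem_range.2 hq, by rwa [hov]⟩)
    exact ⟨i, him, pos v, hq, hov, h1, h2⟩

theorem Interior.not_of_disjoint {P : Finset (I.G.Path I.s I.t)}
    (hP : IsDisjointUniColorFamily I.f P) {p r : I.G.Path I.s I.t} (hp : p ∈ P) (hr : r ∈ P)
    (hne : p ≠ r) {v : ℕ} (hv : Interior p v) : ¬ Interior r v := by
  rintro ⟨hv', hmem', -, -⟩
  obtain ⟨_, hmem, h1, h2⟩ := hv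
  rcases hP.2 p hp r hr hne _ hmem hmem' with h | h
  · exact h1 (congrArg Fin.val h)
  · exact h2 (congrArg Fin.val h)

open Classical in
theorem card_direct_le {P : Finset (I.G.Path I.s I.t)} (hP : IsDisjointUniColorFamily I.f P) :
    #{p ∈ P | p.1.length = 1} ≤ I.direct := by
  rcases eq_empty_or_nonempty {p ∈ P | p.1.length = 1} with h | ⟨p, hp⟩
  · simp [h]
  · obtain ⟨hpP, hlen⟩ := mem_filter.1 hp
    obtain ⟨c, hc⟩ := hP.1 p hpP
    have hcol := hasColor_getVert hc (j := 0) (by omega)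
    rw [SimpleGraph.Walk.getVert_zero, SimpleGraph.Walk.getVert_of_length_le _ (by omega)] at hcol
    rw [direct, if_pos ⟨c, c.2, hcol⟩]
    refine card_le_one.2 fun r hr r' hr' => Subtype.ext ?_
    exact SimpleGraph.Walk.eq_of_length_eq_one (mem_filter.1 hr).2 (mem_filter.1 hr').2

/-- Every disjoint family of uni-colour paths is described by a certificate. -/
theorem exists_certificate {k x : ℕ} {o : ℕ → ℕ} (ho : IsLinearLayout I.n (I.RestAdj k x) o)
    {P : Finset (I.G.Path I.s I.t)} (hP : IsDisjointUniColorFamily I.f P) :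
    ∃ r ≤ k, ∃ col < I.base ^ (k * (3 * k + 6)), ∃ lo < I.base ^ (k * (3 * k + 6)),
      ∃ hi < I.base ^ (k * (3 * k + 6)), I.IsCertificate o (3 * k + 6) r col lo hi #P := by
  classical
  set m := 3 * k + 6 with hm
  set Q := {p ∈ P | ¬ p.1.length = 1} with hQ
  set PX := {p ∈ Q | ∃ v, Interior p v ∧ I.Deleted k x v} with hPX
  set P1 := {p ∈ Q | ¬ ∃ v, Interior p v ∧ I.Deleted k x v} with hP1
  have hPXP : ∀ p ∈ PX, p ∈ P ∧ p.1.length ≠ 1 := fun p hp => mem_filter.1 (mem_filter.1 hp).1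
  have hP1P : ∀ p ∈ P1, p ∈ P ∧ p.1.length ≠ 1 := fun p hp => mem_filter.1 (mem_filter.1 hp).1
  have hcards : #P = #PX + #P1 + #{p ∈ P | p.1.length = 1} := by
    rw [hPX, hP1, card_filter_add_card_filter_not, hQ, add_comm, card_filter_add_card_filter_not]
  -- few paths meet the deleted vertices
  have hr : #PX ≤ k := by
    have hidx : ∀ p ∈ PX, ∃ i < k, Interior p (digit I.base x i) := by
      intro p hp
      obtain ⟨-, v, hv, hd⟩ := mem_filter.1 hp
      rcases hd with h | h | ⟨i, hi, h⟩
      · exact absurd h hv.2.2.1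
      · exact absurd h hv.2.2.2
      · exact ⟨i, hi, h ▸ hv⟩
    choose! i hi hint using hidx
    calc #PX ≤ #(range k) := card_le_card_of_injOn i (fun p hp => mem_coe.2 (mem_range.2 (hi p hp)))
          fun p hp p' hp' h => by
            by_contra hne
            have h1 := hint p hp
            rw [h] at h1
            exact h1.not_of_disjoint hP (hPXP p hp).1 (hPXP p' hp').1 hne (hint p' hp')
      _ = k := card_range k
  -- The enumeration `pp` below needs a default path, so the case without any `st`-path is settled
  -- separately.
  obtain hempty | hnonempty := isEmpty_or_nonempty (I.G.Path I.s I.t)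
  · have hP0 : P = ∅ := eq_empty_of_forall_notMem fun p _ => hempty.elim p
    have hpow : 0 < I.base ^ (k * m) := Nat.pow_pos (by have := I.two_le_base; omega)
    exact ⟨0, Nat.zero_le k, 0, hpow, 0, hpow, 0, hpow, fun a ha => absurd ha (by omega),
      fun a ha => absurd ha (by omega), by simp [hP0]⟩
  -- enumeration of the paths that meet the deleted vertices
  let pp : ℕ → I.G.Path I.s I.t := fun a =>
    if h : a < #PX then (PX.equivFin.symm ⟨a, h⟩ : I.G.Path I.s I.t) else hnonempty.some
  have hpp : ∀ a < #PX, pp a ∈ PX := fun a ha => by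
    simp only [pp, dif_pos ha]
    exact (PX.equivFin.symm ⟨a, ha⟩).2
  have hppinj : ∀ a < #PX, ∀ b < #PX, pp a = pp b → a = b := fun a ha b hb h => by
    simp only [pp, dif_pos ha, dif_pos hb] at h
    have := PX.equivFin.symm.injective (Subtype.ext h)
    exact congrArg Fin.val this
  choose lo hi hlt hseg using fun p => exists_segments ho p
  have hcolor : ∀ p ∈ P, p.1.length ≠ 1 → ∃ c < I.q, ∀ S : ℕ → Prop,
      (∀ v, Interior p v → S v) → I.Linked c S := fun p hp hlen => exists_linked (hP.1 p hp) hlen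
  choose! color hcolor_lt hcolor_linked using hcolor
  have hnb : I.n ≤ I.base := Nat.le_add_right _ _
  obtain ⟨cc, hcc, hcc'⟩ := exists_digits (B := I.base) #PX (fun a => color (pp a)) fun a ha =>
    (hcolor_lt _ (hPXP _ (hpp a ha)).1 (hPXP _ (hpp a ha)).2).trans_le (Nat.le_add_left _ _)
  -- Digit `a * m + i` codes an end point of segment `i` of path `a`.
  obtain ⟨cl, hcl, hcl'⟩ := exists_digits (B := I.base) (k * m) (fun i => lo (pp (i / m)) (i % m))
    fun i _ => (hlt _ _).1.trans_le hnb
  obtain ⟨ch, hch, hch'⟩ := exists_digits (B := I.base) (k * m) (fun i => hi (pp (i / m)) (i % m))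
    fun i _ => (hlt _ _).2.trans_le hnb
  have hterr : ∀ a < #PX, ∀ v, I.Territory o m cl ch a v ↔ Interior (pp a) v := by
    intro a ha v
    rw [← hseg (pp a) v]
    refine exists_congr fun i => and_congr_right fun him => ?_
    have h1 : a * m + i < k * m := by
      have : (a + 1) * m ≤ k * m := Nat.mul_le_mul_right _ (by omega)
      rw [Nat.succ_mul] at this
      omega
    have h2 : (a * m + i) / m = a := by
      rw [mul_comm, Nat.mul_add_div (by omega), Nat.div_eq_of_lt him, add_zero]
    have h3 : (a * m + i) % m = i := by
      rw [mul_comm, Nat.mul_add_mod, Nat.mod_eq_of_lt him]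
    rw [hcl' _ h1, hch' _ h1, h2, h3]
  refine ⟨#PX, hr, cc, ?_, cl, hcl, ch, hch, fun a ha => ?_, fun a ha b hb v hv => ?_, ?_⟩
  · refine hcc.trans_le (Nat.pow_le_pow_right (by have := I.two_le_base; omega) (hr.trans ?_))
    exact Nat.le_mul_of_pos_right _ (by omega)
  · rw [hcc' a ha]
    exact hcolor_linked _ (hPXP _ (hpp a ha)).1 (hPXP _ (hpp a ha)).2 _ fun v => (hterr a ha v).2
  · rintro ⟨h1, h2⟩
    rw [hterr a ha] at h1
    rw [hterr b (by omega)] at h2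
    refine h1.not_of_disjoint hP (hPXP _ (hpp a ha)).1 (hPXP _ (hpp b (by omega))).1 (fun h => ?_) h2
    have := hppinj a ha b (by omega) h
    omega
  · have hint : ∀ p ∈ P1, ∃ ab : ℕ × ℕ, ab.1 ≤ ab.2 ∧ ab.2 < I.n ∧
        ∀ v, I.Segment o ab.1 ab.2 v ↔ Interior p v := by
      intro p hp
      obtain ⟨a, b, h⟩ := exists_segment ho (hP1P p hp).2 fun v hv hd =>
        (mem_filter.1 hp).2 ⟨v, hv, hd⟩
      exact ⟨(a, b), h⟩
    choose! ab hab1 hab2 hab using hint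
    have hsep : ∀ p ∈ P1, ∀ p' ∈ P1, p ≠ p' → (ab p).2 < (ab p').1 ∨ (ab p').2 < (ab p).1 := by
      -- Two overlapping intervals share the larger of their left ends, and the vertex there would
      -- be internal to both paths.
      intro p hp p' hp' hne
      by_contra hcon
      have h1 := hab1 p hp
      have h2 := hab1 p' hp'
      have h3 := hab2 p hp
      have h4 := hab2 p' hp'
      have h5 : I.Segment o (ab p).1 (ab p).2 (o (max (ab p).1 (ab p').1)) :=
        ⟨_, by omega, rfl, by omega, by omega⟩
      have h6 : I.Segment o (ab p').1 (ab p').2 (o (max (ab p).1 (ab p').1)) :=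
        ⟨_, by omega, rfl, by omega, by omega⟩
      exact ((hab p hp _).1 h5).not_of_disjoint hP (hP1P p hp).1 (hP1P p' hp').1 hne
        ((hab p' hp' _).1 h6)
    have hinj : Set.InjOn ab P1 := fun p hp p' hp' h => by
      by_contra hne
      have h1 := hsep p hp p' hp' hne
      have h2 := hab1 p hp
      have h3 := hab1 p' hp'
      rw [h] at h1 h2
      omega
    have hpack : IsIntervalPacking (I.Good o m #PX cl ch) (P1.image ab) I.n := by
      refine ⟨fun q hq => ?_, fun q hq q' hq' hne => ?_⟩
      · obtain ⟨p, hp, rfl⟩ := mem_image.1 hq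
        refine ⟨hab1 p hp, hab2 p hp, fun v _ hv a ha ht => ?_, color p,
          hcolor_lt _ (hP1P p hp).1 (hP1P p hp).2,
          hcolor_linked _ (hP1P p hp).1 (hP1P p hp).2 _ fun v => (hab p hp v).2⟩
        rw [hterr a ha] at ht
        refine ht.not_of_disjoint hP (hPXP _ (hpp a ha)).1 (hP1P p hp).1 (fun h => ?_)
          ((hab p hp v).1 hv)
        exact (mem_filter.1 hp).2 (h ▸ (mem_filter.1 (hpp a ha)).2)
      · obtain ⟨p, hp, rfl⟩ := mem_image.1 hq
        obtain ⟨p', hp', rfl⟩ := mem_image.1 hq'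
        exact hsep p hp p' hp' fun h => hne (h ▸ rfl)
    have h1 := hpack.card_le
    rw [card_image_of_injOn hinj] at h1
    have h2 := card_direct_le hP
    omega

end MaxCDPInstance

/-! ### From a minimum deletion set to a successful search -/

/-- In a disjoint union of paths, the position on the path is a rank function. -/
theorem SimpleGraph.IsDisjointUnionOfPaths.exists_rank {V : Type*} {H : SimpleGraph V}
    (h : H.IsDisjointUnionOfPaths) : ∃ rank : V → ℕ,
      (∀ u v, H.Adj u v → rank u = rank v + 1 ∨ rank v = rank u + 1) ∧
      ∀ u v w, H.Adj u v → H.Adj u w → rank v = rank w → v = w := by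
  choose k φ using h
  let ψ : ∀ K, K.toSimpleGraph ≃g SimpleGraph.pathGraph (k K) := fun K => (φ K).some
  let rank : V → ℕ := fun v => ψ (H.connectedComponentMk v) ⟨v, rfl⟩
  have hrank : ∀ K v, ∀ hv : v ∈ K, rank v = ψ K ⟨v, hv⟩ := by
    rintro K v rfl
    rfl
  have hmem : ∀ u v, H.Adj u v → v ∈ H.connectedComponentMk u := fun u v huv =>
    (SimpleGraph.ConnectedComponent.connectedComponentMk_eq_of_adj huv).symm
  refine ⟨rank, fun u v huv => ?_, fun u v w huv huw heq => ?_⟩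
  · have hadj : (H.connectedComponentMk u).toSimpleGraph.Adj ⟨u, rfl⟩ ⟨v, hmem u v huv⟩ :=
      (SimpleGraph.ConnectedComponent.toSimpleGraph_adj _ _ _).2 huv
    have := SimpleGraph.pathGraph_adj.1 ((ψ _).map_adj_iff.2 hadj)
    rw [hrank _ u rfl, hrank _ v (hmem u v huv)]
    omega
  · rw [hrank _ v (hmem u v huv), hrank _ w (hmem u w huw)] at heq
    exact congrArg Subtype.val ((ψ _).injective (Fin.ext heq))

namespace MaxCDPInstance

variable {I : MaxCDPInstance}

/-- Some code of deleted vertices, as many as the distance to disjoint paths, has a linear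
layout. -/
theorem exists_isLinearLayout (I : MaxCDPInstance) : ∃ x < I.base ^ I.distToPaths,
    IsLinearLayout I.n (I.RestAdj I.distToPaths x) (I.order I.distToPaths x) := by
  classical
  obtain ⟨X, hXcard, hX⟩ := I.G.distToDisjointPaths_spec.1
  change #X = I.distToPaths at hXcard
  obtain ⟨rank, h1, h2⟩ := hX.exists_rank
  have hX0 : ∀ i < I.distToPaths, i < #X := fun i hi => hXcard ▸ hi
  obtain ⟨x, hx, hx'⟩ := exists_digits (B := I.base) I.distToPaths
    (fun i => if h : i < #X then ((X.equivFin.symm ⟨i, h⟩ : Fin I.n) : ℕ) else 0) fun i hi => by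
      rw [dif_pos (hX0 i hi)]
      exact (Fin.is_lt _).trans_le (Nat.le_add_right _ _)
  -- Only this inclusion is needed: deleting further vertices, such as `s` and `t`, removes edges
  -- and cannot spoil the rank function.
  have hdel : ∀ v : Fin I.n, ¬ I.Deleted I.distToPaths x v → v ∉ X := by
    intro v hv hmem
    refine hv (.inr (.inr ⟨X.equivFin ⟨v, hmem⟩, ?_, ?_⟩))
    · rw [← hXcard]
      exact (X.equivFin ⟨v, hmem⟩).2
    · rw [hx' _ (by rw [← hXcard]; exact (X.equivFin ⟨v, hmem⟩).2),
        dif_pos (X.equivFin ⟨v, hmem⟩).2]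
      simp
  have hadj : ∀ u v, I.RestAdj I.distToPaths x u v → ∃ (hu : u < I.n) (hv : v < I.n)
      (hu' : (⟨u, hu⟩ : Fin I.n) ∉ X) (hv' : (⟨v, hv⟩ : Fin I.n) ∉ X),
      (I.G.induce {v | v ∉ X}).Adj ⟨⟨u, hu⟩, hu'⟩ ⟨⟨v, hv⟩, hv'⟩ := by
    rintro u v ⟨⟨hu, hv, h⟩, hdu, hdv⟩
    exact ⟨hu, hv, hdel ⟨u, hu⟩ hdu, hdel ⟨v, hv⟩ hdv, h⟩
  -- The default rank is immaterial, since vertices in `X` have no edges left.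
  let rk : ℕ → ℕ := fun v => if h : ∃ hv : v < I.n, (⟨v, hv⟩ : Fin I.n) ∉ X then
    rank ⟨⟨v, h.1⟩, h.2⟩ else 0
  have hrk : ∀ v (hv : v < I.n) (hv' : (⟨v, hv⟩ : Fin I.n) ∉ X), rk v = rank ⟨⟨v, hv⟩, hv'⟩ :=
    fun v hv hv' => dif_pos ⟨hv, hv'⟩
  refine ⟨x, hx, isLinearLayout_layout RestAdj.symm rk (fun u v h => ?_) fun u v w hv hw heq => ?_⟩
  · obtain ⟨hu, hv, hu', hv', ha⟩ := hadj u v h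
    rw [hrk u hu hu', hrk v hv hv']
    exact h1 _ _ ha
  · obtain ⟨_, hv1, _, hv2, ha⟩ := hadj u v hv
    obtain ⟨_, hw1, _, hw2, hb⟩ := hadj u w hw
    rw [hrk v hv1 hv2, hrk w hw1 hw2] at heq
    have := h2 _ _ _ ha hb heq
    simpa using this

/-- Once `N` exceeds these bounds, `k = d(G)` and a minimum deletion set are among the attempts. The
certificate of the empty family is enough, by `Feasible.of_family`. -/
theorem exists_feasible {N : ℕ} (hN : I.base ^ (I.distToPaths * (3 * I.distToPaths + 6)) ≤ N)
    (hN' : I.distToPaths * (3 * I.distToPaths + 6) + (3 * I.distToPaths + 6) < N) :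
    I.Feasible N 0 := by
  obtain ⟨x, hx, ho⟩ := I.exists_isLinearLayout
  obtain ⟨r, hr, col, hcol, lo, hlo, hi, hhi, hc⟩ := exists_certificate ho
    (P := ∅) ⟨by simp, by simp⟩
  have hx' : x < N := hx.trans_le ((Nat.pow_le_pow_right (by have := I.two_le_base; omega)
    (Nat.le_mul_of_pos_right _ (by omega))).trans hN)
  exact ⟨I.distToPaths, by omega, x, hx', _, by omega, _, by omega, rfl, rfl, hN, ho, r, by omega,
    hr, col, by omega, lo, by omega, hi, by omega, hc⟩

/-- An accepted attempt for any `z` provides a linear layout and `base ^ e ≤ N`. Every family has a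
certificate for this layout with codes below `base ^ e`, hence within the range of the search. So no
bound `N` gives a value between failure and the optimum. -/
theorem Feasible.of_family {N z : ℕ} (h : I.Feasible N z) {P : Finset (I.G.Path I.s I.t)}
    (hP : IsDisjointUniColorFamily I.f P) : I.Feasible N #P := by
  obtain ⟨k, hk, x, hx, m, hm, e, he, rfl, rfl, hpow, ho, -⟩ := h
  obtain ⟨r, hr, col, hcol, lo, hlo, hi, hhi, hc⟩ := exists_certificate ho hP
  exact ⟨k, hk, x, hx, _, hm, _, he, rfl, rfl, hpow, ho, r, by omega, hr, col, by omega, lo,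
    by omega, hi, by omega, hc⟩

theorem Feasible.mono {N z z' : ℕ} (h : I.Feasible N z) (hz : z' ≤ z) : I.Feasible N z' := by
  obtain ⟨k, hk, x, hx, m, hm, e, he, h1, h2, h3, h4, r, hr, hrk, col, hcol, lo, hlo, hi, hhi, h5, h6,
    h7⟩ := h
  exact ⟨k, hk, x, hx, m, hm, e, he, h1, h2, h3, h4, r, hr, hrk, col, hcol, lo, hlo, hi, hhi, h5, h6,
    hz.trans h7⟩

/-! ### The optimum and the value of the search -/

/-- The second vertices of disjoint paths are distinct. -/
theorem card_family_le {P : Finset (I.G.Path I.s I.t)} (hP : IsDisjointUniColorFamily I.f P) :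
    #P ≤ I.n := by
  classical
  have h : #P ≤ #(univ : Finset (Fin I.n)) := by
    refine card_le_card_of_injOn (fun p => p.1.getVert 1) (fun _ _ => mem_coe.2 (mem_univ _))
      fun p hp r hr heq => ?_
    by_contra hne
    have hmem : p.1.getVert 1 ∈ r.1.support := by
      rw [show p.1.getVert 1 = r.1.getVert 1 from heq]
      exact r.1.getVert_mem_support 1
    have hp0 := length_pos p
    have hr0 := length_pos r
    rcases hP.2 p hp r hr hne _ (p.1.getVert_mem_support 1) hmem with h | h
    · have := (p.2.getVert_eq_start_iff (i := 1) (by omega)).1 h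
      omega
    · have h1 := (p.2.getVert_eq_end_iff (i := 1) (by omega)).1 h
      have h2 := (r.2.getVert_eq_end_iff (i := 1) (by omega)).1
        ((show p.1.getVert 1 = r.1.getVert 1 from heq) ▸ h)
      exact hne (Subtype.ext (SimpleGraph.Walk.eq_of_length_eq_one h1.symm h2.symm))
  simpa using h

theorem exists_isOptimum (I : MaxCDPInstance) : ∃ z, I.IsOptimum z := by
  have hbdd : BddAbove {k | ∃ P : Finset (I.G.Path I.s I.t),
      IsDisjointUniColorFamily I.f P ∧ P.card = k} :=
    ⟨I.n, by rintro _ ⟨P, hP, rfl⟩; exact card_family_le hP⟩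
  exact ⟨_, Nat.sSup_mem ⟨0, ∅, ⟨by simp, by simp⟩, rfl⟩ hbdd, fun _ h => le_csSup hbdd h⟩

theorem IsOptimum.le_n {z : ℕ} (h : I.IsOptimum z) : z ≤ I.n := by
  obtain ⟨P, hP, rfl⟩ := h.1
  exact card_family_le hP

/-- The feasible numbers are exactly those from `0` to `opt`; as `opt ≤ n < N`, none is lost by
counting below `N`. -/
theorem searchResult_eq {N opt : ℕ} (hN : I.n < N) (hopt : I.IsOptimum opt)
    (h : I.Feasible N 0) : I.searchResult N = opt + 1 := by
  classical
  have hfeas : I.Feasible N opt := by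
    obtain ⟨P, hP, rfl⟩ := hopt.1
    exact h.of_family hP
  have : {z ∈ range N | I.Feasible N z} = range (opt + 1) := by
    ext z
    rw [mem_filter, mem_range, mem_range]
    refine ⟨fun hz => ?_, fun hz => ⟨?_, hfeas.mono (by omega)⟩⟩
    · obtain ⟨P, hP, hle⟩ := hz.2.exists_family
      have := hopt.2 ⟨P, hP, rfl⟩
      omega
    · have := hopt.le_n
      omega
  rw [searchResult]
  convert card_range (opt + 1)

theorem isOptimum_of_searchResult {N z : ℕ} (hN : I.n < N) (h : I.searchResult N = z + 1) :
    I.IsOptimum z := by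
  classical
  obtain ⟨opt, hopt⟩ := I.exists_isOptimum
  have hfeas : I.Feasible N 0 := by
    have hne : {z ∈ range N | I.Feasible N z}.Nonempty := by
      rw [← card_pos]
      rw [searchResult] at h
      convert Nat.succ_pos z
    obtain ⟨z', hz'⟩ := hne
    exact (mem_filter.1 hz').2.mono (Nat.zero_le _)
  have := searchResult_eq hN hopt hfeas
  have hz : opt = z := by omega
  exact hz ▸ hopt

theorem n_lt_length (I : MaxCDPInstance) : I.n + I.q < I.encode.length := by
  rw [I.encode_length]
  have h2 := I.two_le_n
  have h4 : 1 * I.q ≤ I.n * I.n * I.q := Nat.mul_le_mul_right _ (by nlinarith)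
  have h5 : I.n * 1 ≤ I.n * I.n := Nat.mul_le_mul_left _ (by omega)
  omega

end MaxCDPInstance

theorem mainTheorem4 :
    RAM.InXP MaxCDPInstance.encode MaxCDPInstance.IsOptimum MaxCDPInstance.distToPaths := by
  obtain ⟨t, ht⟩ := RAM.exists_searchTerm
  -- The first summand yields `base ^ (d * (3 * d + 6)) ≤ N`. The second makes the exponent `e + m`
  -- for `e = d * (3 * d + 6)` and `m = 3 * d + 6`; an exponent is less than its power, so `e` and
  -- `m` are within the range of the search as well.
  refine RAM.inXP_of_term t (fun d => d * (3 * d + 6) + (3 * d + 6)) (fun I => ?_)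
    (fun I N z hN hz => ?_) fun I N hN hpow => ?_
  · have := I.n_lt_length
    have := I.two_le_n
    omega
  · have := I.n_lt_length
    rw [ht I N hN] at hz
    exact I.isOptimum_of_searchResult (by omega) hz
  · obtain ⟨opt, hopt⟩ := I.exists_isOptimum
    have hlen := I.n_lt_length
    have hsize := RAM.length_le_inputSize I.encode
    have hbase : I.base ≤ RAM.inputSize I.encode := by
      rw [MaxCDPInstance.base]
      omega
    have h2 := I.two_le_base
    rw [ht I N hN, MaxCDPInstance.searchResult_eq (by omega) hopt
      (MaxCDPInstance.exists_feasible ?_ ?_)]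
    · exact Nat.succ_ne_zero opt
    · exact ((Nat.pow_le_pow_left hbase _).trans
        (Nat.pow_le_pow_right (by omega) (Nat.le_add_right _ _))).trans hpow
    · exact (Nat.lt_pow_self (by omega)).trans_le hpow
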